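/- Let $\Lambda=\mathbb Z\omega_1+\mathbb Z\omega_2\subset\mathbb C$ be a lattice, $T=\mathbb C/\Lambda$, and let $\rho:C_2\times C_2\to\mathrm{Aut}(\mathfrak{sl}_2)$ and $\sigma:C_2\times C_2\to\mathrm{Aut}(T)$ (Lie algebra automorphisms of $\mathfrak{sl}_2=\mathfrak{sl}_2(\mathbb C)$, biholomorphisms of $T$) be injective homomorphisms such that $T/\sigma(C_2\times C_2)$ has genus $1$ (equivalently, $C_2\times C_2$ acts on $T$ by the half-period translations). Put $\mathbb T=T\setminus\sigma(C_2\times C_2)\cdot\{0\}$, let $\mathcal O_{\mathbb T}$ be the algebra of meromorphic functions on $T$ that are holomorphic on $\mathbb T$, with the action $\tilde\sigma(\gamma)f=f\circ\sigma(\gamma)^{-1}$, and let $$\mathfrak A=(\mathfrak{sl}_2\otimes_{\mathbb C}\mathcal O_{\mathbb T})^{\rho\otimes\tilde\sigma(C_2\times C_2)}$$ be the Lie algebra of elements fixed by $\gamma\cdot(A\otimes f)=\rho(\gamma)A\otimes\tilde\sigma(\gamma)f$, $\gamma\in C_2\times C_2$. (1) $\mathcal O_{\mathbb T}^{\tilde\sigma(C_2\times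 C_2)}=\mathbb C[\wp_{\Lambda/2},\wp'_{\Lambda/2}]$, and as complex Lie algebras $$\mathfrak A\cong\mathfrak{sl}_2\otimes_{\mathbb C}\mathcal O_{\mathbb T}^{\tilde\sigma(C_2\times C_2)}=\mathfrak{sl}_2\otimes_{\mathbb C}\mathbb C[\wp_{\Lambda/2},\wp'_{\Lambda/2}]\cong\mathfrak C_{\Lambda/2},$$ where $\mathfrak C_{\Lambda/2}=\mathfrak{sl}_2\otimes_{\mathbb C}\mathbb C[x,y]/(y^2-4x^3+g_2(\Lambda/2)x+g_3(\Lambda/2))$. (2) Write $\wp=\wp_\Lambda$, $e_1=\wp(\tfrac{\omega_1}2)$, $e_2=\wp(\tfrac{\omega_2}2)$, $e_3=\wp(\tfrac{\omega_1+\omega_2}2)$, and for $(a,b)\in\{\pm1\}^2$ $$p_{a,b}(z)=\frac1{\wp'(z)}+\frac a{\wp'(z-\frac{\omega_1}2)}+\frac b{\wp'(z-\frac{\omega_2}2)}+\frac{ab}{\wp'(z-\frac{\omega_1+\omega_2}2)},\qquad p_0=p_{-1,-1},\ p_1=p_{-1,1},\ p_2=p_{1,-1}.$$ Let $\alpha_1=\big(\tfrac{e_1-e_3}{e_2-e_3}\big)^2$,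 $\alpha_2=\tfrac4{(e_1-e_2)(e_2-e_3)^2}$, $\beta_1=\big(\tfrac{e_1-e_2}{e_2-e_3}\big)^2$, $\beta_2=\tfrac4{(e_1-e_3)(e_2-e_3)^2}$. Choose any $A,B\in\mathbb C$ with $A^2=\big(\tfrac{e_1-e_3}{e_2-e_3}\big)^3$, $B^2=\big(\tfrac{e_1-e_2}{e_2-e_3}\big)^3$, and let $\kappa=AB\big(\tfrac{\alpha_2}{\alpha_1}-\tfrac{\beta_2}{\beta_1}\big)$; then $\kappa^2=\alpha_2\beta_2$. There are functions $\xi_\pm$ on $\mathbb C\setminus\frac12\Lambda$ (no continuity is required) with $$\xi_\pm^2=\tfrac A{\alpha_1}p_1\pm\tfrac B{\beta_1}p_0,\qquad \xi_-\xi_+=p_2,$$ and for any such functions the matrix $$\Omega=\begin{pmatrix}\xi_-&\frac1{2\kappa}(Ap_0-Bp_1)\,\xi_+\\ \xi_+&\frac1{2\kappa}(Ap_0+Bp_1)\,\xi_-\end{pmatrix}$$ has determinant $1$ on $\mathbb C\setminus\frac12\Lambda$, and $\Psi=\mathrm{Ad}(\Omega)$, i.e. $(\Psi a)(z)=\Omega(z)a(z)\Omega(z)^{-1}$,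 is a well-defined $\mathcal O_{\mathbb T}$-linear Lie algebra automorphism of $\mathfrak{sl}_2\otimes\mathcal O_{\mathbb T}$. (3) There is $\theta\in\mathrm{Aut}(\mathfrak{sl}_2)$, independent of the choices of $A,B,\xi_\pm$, such that $\theta\circ\Psi(\sigma(\gamma)x)=\rho(\gamma)\circ\theta\circ\Psi(x)$ for all $\gamma\in C_2\times C_2$, $x\in\mathbb T$, and such that, with $h,e,f$ the standard basis of $\mathfrak{sl}_2$, the elements $h'=\theta\Psi h$, $e'=\theta\Psi e$, $f'=\theta\Psi f$ satisfy $$\mathfrak A=\mathbb C\langle h',e',f'\rangle\otimes_{\mathbb C}\mathbb C[\wp_{\Lambda/2},\wp'_{\Lambda/2}],\qquad [h',e']=2e',\quad[h',f']=-2f',\quad[e',f']=h',$$ i.e. $h',e',f'$ is a basis of $\mathfrak A$ as a module over $\mathcal O_{\mathbb T}^{\tilde\sigma(C_2\times C_2)}$. If, for the generators $r_1,r_2$ of the two factors of $C_2\times C_2$, the actions are in the standard position $$\rho(r_1)\begin{pmatrix}a&b\\c&-a\end{pmatrix}=\begin{pmatrix}a&-b\\-c&-a\end{pmatrix},\quad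 \rho(r_2)\begin{pmatrix}a&b\\c&-a\end{pmatrix}=\begin{pmatrix}-a&-c\\-b&a\end{pmatrix},\quad \sigma(r_1)z=z+\tfrac{\omega_1}2,\quad\sigma(r_2)z=z+\tfrac{\omega_2}2,$$ one may take $\theta=1$, so that $h'=\Psi h$, $e'=\Psi e$, $f'=\Psi f$. -/

import Mathlib

open scoped TensorProduct Topology

noncomputable section

namespace ALia

/-! ### Complex tori and their biholomorphisms -/

/-- The complex torus `ℂ / Λ` of a lattice `Λ = ℤ ω₁ + ℤ ω₂`. -/
abbrev Torus (L : PeriodPair) : Type := ℂ ⧸ L.lattice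

/-- The projection `ℂ → ℂ / Λ`. -/
def proj (L : PeriodPair) (z : ℂ) : Torus L := Submodule.Quotient.mk z

/-- A map between complex tori is holomorphic if, near every point, it lifts along the projections
to a holomorphic map of `ℂ` (local sections of the projection are the charts of a torus). -/
def IsHolomorphic {L L' : PeriodPair} (F : Torus L → Torus L') : Prop :=
  ∀ z : ℂ, ∃ s : ℂ → ℂ, AnalyticAt ℂ s z ∧ ∀ᶠ w in 𝓝 z, F (proj L w) = proj L' (s w)

theorem isHolomorphic_id (L : PeriodPair) : IsHolomorphic (fun x : Torus L => x) :=
  fun _ => ⟨id, analyticAt_id, Filter.Eventually.of_forall fun _ => rfl⟩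

theorem IsHolomorphic.lift_apply {L L' : PeriodPair} {F : Torus L → Torus L'} {s : ℂ → ℂ} {z : ℂ}
    (h : ∀ᶠ w in 𝓝 z, F (proj L w) = proj L' (s w)) : F (proj L z) = proj L' (s z) :=
  h.self_of_nhds

theorem IsHolomorphic.comp {L L' L'' : PeriodPair} {G : Torus L' → Torus L''}
    {F : Torus L → Torus L'} (hG : IsHolomorphic G) (hF : IsHolomorphic F) :
    IsHolomorphic (fun x => G (F x)) := by
  intro z
  obtain ⟨s, hs, hs'⟩ := hF z
  obtain ⟨t, ht, ht'⟩ := hG (s z)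
  refine ⟨fun w => t (s w), ht.comp hs, ?_⟩
  filter_upwards [hs', hs.continuousAt.eventually ht'] with w h1 h2
  rw [h1, h2]

/-- The group `Aut(T)` of biholomorphisms of the torus `T = ℂ / Λ`. -/
def TorusAut (L : PeriodPair) : Subgroup (Equiv.Perm (Torus L)) where
  carrier := {g | IsHolomorphic (fun x => g x) ∧ IsHolomorphic (fun x => g⁻¹ x)}
  mul_mem' := by
    rintro a b ⟨ha, ha'⟩ ⟨hb, hb'⟩
    refine ⟨ha.comp hb, ?_⟩
    simp only [mul_inv_rev]
    exact hb'.comp ha'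
  one_mem' := ⟨isHolomorphic_id L, isHolomorphic_id L⟩
  inv_mem' := by
    rintro a ⟨ha, ha'⟩
    exact ⟨ha', by simpa using ha⟩

/-! ### The symmetry group and its actions -/

/-- The group `C₂ × C₂`. -/
abbrev Klein : Type := Multiplicative (ZMod 2) × Multiplicative (ZMod 2)

/-- The generator of the first factor. -/
def r₁ : Klein := (Multiplicative.ofAdd 1, 1)

/-- The generator of the second factor. -/
def r₂ : Klein := (1, Multiplicative.ofAdd 1)

/-- The quotient `T / σ(C₂ × C₂)` has genus one. The quotient is a compact Riemann surface, so this
says that, as a topological surface, it is a product of two circles. -/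
def QuotientHasGenusOne {L : PeriodPair} (σ : Klein →* TorusAut L) : Prop :=
  Nonempty (MulAction.orbitRel.Quotient σ.range (Torus L) ≃ₜ
    AddCircle (1 : ℝ) × AddCircle (1 : ℝ))

/-- The Lie algebra `sl₂` of traceless complex `2 × 2` matrices. -/
abbrev sl2 : Type := LieAlgebra.SpecialLinear.sl (Fin 2) ℂ

/-- Automorphisms of the Lie algebra `sl₂`. -/
abbrev LieAut : Type := sl2 ≃ₗ⁅ℂ⁆ sl2

/-- `Aut(sl₂)` is a group under composition. -/
instance instGroupLieAut : Group LieAut where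
  mul a b := b.trans a
  one := 1
  inv a := a.symm
  mul_assoc _ _ _ := rfl
  one_mul _ := rfl
  mul_one _ := rfl
  inv_mul_cancel a := a.self_trans_symm

theorem matrix_mem_sl2 (a b c : ℂ) : !![a, b; c, -a] ∈ LieAlgebra.SpecialLinear.sl (Fin 2) ℂ := by
  change _ ∈ LinearMap.ker _
  simp [Matrix.trace_fin_two]

/-- The element `h` of the standard basis of `sl₂`. -/
def hElt : sl2 := ⟨!![1, 0; 0, -1], matrix_mem_sl2 1 0 0⟩

/-- The element `e` of the standard basis of `sl₂`. -/
def eElt : sl2 := ⟨!![0, 1; 0, 0], by simpa using matrix_mem_sl2 0 1 0⟩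

/-- The element `f` of the standard basis of `sl₂`. -/
def fElt : sl2 := ⟨!![0, 0; 1, 0], by simpa using matrix_mem_sl2 0 0 1⟩

/-! ### Functions on the punctured torus -/

/-- The removed set `σ(C₂ × C₂) · {0}`. -/
def punctures {L : PeriodPair} (σ : Klein →* TorusAut L) : Set (Torus L) :=
  Set.range fun γ => (σ γ : Equiv.Perm (Torus L)) (proj L 0)

/-- The punctured torus `𝕋 = T ∖ σ(C₂ × C₂) · {0}`. -/
abbrev Punctured {L : PeriodPair} (σ : Klein →* TorusAut L) : Type :=
  {x : Torus L // x ∉ punctures σ}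

/-- The algebra `𝒪_𝕋` of functions that are holomorphic on `𝕋` and meromorphic on `T`. -/
def regular {L : PeriodPair} (σ : Klein →* TorusAut L) : Subalgebra ℂ (Punctured σ → ℂ) where
  carrier := {f |
    (∀ z : ℂ, proj L z ∉ punctures σ → ∃ g : ℂ → ℂ, AnalyticAt ℂ g z ∧
      ∀ᶠ w in 𝓝 z, ∀ hw : proj L w ∉ punctures σ, f ⟨proj L w, hw⟩ = g w) ∧
    (∀ z : ℂ, proj L z ∈ punctures σ → ∃ g : ℂ → ℂ, MeromorphicAt g z ∧
      ∀ᶠ w in 𝓝[≠] z, ∀ hw : proj L w ∉ punctures σ, f ⟨proj L w, hw⟩ = g w)}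
  mul_mem' := by
    rintro a b ⟨ha, ha'⟩ ⟨hb, hb'⟩
    refine ⟨fun z hz => ?_, fun z hz => ?_⟩
    · obtain ⟨g, hg, hg'⟩ := ha z hz
      obtain ⟨k, hk, hk'⟩ := hb z hz
      refine ⟨g * k, hg.mul hk, ?_⟩
      filter_upwards [hg', hk'] with w h1 h2 hw
      simp [h1 hw, h2 hw]
    · obtain ⟨g, hg, hg'⟩ := ha' z hz
      obtain ⟨k, hk, hk'⟩ := hb' z hz
      refine ⟨g * k, hg.mul hk, ?_⟩
      filter_upwards [hg', hk'] with w h1 h2 hw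
      simp [h1 hw, h2 hw]
  add_mem' := by
    rintro a b ⟨ha, ha'⟩ ⟨hb, hb'⟩
    refine ⟨fun z hz => ?_, fun z hz => ?_⟩
    · obtain ⟨g, hg, hg'⟩ := ha z hz
      obtain ⟨k, hk, hk'⟩ := hb z hz
      refine ⟨g + k, hg.add hk, ?_⟩
      filter_upwards [hg', hk'] with w h1 h2 hw
      simp [h1 hw, h2 hw]
    · obtain ⟨g, hg, hg'⟩ := ha' z hz
      obtain ⟨k, hk, hk'⟩ := hb' z hz
      refine ⟨g + k, hg.add hk, ?_⟩
      filter_upwards [hg', hk'] with w h1 h2 hw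
      simp [h1 hw, h2 hw]
  algebraMap_mem' c :=
    ⟨fun _ _ => ⟨fun _ => c, analyticAt_const, Filter.Eventually.of_forall fun _ _ => rfl⟩,
      fun _ _ => ⟨fun _ => c, .const c _, Filter.Eventually.of_forall fun _ _ => rfl⟩⟩

theorem apply_mem_punctures {L : PeriodPair} (σ : Klein →* TorusAut L) (γ : Klein) {x : Torus L}
    (hx : x ∈ punctures σ) : (σ γ : Equiv.Perm (Torus L)) x ∈ punctures σ := by
  obtain ⟨δ, rfl⟩ := hx
  exact ⟨γ * δ, by simp [map_mul]⟩

theorem apply_notMem_punctures {L : PeriodPair} (σ : Klein →* TorusAut L) (γ : Klein) {x : Torus L}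
    (hx : x ∉ punctures σ) : (σ γ : Equiv.Perm (Torus L)) x ∉ punctures σ := by
  intro h
  obtain ⟨δ, hδ⟩ := h
  refine hx ⟨γ⁻¹ * δ, ?_⟩
  simp only at hδ
  simp [map_mul, hδ]

/-- The action of `C₂ × C₂` on the punctured torus. -/
def actPt {L : PeriodPair} (σ : Klein →* TorusAut L) (γ : Klein) (x : Punctured σ) : Punctured σ :=
  ⟨(σ γ : Equiv.Perm (Torus L)) x.1, apply_notMem_punctures σ γ x.2⟩

theorem comp_actPt_mem {L : PeriodPair} (σ : Klein →* TorusAut L) (γ : Klein)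
    {f : Punctured σ → ℂ} (hf : f ∈ regular σ) : (fun x => f (actPt σ γ x)) ∈ regular σ := by
  obtain ⟨hf, hf'⟩ := hf
  refine ⟨fun z hz => ?_, fun z hz => ?_⟩
  · obtain ⟨s, hs, hs'⟩ := (σ γ).2.1 z
    have hz' : proj L (s z) ∉ punctures σ := by
      rw [← hs'.self_of_nhds]
      exact apply_notMem_punctures σ γ hz
    obtain ⟨g, hg, hg'⟩ := hf (s z) hz'
    refine ⟨fun w => g (s w), hg.comp hs, ?_⟩
    filter_upwards [hs', hs.continuousAt.eventually hg'] with w h1 h2 hw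
    have h3 : proj L (s w) ∉ punctures σ := by
      rw [← h1]
      exact apply_notMem_punctures σ γ hw
    rw [← h2 h3]
    congr 1
    exact Subtype.ext h1
  · obtain ⟨s, hs, hs'⟩ := (σ γ).2.1 z
    have hz' : proj L (s z) ∈ punctures σ := by
      rw [← hs'.self_of_nhds]
      exact apply_mem_punctures σ γ hz
    obtain ⟨g, hg, hg'⟩ := hf' (s z) hz'
    refine ⟨fun w => g (s w), hg.comp_analyticAt hs, ?_⟩
    rw [eventually_nhdsWithin_iff] at hg'
    filter_upwards [nhdsWithin_le_nhds hs',
      nhdsWithin_le_nhds (hs.continuousAt.eventually hg')] with w h1 h2 hw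
    have h3 : proj L (s w) ∉ punctures σ := by
      rw [← h1]
      exact apply_notMem_punctures σ γ hw
    rw [← h2 (fun h => h3 (by rw [h]; exact hz')) h3]
    congr 1
    exact Subtype.ext h1

/-- The induced action `σ̃(γ) f = f ∘ σ(γ)⁻¹` on `𝒪_𝕋`. -/
def actFun {L : PeriodPair} (σ : Klein →* TorusAut L) (γ : Klein) : regular σ →ₐ[ℂ] regular σ where
  toFun f := ⟨fun x => f.1 (actPt σ γ⁻¹ x), comp_actPt_mem σ γ⁻¹ f.2⟩
  map_one' := rfl
  map_mul' _ _ := rfl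
  map_zero' := rfl
  map_add' _ _ := rfl
  commutes' _ := rfl

/-- The algebra of invariants `𝒪_𝕋^{σ̃(C₂ × C₂)}`. -/
def invariants {L : PeriodPair} (σ : Klein →* TorusAut L) : Subalgebra ℂ (regular σ) where
  carrier := {f | ∀ γ, actFun σ γ f = f}
  mul_mem' ha hb γ := by rw [map_mul, ha γ, hb γ]
  add_mem' ha hb γ := by rw [map_add, ha γ, hb γ]
  algebraMap_mem' c γ := (actFun σ γ).commutes c

/-! ### The automorphic Lie algebra -/

/-- Shortcut instance: the commutative ring structure of the algebra of invariants. -/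
instance instCommRingInvariants {L : PeriodPair} (σ : Klein →* TorusAut L) :
    CommRing (invariants σ) := (invariants σ).toCommRing

/-- Shortcut instance: the current algebra over the algebra of invariants is a Lie ring. -/
instance instLieRingInvariants {L : PeriodPair} (σ : Klein →* TorusAut L) :
    LieRing (invariants σ ⊗[ℂ] sl2) := LieAlgebra.ExtendScalars.instLieRing ℂ (invariants σ) sl2

/-- Shortcut instance: the current algebra over the algebra of invariants is a Lie algebra. -/
instance instLieAlgebraInvariants {L : PeriodPair} (σ : Klein →* TorusAut L) :
    LieAlgebra ℂ (invariants σ ⊗[ℂ] sl2) :=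
  LieAlgebra.ExtendScalars.instBaseLieAlgebra ℂ (invariants σ) sl2

/-- The current algebra `sl₂ ⊗ 𝒪_𝕋`, with the bracket of `sl₂` extended `𝒪_𝕋`-bilinearly. -/
abbrev Current {L : PeriodPair} (σ : Klein →* TorusAut L) : Type := regular σ ⊗[ℂ] sl2

/-- The diagonal action `γ · (A ⊗ f) = ρ(γ) A ⊗ σ̃(γ) f` on the current algebra. -/
def actCurrent {L : PeriodPair} (ρ : Klein →* LieAut) (σ : Klein →* TorusAut L) (γ : Klein) :
    Current σ →ₗ⁅ℂ⁆ Current σ :=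
  LieAlgebra.ExtendScalars.map (actFun σ γ) (ρ γ).toLieHom

/-- The automorphic Lie algebra `(sl₂ ⊗ 𝒪_𝕋)^{ρ ⊗ σ̃(C₂ × C₂)}`. -/
def automorphic {L : PeriodPair} (ρ : Klein →* LieAut) (σ : Klein →* TorusAut L) :
    LieSubalgebra ℂ (Current σ) where
  carrier := {a | ∀ γ, actCurrent ρ σ γ a = a}
  add_mem' ha hb γ := by rw [map_add, ha γ, hb γ]
  zero_mem' γ := map_zero _
  smul_mem' c _ ha γ := by rw [map_smul, ha γ]
  lie_mem' ha hb γ := by rw [LieHom.map_lie, ha γ, hb γ]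

/-- Evaluation of functions in `𝒪_𝕋` at a point of `𝕋`. -/
def evalFun {L : PeriodPair} (σ : Klein →* TorusAut L) (x : Punctured σ) : regular σ →ₐ[ℂ] ℂ :=
  (Pi.evalAlgHom ℂ (fun _ : Punctured σ => ℂ) x).comp (regular σ).val

/-- The value in `sl₂` of an element of `sl₂ ⊗ 𝒪_𝕋` at a point of `𝕋`. -/
def eval {L : PeriodPair} (σ : Klein →* TorusAut L) (x : Punctured σ) : Current σ →ₗ[ℂ] sl2 :=
  (TensorProduct.lid ℂ sl2).toLinearMap ∘ₗ
    TensorProduct.map (evalFun σ x).toLinearMap LinearMap.id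

theorem eval_tmul {L : PeriodPair} (σ : Klein →* TorusAut L) (x : Punctured σ) (f : regular σ)
    (A : sl2) : eval σ x (f ⊗ₜ A) = f.1 x • A := rfl

/-- The map `A ⊗ f ↦ θ(A) ⊗ f` on the current algebra. -/
def constAct {L : PeriodPair} (σ : Klein →* TorusAut L) (θ : LieAut) :
    Current σ →ₗ⁅ℂ⁆ Current σ :=
  LieAlgebra.ExtendScalars.map (AlgHom.id ℂ (regular σ)) θ.toLieHom

/-! ### The half lattice and its Weierstrass functions -/

/-- The period pair `(ω₁ / 2, ω₂ / 2)`, whose lattice is `Λ / 2`. -/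
def half (L : PeriodPair) : PeriodPair where
  ω₁ := L.ω₁ / 2
  ω₂ := L.ω₂ / 2
  indep := by
    have h := L.indep
    rw [LinearIndependent.pair_iff] at h ⊢
    intro s t hst
    refine h s t ?_
    have h2 : (2 : ℂ) * (s • (L.ω₁ / 2) + t • (L.ω₂ / 2)) = 0 := by rw [hst, mul_zero]
    simp only [Complex.real_smul] at h2 ⊢
    linear_combination h2

theorem lattice_le_half (L : PeriodPair) : L.lattice ≤ (half L).lattice := by
  intro x hx
  obtain ⟨m, n, h⟩ := PeriodPair.mem_lattice.mp hx
  refine PeriodPair.mem_lattice.mpr ⟨2 * m, 2 * n, ?_⟩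
  rw [← h]
  simp only [half]
  push_cast
  ring

/-- `℘_{Λ/2}`, as a function on `ℂ / Λ`. -/
def wpHalf (L : PeriodPair) : Torus L → ℂ :=
  Quotient.lift (half L).weierstrassP <| by
    intro a b hab
    have h : a - b ∈ L.lattice := (Submodule.quotientRel_def _).mp hab
    have := (half L).weierstrassP_add_coe b ⟨a - b, lattice_le_half L h⟩
    simpa using this

/-- `℘'_{Λ/2}`, as a function on `ℂ / Λ`. -/
def wpHalfDeriv (L : PeriodPair) : Torus L → ℂ :=
  Quotient.lift (half L).derivWeierstrassP <| by
    intro a b hab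
    have h : a - b ∈ L.lattice := (Submodule.quotientRel_def _).mp hab
    have := (half L).derivWeierstrassP_add_coe b ⟨a - b, lattice_le_half L h⟩
    simpa using this

/-- The algebra `ℂ[℘_{Λ/2}, ℘'_{Λ/2}]` of functions on `𝕋`. -/
def wpHalfAlgebra {L : PeriodPair} (σ : Klein →* TorusAut L) : Subalgebra ℂ (Punctured σ → ℂ) :=
  Algebra.adjoin ℂ {fun x => wpHalf L x.1, fun x => wpHalfDeriv L x.1}

/-- The ring `ℂ[x, y] / (y² - 4 x³ + g₂(Λ) x + g₃(Λ))`. -/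
abbrev WeierstrassRing (L : PeriodPair) : Type :=
  MvPolynomial (Fin 2) ℂ ⧸ Ideal.span {(MvPolynomial.X 1 ^ 2 - 4 * MvPolynomial.X 0 ^ 3 +
    MvPolynomial.C L.g₂ * MvPolynomial.X 0 + MvPolynomial.C L.g₃ : MvPolynomial (Fin 2) ℂ)}

/-- The Lie algebra `ℭ_Λ = sl₂ ⊗ ℂ[x, y] / (y² - 4 x³ + g₂(Λ) x + g₃(Λ))`. -/
abbrev CurrentC (L : PeriodPair) : Type := WeierstrassRing L ⊗[ℂ] sl2

/-! ### The explicit intertwiner -/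

/-- `e₁ = ℘(ω₁ / 2)`. -/
def e₁ (L : PeriodPair) : ℂ := L.weierstrassP (L.ω₁ / 2)

/-- `e₂ = ℘(ω₂ / 2)`. -/
def e₂ (L : PeriodPair) : ℂ := L.weierstrassP (L.ω₂ / 2)

/-- `e₃ = ℘((ω₁ + ω₂) / 2)`. -/
def e₃ (L : PeriodPair) : ℂ := L.weierstrassP ((L.ω₁ + L.ω₂) / 2)

/-- `1 / ℘'` and its translates under `1`, `r₁ : z ↦ z + ω₁/2`, `r₂ : z ↦ z + ω₂/2` and `r₁ r₂`,
with the signs `1, a, b, a b`: four times the projection of `1 / ℘'` on a character. -/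
def projInv (L : PeriodPair) (a b : ℂ) (z : ℂ) : ℂ :=
  1 / L.derivWeierstrassP z + a * (1 / L.derivWeierstrassP (z - L.ω₁ / 2)) +
    b * (1 / L.derivWeierstrassP (z - L.ω₂ / 2)) +
    a * b * (1 / L.derivWeierstrassP (z - (L.ω₁ + L.ω₂) / 2))

/-- `p₀`, for the character with values `-1` at `r₁` and `-1` at `r₂`. -/
def p₀ (L : PeriodPair) : ℂ → ℂ := projInv L (-1) (-1)

/-- `p₁`, for the character with values `-1` at `r₁` and `1` at `r₂`. -/
def p₁ (L : PeriodPair) : ℂ → ℂ := projInv L (-1) 1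

/-- `p₂`, for the character with values `1` at `r₁` and `-1` at `r₂`. -/
def p₂ (L : PeriodPair) : ℂ → ℂ := projInv L 1 (-1)

/-- `α₁ = ((e₁ - e₃) / (e₂ - e₃))²`. -/
def α₁ (L : PeriodPair) : ℂ := ((e₁ L - e₃ L) / (e₂ L - e₃ L)) ^ 2

/-- `α₂ = 4 / ((e₁ - e₂) (e₂ - e₃)²)`. -/
def α₂ (L : PeriodPair) : ℂ := 4 / ((e₁ L - e₂ L) * (e₂ L - e₃ L) ^ 2)

/-- `β₁ = ((e₁ - e₂) / (e₂ - e₃))²`. -/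
def β₁ (L : PeriodPair) : ℂ := ((e₁ L - e₂ L) / (e₂ L - e₃ L)) ^ 2

/-- `β₂ = 4 / ((e₁ - e₃) (e₂ - e₃)²)`. -/
def β₂ (L : PeriodPair) : ℂ := 4 / ((e₁ L - e₃ L) * (e₂ L - e₃ L) ^ 2)

/-- `A` is a value of `((e₁ - e₃) / (e₂ - e₃))^{3/2}` and `B` one of `((e₁ - e₂) / (e₂ - e₃))^{3/2}`. -/
structure IsRootPair (L : PeriodPair) (A B : ℂ) : Prop where
  sq_A : A ^ 2 = ((e₁ L - e₃ L) / (e₂ L - e₃ L)) ^ 3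
  sq_B : B ^ 2 = ((e₁ L - e₂ L) / (e₂ L - e₃ L)) ^ 3

/-- The square root `√(α₂ β₂)`. Its sign is the one determined by the choice of `A` and `B`, namely
`√(α₂ β₂) = A B (α₂ / α₁ - β₂ / β₁)`. -/
def sqrtαβ (L : PeriodPair) (A B : ℂ) : ℂ := A * B * (α₂ L / α₁ L - β₂ L / β₁ L)

/-- `ξm` and `ξp` are square roots `ξ₋`, `ξ₊` of `(A/α₁) p₁ ∓ (B/β₁) p₀` off `Λ/2`, with branches
chosen so that `ξ₋ ξ₊ = p₂`. -/
structure IsBranchPair (L : PeriodPair) (A B : ℂ) (ξm ξp : ℂ → ℂ) : Prop where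
  sq_m : ∀ z ∉ (half L).lattice, ξm z ^ 2 = A / α₁ L * p₁ L z - B / β₁ L * p₀ L z
  sq_p : ∀ z ∉ (half L).lattice, ξp z ^ 2 = A / α₁ L * p₁ L z + B / β₁ L * p₀ L z
  mul : ∀ z ∉ (half L).lattice, ξm z * ξp z = p₂ L z

/-- The matrix `Ω`. -/
def Omega (L : PeriodPair) (A B : ℂ) (ξm ξp : ℂ → ℂ) (z : ℂ) : Matrix (Fin 2) (Fin 2) ℂ :=
  !![ξm z, 1 / (2 * sqrtαβ L A B) * (A * p₀ L z - B * p₁ L z) * ξp z;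
     ξp z, 1 / (2 * sqrtαβ L A B) * (A * p₀ L z + B * p₁ L z) * ξm z]

/-- `Ψ` is conjugation by `Ω`: `Ψ(a)(z) = Ω(z) a(z) Ω(z)⁻¹` at all points of `𝕋`. -/
def IsAdOmega {L : PeriodPair} (σ : Klein →* TorusAut L) (A B : ℂ) (ξm ξp : ℂ → ℂ)
    (Ψ : Current σ ≃ₗ⁅regular σ⁆ Current σ) : Prop :=
  ∀ (a : Current σ) (z : ℂ) (hz : proj L z ∉ punctures σ),
    (eval σ ⟨proj L z, hz⟩ (Ψ a) : Matrix (Fin 2) (Fin 2) ℂ) =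
      Omega L A B ξm ξp z * (eval σ ⟨proj L z, hz⟩ a : Matrix (Fin 2) (Fin 2) ℂ) *
        (Omega L A B ξm ξp z)⁻¹

/-- The actions in standard position:
`ρ(r₁) (a, b; c, -a) = (a, -b; -c, -a)`, `ρ(r₂) (a, b; c, -a) = (-a, -c; -b, a)`,
`σ(r₁) z = z + ω₁/2`, `σ(r₂) z = z + ω₂/2`. -/
structure IsStandard {L : PeriodPair} (ρ : Klein →* LieAut) (σ : Klein →* TorusAut L) : Prop where
  rho_r₁ : ∀ X : sl2, (ρ r₁ X : Matrix (Fin 2) (Fin 2) ℂ) =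
    !![X.1 0 0, -X.1 0 1; -X.1 1 0, X.1 1 1]
  rho_r₂ : ∀ X : sl2, (ρ r₂ X : Matrix (Fin 2) (Fin 2) ℂ) =
    !![-X.1 0 0, -X.1 1 0; -X.1 0 1, -X.1 1 1]
  sigma_r₁ : ∀ z : ℂ, (σ r₁ : Equiv.Perm (Torus L)) (proj L z) = proj L (z + L.ω₁ / 2)
  sigma_r₂ : ∀ z : ℂ, (σ r₂ : Equiv.Perm (Torus L)) (proj L z) = proj L (z + L.ω₂ / 2)

/-- `𝔄 = ℂ⟨h', e', f'⟩ ⊗ 𝒪_𝕋^{σ̃(C₂ × C₂)}`: the elements `h', e', f'` are a basis of the automorphic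
Lie algebra over the algebra of invariants, with the brackets of the standard basis of `sl₂`. -/
structure IsNormalForm {L : PeriodPair} (ρ : Klein →* LieAut) (σ : Klein →* TorusAut L)
    (h' e' f' : Current σ) : Prop where
  linearIndependent : LinearIndependent (invariants σ) ![h', e', f']
  span_eq : (Submodule.span (invariants σ) {h', e', f'} : Set (Current σ)) = automorphic ρ σ
  lie_h_e : ⁅h', e'⁆ = (2 : ℂ) • e'
  lie_h_f : ⁅h', f'⁆ = (-2 : ℂ) • f'
  lie_e_f : ⁅e', f'⁆ = h'

end ALia

end

open ALia

/-! Genus one forces `C₂ × C₂` to act by the four half-period translations. A biholomorphism of `ℂ /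
Λ` lifts to an affine map, and an involution has linear part `±1`. A linear part `-1` would let
every circle-valued function on the quotient lift to `ℝ`, which is impossible on a product of two
circles (`linear_part_ne_neg_one`).

Translation by a half period `w` acts on `℘` through the rule that `(℘(z) - ℘(w)) (℘(z + w) - ℘(w))`
is a nonzero constant (`exists_shift_const`, from Liouville's theorem). Hence each translate of
`1/℘'` is a quadratic polynomial in `℘` divided by `℘'`, and `p₀²`, `p₁²` are affine functions of
`p₂²` with constant coefficients (`p₀_sq`, `p₁_sq`). For the prescribed `A`, `B` these two relations
say exactly what is needed: `ξ₋² ξ₊² = p₂²` is consistent (`p₂_sq`), and `Ω` has determinant one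
(`det_relation`).

The functions `ξ±` are only chosen pointwise, but conjugation by `Ω` involves them only through
`ξ₋²`, `ξ₊²` and `ξ₋ ξ₊`, which are linear in the `pᵢ`. So `Ad(Ω)` has coefficients in `𝒪_𝕋`
(`adMat`, `exists_adOmega_equiv`). Since the `pᵢ` transform by characters, translating `z` by `ω₁/2`
or `ω₂/2` composes `Ad(Ω(z))` with one of the two standard involutions of `sl₂`. Every faithful `ρ`
is conjugate to the standard one by a constant `θ` (`exists_conj_standard`), so `θ ∘ Ψ` turns the
action on functions alone into the diagonal action. An element `θ Ψ(a h + b e + c f)` is then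
automorphic exactly when `a`, `b`, `c` are invariant (`constAct_curr_mem_automorphic`), which yields
both the normal form and the isomorphism type.

Invariant functions are the `Λ/2`-periodic functions with poles only in `Λ/2`. Subtracting monomials
in `℘` and `℘'` lowers the pole order until a constant is left (`exists_polynomial_eq`), so they are
polynomials in `℘_{Λ/2}` and `℘'_{Λ/2}`; a parity argument shows that the Weierstrass equation
generates all relations. -/

noncomputable section

/-! ### Liouville's theorem and translation of `℘` by half periods -/

namespace PeriodPair

variable (L : PeriodPair)

theorem eventually_notMem_lattice (z : ℂ) : ∀ᶠ w in 𝓝[≠] z, w ∉ L.lattice := by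
  filter_upwards [self_mem_nhdsWithin, mem_nhdsWithin_of_mem_nhds
    (L.compl_lattice_sdiff_singleton_mem_nhds z)] with w hw hw'
  simp_all

variable {L}

/-- Moves a removable singularity along a period, so that Liouville's theorem has to be checked at
one point of each class only. -/
theorem analyticGerm_add {f : ℂ → ℂ} {z l : ℂ} (hf : ∀ w, f (w + l) = f w)
    (h : ∃ g, AnalyticAt ℂ g z ∧ f =ᶠ[𝓝[≠] z] g) :
    ∃ g, AnalyticAt ℂ g (z + l) ∧ f =ᶠ[𝓝[≠] (z + l)] g := by
  obtain ⟨g, hg, hfg⟩ := h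
  refine ⟨fun w => g (w - l), ?_, ?_⟩
  · exact AnalyticAt.fun_comp (by simpa using hg) (by fun_prop)
  · have ht : Filter.Tendsto (fun w => w - l) (𝓝[≠] (z + l)) (𝓝[≠] z) := by
      refine tendsto_nhdsWithin_iff.2 ⟨?_, ?_⟩
      · have : ContinuousAt (fun w => w - l) (z + l) := by fun_prop
        simpa [ContinuousAt] using this.tendsto.mono_left nhdsWithin_le_nhds
      · filter_upwards [self_mem_nhdsWithin] with w hw
        simpa [sub_eq_iff_eq_add] using hw
    filter_upwards [ht.eventually hfg] with w hw
    rw [← hw, ← hf (w - l), sub_add_cancel]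

/-- Liouville's theorem for elliptic functions, up to removable singularities. -/
theorem exists_eventually_eq_const (f : ℂ → ℂ) (hf : ∀ l ∈ L.lattice, ∀ z, f (z + l) = f z)
    (h : ∀ z, ∃ g, AnalyticAt ℂ g z ∧ f =ᶠ[𝓝[≠] z] g) :
    ∃ c, ∀ z, ∀ᶠ w in 𝓝[≠] z, f w = c := by
  choose g hg hfg using h
  have hlim : ∀ z, Filter.Tendsto f (𝓝[≠] z) (𝓝 (g z z)) := fun z =>
    ((hg z).continuousAt.tendsto.mono_left nhdsWithin_le_nhds).congr' (hfg z).symm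
  -- The values `g w w` of the germs at their own centres are the limits of `f`. They glue to an
  -- entire function which fills all the removable singularities.
  have hF : ∀ z, (fun w => g w w) =ᶠ[𝓝 z] g z := by
    intro z
    have h1 : ∀ᶠ w in 𝓝[≠] z, g w w = g z w := by
      filter_upwards [eventually_eventually_nhdsWithin.2 (hfg z),
        nhdsWithin_le_nhds (hg z).eventually_analyticAt, self_mem_nhdsWithin] with w h1 h2 hwz
      have h3 : Filter.Tendsto f (𝓝[≠] w) (𝓝 (g z w)) := by
        refine (h2.continuousAt.tendsto.mono_left nhdsWithin_le_nhds).congr' ?_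
        have h4 : ∀ᶠ x in 𝓝 w, x ≠ z := isOpen_ne.mem_nhds hwz
        rw [eventually_nhdsWithin_iff] at h1
        filter_upwards [nhdsWithin_le_nhds h1, nhdsWithin_le_nhds h4] with x hx hx'
        exact (hx hx').symm
      exact tendsto_nhds_unique (hlim w) h3
    rw [eventually_nhdsWithin_iff] at h1
    filter_upwards [h1] with w hw
    by_cases hwz : w = z
    · rw [hwz]
    · exact hw hwz
  have hd : Differentiable ℂ (fun w => g w w) := fun z =>
    ((hg z).congr (hF z).symm).differentiableAt
  have hper : ∀ z, ∀ l ∈ L.lattice, g (z + l) (z + l) = g z z := by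
    intro z l hl
    refine tendsto_nhds_unique (hlim (z + l)) ?_
    have ht : Filter.Tendsto (fun w => w - l) (𝓝[≠] (z + l)) (𝓝[≠] z) := by
      refine tendsto_nhdsWithin_iff.2 ⟨?_, ?_⟩
      · have : ContinuousAt (fun w => w - l) (z + l) := by fun_prop
        simpa [ContinuousAt] using this.tendsto.mono_left nhdsWithin_le_nhds
      · filter_upwards [self_mem_nhdsWithin] with w hw
        simpa [sub_eq_iff_eq_add] using hw
    refine ((hlim z).comp ht).congr fun w => ?_
    rw [Function.comp, ← hf l hl (w - l), sub_add_cancel]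
  refine ⟨g 0 0, fun z => ?_⟩
  have hconst : ∀ w, g w w = g 0 0 := fun w =>
    hd.apply_eq_apply_of_bounded (IsZLattice.isCompact_range_of_periodic L.lattice _
      hd.continuous hper).isBounded w 0
  filter_upwards [hfg z, nhdsWithin_le_nhds (hF z)] with w h1 h2
  rw [h1, ← h2, hconst]

theorem eq_const_of_continuousAt {f : ℂ → ℂ} {c z : ℂ} (h : ∀ᶠ w in 𝓝[≠] z, f w = c)
    (hf : ContinuousAt f z) : f z = c :=
  tendsto_nhds_unique (hf.tendsto.mono_left nhdsWithin_le_nhds)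
    ((tendsto_const_nhds (x := c)).congr' (by filter_upwards [h] with w hw; exact hw.symm))

theorem weierstrassP_add (z : ℂ) {l : ℂ} (hl : l ∈ L.lattice) :
    L.weierstrassP (z + l) = L.weierstrassP z :=
  L.weierstrassP_add_coe z ⟨l, hl⟩

theorem derivWeierstrassP_add (z : ℂ) {l : ℂ} (hl : l ∈ L.lattice) :
    L.derivWeierstrassP (z + l) = L.derivWeierstrassP z :=
  L.derivWeierstrassP_add_coe z ⟨l, hl⟩

theorem weierstrassP_eq_add_inv (z : ℂ) :
    L.weierstrassP z = L.weierstrassPExcept 0 z + 1 / z ^ 2 := by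
  have := L.weierstrassPExcept_add 0 z
  simp at this
  simp [← this]

theorem derivWeierstrassP_eq_sub (z : ℂ) :
    L.derivWeierstrassP z = L.derivWeierstrassPExcept 0 z - 2 / z ^ 3 := by
  have := L.derivWeierstrassPExcept_sub 0 z
  simp at this
  simp [← this]

theorem exists_eventuallyEq_sq_mul {f : ℂ → ℂ} {z : ℂ} (hf : AnalyticAt ℂ f z) (h0 : f z = 0)
    (h1 : deriv f z = 0) : ∃ k, AnalyticAt ℂ k z ∧ ∀ᶠ w in 𝓝 z, f w = (w - z) ^ 2 * k w := by
  have : ((2 : ℕ) : ℕ∞) ≤ analyticOrderAt f z := by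
    rw [natCast_le_analyticOrderAt_iff_iteratedDeriv_eq_zero hf]
    intro i hi
    interval_cases i
    · simpa using h0
    · simpa using h1
  simpa using (natCast_le_analyticOrderAt hf).1 this

variable (L) in
-- A lattice is countable, and the complement of a countable set in a real vector space of dimension
-- above one is path connected. This makes the identity theorem available for `℘`.
theorem isPreconnected_compl_lattice : IsPreconnected ((L.lattice : Set ℂ)ᶜ) := by
  have hc : (L.lattice : Set ℂ).Countable := by
    have : Countable L.lattice := by infer_instance
    exact Set.countable_coe_iff.1 this
  exact (hc.isPathConnected_compl_of_one_lt_rank (by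
    simp [Complex.rank_real_complex])).isConnected.isPreconnected

theorem not_eventually_weierstrassP_eq {w : ℂ} (hw : w ∉ L.lattice) (c : ℂ) :
    ¬ ∀ᶠ z in 𝓝 w, L.weierstrassP z = c := by
  intro h
  have h1 : Set.EqOn L.weierstrassP (fun _ => c) (L.lattice : Set ℂ)ᶜ :=
    L.analyticOnNhd_weierstrassP.eqOn_of_preconnected_of_eventuallyEq
      (fun _ _ => analyticAt_const) L.isPreconnected_compl_lattice hw h
  have h2 : L.weierstrassP =ᶠ[𝓝[≠] 0] fun _ => c := by
    filter_upwards [L.eventually_notMem_lattice 0] with z hz using h1 hz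
  have h3 := L.order_weierstrassP 0 (zero_mem _)
  rw [meromorphicOrderAt_congr h2, meromorphicOrderAt_const] at h3
  split_ifs at h3 <;> exact absurd h3 (by decide)

/-! ### Half periods -/

theorem derivWeierstrassP_half {w : ℂ} (hw : w + w ∈ L.lattice) : L.derivWeierstrassP w = 0 := by
  have h := L.derivWeierstrassP_neg w
  rw [← derivWeierstrassP_add (-w) hw, neg_add_cancel_left] at h
  linear_combination h / 2

/-- At `0` the double pole of `℘` meets the double zero of `℘(z + w) - ℘(w)`, double because `℘'(w)
= 0`. The product is unchanged by `z ↦ z + w`, so the singularity at `-w` is removable too, and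
Liouville's theorem applies. -/
theorem exists_shift_const {w : ℂ} (hw : w ∉ L.lattice) (hw2 : w + w ∈ L.lattice) :
    ∃ C ≠ 0, ∀ z ∉ L.lattice, z + w ∉ L.lattice →
      (L.weierstrassP z - L.weierstrassP w) * (L.weierstrassP (z + w) - L.weierstrassP w) = C := by
  set f : ℂ → ℂ := fun z =>
    (L.weierstrassP z - L.weierstrassP w) * (L.weierstrassP (z + w) - L.weierstrassP w) with hf
  have hper : ∀ l ∈ L.lattice, ∀ z, f (z + l) = f z := by
    intro l hl z
    simp only [hf, weierstrassP_add z hl]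
    rw [add_right_comm, weierstrassP_add _ hl]
  have hperw : ∀ z, f (z + w) = f z := by
    intro z
    simp only [hf]
    rw [add_assoc, weierstrassP_add _ hw2, mul_comm]
  have hana : ∀ z ∉ L.lattice, z + w ∉ L.lattice → AnalyticAt ℂ f z := by
    intro z hz hzw
    have h1 := L.analyticOnNhd_weierstrassP z hz
    have h2 : AnalyticAt ℂ (fun z => L.weierstrassP (z + w)) z :=
      AnalyticAt.fun_comp (f := fun z => z + w) (L.analyticOnNhd_weierstrassP (z + w) hzw)
        (by fun_prop)
    fun_prop
  obtain ⟨k, hk, hkw⟩ := exists_eventuallyEq_sq_mul (f := fun z => L.weierstrassP z -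
    L.weierstrassP w) ((L.analyticOnNhd_weierstrassP w hw).sub analyticAt_const) (by simp)
    (by simp [derivWeierstrassP_half hw2])
  have hk0 : AnalyticAt ℂ (fun z => k (z + w)) 0 :=
    AnalyticAt.fun_comp (f := fun z => z + w) (by simpa using hk) (by fun_prop)
  have hkw0 : ∀ᶠ z in 𝓝 0, L.weierstrassP (z + w) - L.weierstrassP w = z ^ 2 * k (z + w) := by
    have : ContinuousAt (fun z : ℂ => z + w) 0 := by fun_prop
    have := this.eventually (by simpa using hkw)
    simpa using this
  have hg0 : f =ᶠ[𝓝[≠] 0] fun z =>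
      (z ^ 2 * (L.weierstrassPExcept 0 z - L.weierstrassP w) + 1) * k (z + w) := by
    filter_upwards [nhdsWithin_le_nhds hkw0, self_mem_nhdsWithin] with z hz hz0
    have hz0 : z ≠ 0 := hz0
    simp only [hf]
    rw [hz, weierstrassP_eq_add_inv z]
    field_simp
    ring
  have hgerm0 : ∃ g, AnalyticAt ℂ g 0 ∧ f =ᶠ[𝓝[≠] 0] g := by
    have := L.analyticAt_weierstrassPExcept 0
    refine ⟨_, AnalyticAt.mul ?_ hk0, hg0⟩
    fun_prop
  obtain ⟨C, hC⟩ := exists_eventually_eq_const (L := L) f hper fun z => by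
    by_cases hz : z ∈ L.lattice
    · simpa using analyticGerm_add (hper z hz) hgerm0
    by_cases hzw : z + w ∈ L.lattice
    · have h1 := analyticGerm_add hperw hgerm0
      have h2 := analyticGerm_add (hper (z - w)
        (by convert sub_mem hzw hw2 using 1; ring)) h1
      simpa using h2
    · exact ⟨f, hana z hz hzw, Filter.EventuallyEq.rfl⟩
  have hC' : ∀ z ∉ L.lattice, z + w ∉ L.lattice → f z = C := fun z hz hzw =>
    eq_const_of_continuousAt (hC z) (hana z hz hzw).continuousAt
  refine ⟨C, ?_, hC'⟩
  rintro rfl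
  -- If the constant were `0`, the factor `z² (℘(z) - ℘(w))`, which tends to `1` at `0`, would force
  -- `℘` to be constant near `w`.
  have hk1 : ∀ᶠ z in 𝓝[≠] (0 : ℂ), k (z + w) = 0 := by
    have hne : ∀ᶠ z in 𝓝 (0 : ℂ),
        z ^ 2 * (L.weierstrassPExcept 0 z - L.weierstrassP w) + 1 ≠ 0 := by
      have hc : ContinuousAt (fun z : ℂ =>
          z ^ 2 * (L.weierstrassPExcept 0 z - L.weierstrassP w) + 1) 0 := by
        have := (L.analyticAt_weierstrassPExcept 0).continuousAt
        fun_prop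
      exact hc.eventually_ne (by simp)
    filter_upwards [hg0, hC 0, nhdsWithin_le_nhds hne] with z h1 h2 h3
    rw [h2] at h1
    exact (mul_eq_zero.1 h1.symm).resolve_left h3
  have h0 : ∀ᶠ z in 𝓝 (0 : ℂ), L.weierstrassP (z + w) = L.weierstrassP w := by
    rw [eventually_nhdsWithin_iff] at hk1
    filter_upwards [hk1, hkw0] with z h1 h2
    by_cases hz : z = 0
    · simp [hz]
    · rw [h1 hz, mul_zero] at h2
      linear_combination h2
  refine not_eventually_weierstrassP_eq hw (L.weierstrassP w) ?_
  have : ContinuousAt (fun z : ℂ => z - w) w := by fun_prop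
  have := this.eventually (by simpa using h0)
  simpa using this

theorem weierstrassP_ne_of_half {w z : ℂ} (hw : w ∉ L.lattice) (hw2 : w + w ∈ L.lattice)
    (hz : z ∉ L.lattice) (hzw : z + w ∉ L.lattice) : L.weierstrassP z ≠ L.weierstrassP w := by
  obtain ⟨C, hC, h⟩ := exists_shift_const hw hw2
  intro h0
  rw [← h z hz hzw, h0, sub_self, zero_mul] at hC
  exact hC rfl

/-- The translation formula for `℘'` by a half period. -/
theorem exists_shift_formula {w : ℂ} (hw : w ∉ L.lattice) (hw2 : w + w ∈ L.lattice) :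
    ∃ C ≠ 0, ∀ z ∉ L.lattice, z + w ∉ L.lattice →
      (L.weierstrassP z - L.weierstrassP w) * (L.weierstrassP (z + w) - L.weierstrassP w) = C ∧
      L.derivWeierstrassP (z + w) * (L.weierstrassP z - L.weierstrassP w) ^ 2 =
        -C * L.derivWeierstrassP z := by
  obtain ⟨C, hC, h⟩ := exists_shift_const hw hw2
  refine ⟨C, hC, fun z hz hzw => ⟨h z hz hzw, ?_⟩⟩
  have h1 : (fun z => (L.weierstrassP z - L.weierstrassP w) *
      (L.weierstrassP (z + w) - L.weierstrassP w)) =ᶠ[𝓝 z] fun _ => C := by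
    have hc : ContinuousAt (fun z : ℂ => z + w) z := by fun_prop
    filter_upwards [L.isClosed_lattice.isOpen_compl.mem_nhds hz,
      hc.eventually (L.isClosed_lattice.isOpen_compl.mem_nhds hzw)] with x h1 h2
    exact h x h1 h2
  have hd1 : HasDerivAt L.weierstrassP (L.derivWeierstrassP z) z := by
    rw [← L.deriv_weierstrassP]
    exact (L.analyticOnNhd_weierstrassP z hz).differentiableAt.hasDerivAt
  have hd2 : HasDerivAt (fun z => L.weierstrassP (z + w)) (L.derivWeierstrassP (z + w)) z := by
    rw [← L.deriv_weierstrassP]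
    exact (L.analyticOnNhd_weierstrassP _ hzw).differentiableAt.hasDerivAt.comp_add_const z w
  have h2 := (hd1.sub_const (L.weierstrassP w)).mul (hd2.sub_const (L.weierstrassP w))
  have h3 := h2.unique ((hasDerivAt_const z C).congr_of_eventuallyEq h1)
  -- The derivative of the product relation is multiplied by `℘(z) - ℘(w)`, and the product relation
  -- then eliminates `℘(z + w)`.
  linear_combination (L.weierstrassP z - L.weierstrassP w) * h3 -
    L.derivWeierstrassP z * h z hz hzw

end PeriodPair

/-! ### Values at half periods and the functions `p₀`, `p₁`, `p₂` -/

namespace ALia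

open PeriodPair

variable {L : PeriodPair}

theorem mem_half_lattice {z : ℂ} : z ∈ (half L).lattice ↔ z + z ∈ L.lattice := by
  constructor
  · intro h
    obtain ⟨m, n, rfl⟩ := mem_lattice.1 h
    refine mem_lattice.2 ⟨m, n, ?_⟩
    simp only [half]
    ring
  · intro h
    obtain ⟨m, n, h⟩ := mem_lattice.1 h
    refine mem_lattice.2 ⟨m, n, ?_⟩
    simp only [half]
    linear_combination h / 2

variable (L) in
theorem half₁_add_self : L.ω₁ / 2 + L.ω₁ / 2 ∈ L.lattice := by
  simpa using L.ω₁_mem_lattice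

variable (L) in
theorem half₂_add_self : L.ω₂ / 2 + L.ω₂ / 2 ∈ L.lattice := by
  simpa using L.ω₂_mem_lattice

variable (L) in
theorem half₃_add_self : (L.ω₁ + L.ω₂) / 2 + (L.ω₁ + L.ω₂) / 2 ∈ L.lattice := by
  simpa using add_mem L.ω₁_mem_lattice L.ω₂_mem_lattice

variable (L) in
theorem half₃_notMem : (L.ω₁ + L.ω₂) / 2 ∉ L.lattice := by
  have := (L.mul_ω₁_add_mul_ω₂_mem_lattice (α := 1 / 2) (β := 1 / 2)).not.mpr (by norm_num)
  intro h
  refine this ?_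
  convert h using 1
  push_cast
  ring

theorem notMem_of_notMem_half {z w : ℂ} (hz : z ∉ (half L).lattice) (hw : w + w ∈ L.lattice) :
    z + w ∉ L.lattice := by
  intro h
  refine hz (mem_half_lattice.2 ?_)
  convert sub_mem (add_mem h h) hw using 1
  ring

theorem notMem_lattice_of_half {z : ℂ} (hz : z ∉ (half L).lattice) : z ∉ L.lattice :=
  fun h => hz (lattice_le_half L h)

variable (L) in
theorem e₁_ne_e₂ : e₁ L ≠ e₂ L :=
  weierstrassP_ne_of_half L.ω₂_div_two_notMem_lattice (half₂_add_self L)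
    L.ω₁_div_two_notMem_lattice (by rw [← add_div]; exact half₃_notMem L)

variable (L) in
theorem e₁_ne_e₃ : e₁ L ≠ e₃ L :=
  weierstrassP_ne_of_half (half₃_notMem L) (half₃_add_self L) L.ω₁_div_two_notMem_lattice (by
    intro h
    refine L.ω₂_div_two_notMem_lattice ?_
    convert sub_mem h L.ω₁_mem_lattice using 1
    ring)

variable (L) in
theorem e₂_ne_e₃ : e₂ L ≠ e₃ L :=
  weierstrassP_ne_of_half (half₃_notMem L) (half₃_add_self L) L.ω₂_div_two_notMem_lattice (by
    intro h
    refine L.ω₁_div_two_notMem_lattice ?_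
    convert sub_mem h L.ω₂_mem_lattice using 1
    ring)

variable (L) in
theorem e₁_root : 4 * e₁ L ^ 3 - L.g₂ * e₁ L - L.g₃ = 0 := by
  rw [e₁, ← L.derivWeierstrassP_sq _ L.ω₁_div_two_notMem_lattice,
    derivWeierstrassP_half (half₁_add_self L), zero_pow two_ne_zero]

variable (L) in
theorem e₂_root : 4 * e₂ L ^ 3 - L.g₂ * e₂ L - L.g₃ = 0 := by
  rw [e₂, ← L.derivWeierstrassP_sq _ L.ω₂_div_two_notMem_lattice,
    derivWeierstrassP_half (half₂_add_self L), zero_pow two_ne_zero]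

variable (L) in
theorem e₃_root : 4 * e₃ L ^ 3 - L.g₂ * e₃ L - L.g₃ = 0 := by
  rw [e₃, ← L.derivWeierstrassP_sq _ (half₃_notMem L),
    derivWeierstrassP_half (half₃_add_self L), zero_pow two_ne_zero]

variable (L) in
-- Vieta's formula: subtracting the cubic equations of two distinct roots and dividing by their
-- difference gives a quadratic relation; the difference of two such relations contains `e₂ - e₃` as
-- a factor.
theorem e_sum : e₁ L + e₂ L + e₃ L = 0 := by
  have h1 : 4 * (e₁ L ^ 2 + e₁ L * e₂ L + e₂ L ^ 2) = L.g₂ :=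
    mul_left_cancel₀ (sub_ne_zero.2 (e₁_ne_e₂ L)) (by
      linear_combination e₁_root L - e₂_root L)
  have h2 : 4 * (e₁ L ^ 2 + e₁ L * e₃ L + e₃ L ^ 2) = L.g₂ :=
    mul_left_cancel₀ (sub_ne_zero.2 (e₁_ne_e₃ L)) (by
      linear_combination e₁_root L - e₃_root L)
  refine mul_left_cancel₀ (sub_ne_zero.2 (e₂_ne_e₃ L)) ?_
  linear_combination (h1 - h2) / 4

theorem derivWeierstrassP_sq_eq {z : ℂ} (hz : z ∉ L.lattice) :
    L.derivWeierstrassP z ^ 2 = 4 * (L.weierstrassP z - e₁ L) * (L.weierstrassP z - e₂ L) *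
      (L.weierstrassP z - e₃ L) := by
  have h1 : 4 * (e₁ L ^ 2 + e₁ L * e₂ L + e₂ L ^ 2) = L.g₂ :=
    mul_left_cancel₀ (sub_ne_zero.2 (e₁_ne_e₂ L)) (by
      linear_combination e₁_root L - e₂_root L)
  have h3 : e₃ L = -e₁ L - e₂ L := by linear_combination e_sum L
  rw [L.derivWeierstrassP_sq z hz, h3]
  linear_combination (L.weierstrassP z - e₁ L) * h1 + e₁_root L

theorem weierstrassP_ne_of_notMem_half {z w : ℂ} (hz : z ∉ (half L).lattice) (hw : w ∉ L.lattice)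
    (hw2 : w + w ∈ L.lattice) : L.weierstrassP z ≠ L.weierstrassP w :=
  weierstrassP_ne_of_half hw hw2 (notMem_lattice_of_half hz) (notMem_of_notMem_half hz hw2)

theorem derivWeierstrassP_ne_zero {z : ℂ} (hz : z ∉ (half L).lattice) :
    L.derivWeierstrassP z ≠ 0 := by
  have h1 : L.weierstrassP z - e₁ L ≠ 0 := sub_ne_zero.2
    (weierstrassP_ne_of_notMem_half hz L.ω₁_div_two_notMem_lattice (half₁_add_self L))
  have h2 : L.weierstrassP z - e₂ L ≠ 0 := sub_ne_zero.2
    (weierstrassP_ne_of_notMem_half hz L.ω₂_div_two_notMem_lattice (half₂_add_self L))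
  have h3 : L.weierstrassP z - e₃ L ≠ 0 := sub_ne_zero.2
    (weierstrassP_ne_of_notMem_half hz (half₃_notMem L) (half₃_add_self L))
  rw [← pow_ne_zero_iff two_ne_zero, derivWeierstrassP_sq_eq (notMem_lattice_of_half hz)]
  exact mul_ne_zero (mul_ne_zero (mul_ne_zero (by norm_num) h1) h2) h3

/-- The constant in the translation formula is evaluated at an auxiliary point `v`; for a second
half period it becomes a product of differences of the `eᵢ`. -/
theorem inv_derivWeierstrassP_sub_half {w v : ℂ} (hw : w ∉ L.lattice) (hw2 : w + w ∈ L.lattice)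
    (hv : v ∉ L.lattice) (hvw : v + w ∉ L.lattice) {z : ℂ} (hz : z ∉ (half L).lattice) :
    1 / L.derivWeierstrassP (z - w) = -(L.weierstrassP z - L.weierstrassP w) ^ 2 /
      ((L.weierstrassP v - L.weierstrassP w) * (L.weierstrassP (v + w) - L.weierstrassP w) *
        L.derivWeierstrassP z) := by
  obtain ⟨C, hC, h⟩ := exists_shift_formula hw hw2
  rw [(h v hv hvw).1]
  have h1 := (h z (notMem_lattice_of_half hz) (notMem_of_notMem_half hz hw2)).2
  have h2 : L.derivWeierstrassP (z - w) = L.derivWeierstrassP (z + w) := by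
    rw [← derivWeierstrassP_add (z - w) hw2]
    congr 1
    ring
  have h3 := derivWeierstrassP_ne_zero hz
  have h4 := sub_ne_zero.2 (weierstrassP_ne_of_notMem_half hz hw hw2)
  have h5 : L.derivWeierstrassP (z + w) ≠ 0 := by
    intro h0
    rw [h0, zero_mul] at h1
    exact mul_ne_zero (neg_ne_zero.2 hC) h3 h1.symm
  rw [h2, div_eq_div_iff h5 (mul_ne_zero hC h3)]
  linear_combination h1

theorem inv_deriv_sub₁ {z : ℂ} (hz : z ∉ (half L).lattice) :
    1 / L.derivWeierstrassP (z - L.ω₁ / 2) = -(L.weierstrassP z - e₁ L) ^ 2 /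
      ((e₂ L - e₁ L) * (e₃ L - e₁ L) * L.derivWeierstrassP z) := by
  have h : L.ω₂ / 2 + L.ω₁ / 2 = (L.ω₁ + L.ω₂) / 2 := by ring
  have := inv_derivWeierstrassP_sub_half (v := L.ω₂ / 2) L.ω₁_div_two_notMem_lattice
    (half₁_add_self L) L.ω₂_div_two_notMem_lattice (by rw [h]; exact half₃_notMem L) hz
  rwa [h] at this

theorem inv_deriv_sub₂ {z : ℂ} (hz : z ∉ (half L).lattice) :
    1 / L.derivWeierstrassP (z - L.ω₂ / 2) = -(L.weierstrassP z - e₂ L) ^ 2 /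
      ((e₁ L - e₂ L) * (e₃ L - e₂ L) * L.derivWeierstrassP z) := by
  have h : L.ω₁ / 2 + L.ω₂ / 2 = (L.ω₁ + L.ω₂) / 2 := by ring
  have := inv_derivWeierstrassP_sub_half (v := L.ω₁ / 2) L.ω₂_div_two_notMem_lattice
    (half₂_add_self L) L.ω₁_div_two_notMem_lattice (by rw [h]; exact half₃_notMem L) hz
  rwa [h] at this

theorem inv_deriv_sub₃ {z : ℂ} (hz : z ∉ (half L).lattice) :
    1 / L.derivWeierstrassP (z - (L.ω₁ + L.ω₂) / 2) = -(L.weierstrassP z - e₃ L) ^ 2 /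
      ((e₁ L - e₃ L) * (e₂ L - e₃ L) * L.derivWeierstrassP z) := by
  have h : L.ω₁ / 2 + (L.ω₁ + L.ω₂) / 2 = L.ω₂ / 2 + L.ω₁ := by ring
  have := inv_derivWeierstrassP_sub_half (v := L.ω₁ / 2) (half₃_notMem L)
    (half₃_add_self L) L.ω₁_div_two_notMem_lattice (by
      rw [h]
      intro h'
      exact L.ω₂_div_two_notMem_lattice (by simpa using sub_mem h' L.ω₁_mem_lattice)) hz
  rwa [h, weierstrassP_add _ L.ω₁_mem_lattice] at this

/-- Put `sᵢ = (℘ - eᵢ)² / ∏_{j ≠ i} (eᵢ - eⱼ)`. The four translates are `1, -s₁, -s₂, -s₃` over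
`℘'`, and `s₁ + s₂ + s₃ = 1` by Lagrange interpolation. With the signs of a nontrivial character a
single `sᵢ` survives: here `s₃`, for `p₁` it is `s₂`, for `p₂` it is `s₁`. -/
theorem p₀_eq {z : ℂ} (hz : z ∉ (half L).lattice) :
    p₀ L z = 2 * (1 - (L.weierstrassP z - e₃ L) ^ 2 / ((e₁ L - e₃ L) * (e₂ L - e₃ L))) /
      L.derivWeierstrassP z := by
  have hy := derivWeierstrassP_ne_zero hz
  have h12 := sub_ne_zero.2 (e₁_ne_e₂ L)
  have h13 := sub_ne_zero.2 (e₁_ne_e₃ L)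
  have h23 := sub_ne_zero.2 (e₂_ne_e₃ L)
  rw [p₀, projInv, inv_deriv_sub₁ hz, inv_deriv_sub₂ hz, inv_deriv_sub₃ hz,
    ← neg_sub (e₁ L) (e₂ L), ← neg_sub (e₁ L) (e₃ L), ← neg_sub (e₂ L) (e₃ L)]
  field_simp
  ring

theorem p₁_eq {z : ℂ} (hz : z ∉ (half L).lattice) :
    p₁ L z = 2 * (1 - (L.weierstrassP z - e₂ L) ^ 2 / ((e₁ L - e₂ L) * (e₃ L - e₂ L))) /
      L.derivWeierstrassP z := by
  have hy := derivWeierstrassP_ne_zero hz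
  have h12 := sub_ne_zero.2 (e₁_ne_e₂ L)
  have h13 := sub_ne_zero.2 (e₁_ne_e₃ L)
  have h23 := sub_ne_zero.2 (e₂_ne_e₃ L)
  rw [p₁, projInv, inv_deriv_sub₁ hz, inv_deriv_sub₂ hz, inv_deriv_sub₃ hz,
    ← neg_sub (e₁ L) (e₂ L), ← neg_sub (e₁ L) (e₃ L), ← neg_sub (e₂ L) (e₃ L)]
  field_simp
  ring

theorem p₂_eq {z : ℂ} (hz : z ∉ (half L).lattice) :
    p₂ L z = 2 * (1 - (L.weierstrassP z - e₁ L) ^ 2 / ((e₂ L - e₁ L) * (e₃ L - e₁ L))) /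
      L.derivWeierstrassP z := by
  have hy := derivWeierstrassP_ne_zero hz
  have h12 := sub_ne_zero.2 (e₁_ne_e₂ L)
  have h13 := sub_ne_zero.2 (e₁_ne_e₃ L)
  have h23 := sub_ne_zero.2 (e₂_ne_e₃ L)
  rw [p₂, projInv, inv_deriv_sub₁ hz, inv_deriv_sub₂ hz, inv_deriv_sub₃ hz,
    ← neg_sub (e₁ L) (e₂ L), ← neg_sub (e₁ L) (e₃ L), ← neg_sub (e₂ L) (e₃ L)]
  field_simp
  ring

/-- After `℘'²` is replaced by `4 (℘ - e₁)(℘ - e₂)(℘ - e₃)`, this is an identity of rational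
functions in `℘` and the `eᵢ`. -/
theorem p₁_sq {z : ℂ} (hz : z ∉ (half L).lattice) :
    p₁ L z ^ 2 = α₁ L * p₂ L z ^ 2 + α₂ L := by
  have hy := derivWeierstrassP_ne_zero hz
  have hsq := derivWeierstrassP_sq_eq (notMem_lattice_of_half hz)
  have h12 := sub_ne_zero.2 (e₁_ne_e₂ L)
  have h13 := sub_ne_zero.2 (e₁_ne_e₃ L)
  have h23 := sub_ne_zero.2 (e₂_ne_e₃ L)
  rw [p₁_eq hz, p₂_eq hz, α₁, α₂,
    ← neg_sub (e₁ L) (e₂ L), ← neg_sub (e₁ L) (e₃ L), ← neg_sub (e₂ L) (e₃ L)]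
  field_simp
  rw [hsq]
  ring

theorem p₀_sq {z : ℂ} (hz : z ∉ (half L).lattice) :
    p₀ L z ^ 2 = β₁ L * p₂ L z ^ 2 + β₂ L := by
  have hy := derivWeierstrassP_ne_zero hz
  have hsq := derivWeierstrassP_sq_eq (notMem_lattice_of_half hz)
  have h12 := sub_ne_zero.2 (e₁_ne_e₂ L)
  have h13 := sub_ne_zero.2 (e₁_ne_e₃ L)
  have h23 := sub_ne_zero.2 (e₂_ne_e₃ L)
  rw [p₀_eq hz, p₂_eq hz, β₁, β₂,
    ← neg_sub (e₁ L) (e₂ L), ← neg_sub (e₁ L) (e₃ L)]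
  field_simp
  rw [hsq]
  ring

/-- The translation permutes the four summands up to periods; the weights then differ by the factor
`a`, because `a² = 1`. -/
theorem projInv_add_half₁ {a b : ℂ} (ha : a ^ 2 = 1) (z : ℂ) :
    projInv L a b (z + L.ω₁ / 2) = a * projInv L a b z := by
  have h1 : L.derivWeierstrassP (z + L.ω₁ / 2) = L.derivWeierstrassP (z - L.ω₁ / 2) := by
    rw [← derivWeierstrassP_add (z - L.ω₁ / 2) L.ω₁_mem_lattice]
    congr 1
    ring
  have h2 : L.derivWeierstrassP (z + L.ω₁ / 2 - L.ω₂ / 2) =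
      L.derivWeierstrassP (z - (L.ω₁ + L.ω₂) / 2) := by
    rw [← derivWeierstrassP_add (z - (L.ω₁ + L.ω₂) / 2) L.ω₁_mem_lattice]
    congr 1
    ring
  have h3 : z + L.ω₁ / 2 - (L.ω₁ + L.ω₂) / 2 = z - L.ω₂ / 2 := by ring
  rw [projInv, projInv, h1, h2, h3, add_sub_cancel_right]
  linear_combination (-(1 / L.derivWeierstrassP (z - L.ω₁ / 2)) -
    b * (1 / L.derivWeierstrassP (z - (L.ω₁ + L.ω₂) / 2))) * ha

theorem projInv_add_half₂ {a b : ℂ} (hb : b ^ 2 = 1) (z : ℂ) :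
    projInv L a b (z + L.ω₂ / 2) = b * projInv L a b z := by
  have h1 : L.derivWeierstrassP (z + L.ω₂ / 2) = L.derivWeierstrassP (z - L.ω₂ / 2) := by
    rw [← derivWeierstrassP_add (z - L.ω₂ / 2) L.ω₂_mem_lattice]
    congr 1
    ring
  have h2 : L.derivWeierstrassP (z + L.ω₂ / 2 - L.ω₁ / 2) =
      L.derivWeierstrassP (z - (L.ω₁ + L.ω₂) / 2) := by
    rw [← derivWeierstrassP_add (z - (L.ω₁ + L.ω₂) / 2) L.ω₂_mem_lattice]
    congr 1
    ring
  have h3 : z + L.ω₂ / 2 - (L.ω₁ + L.ω₂) / 2 = z - L.ω₁ / 2 := by ring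
  rw [projInv, projInv, h1, h2, h3, add_sub_cancel_right]
  linear_combination (-(1 / L.derivWeierstrassP (z - L.ω₂ / 2)) -
    a * (1 / L.derivWeierstrassP (z - (L.ω₁ + L.ω₂) / 2))) * hb

theorem projInv_add_lattice {a b : ℂ} (z : ℂ) {l : ℂ} (hl : l ∈ L.lattice) :
    projInv L a b (z + l) = projInv L a b z := by
  simp only [projInv, add_sub_right_comm, derivWeierstrassP_add _ hl]

theorem meromorphic_projInv (a b : ℂ) : Meromorphic (projInv L a b) := by
  have h := L.meromorphic_derivWeierstrassP
  have h' : ∀ c, Meromorphic fun z => L.derivWeierstrassP (z - c) := by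
    intro c z
    exact (h (z - c)).comp_analyticAt (g := fun z => z - c) (by fun_prop)
  have h1 := h' (L.ω₁ / 2)
  have h2 := h' (L.ω₂ / 2)
  have h3 := h' ((L.ω₁ + L.ω₂) / 2)
  unfold projInv
  fun_prop

theorem analyticAt_projInv (a b : ℂ) {z : ℂ} (hz : z ∉ (half L).lattice) :
    AnalyticAt ℂ (projInv L a b) z := by
  have h' : ∀ c, c + c ∈ L.lattice →
      AnalyticAt ℂ (fun z => 1 / L.derivWeierstrassP (z - c)) z := by
    intro c hc
    have h1 : z - c ∉ (half L).lattice := fun h => hz (by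
      simpa using add_mem h (mem_half_lattice.2 hc))
    have h2 := L.analyticOnNhd_derivWeierstrassP _ (notMem_lattice_of_half h1)
    have h3 : AnalyticAt ℂ (fun z => L.derivWeierstrassP (z - c)) z :=
      AnalyticAt.fun_comp (f := fun z => z - c) h2 (by fun_prop)
    exact analyticAt_const.div h3 (derivWeierstrassP_ne_zero h1)
  have h0 := h' 0 (by simp)
  have h1 := h' _ (half₁_add_self L)
  have h2 := h' _ (half₂_add_self L)
  have h3 := h' _ (half₃_add_self L)
  simp only [sub_zero] at h0
  unfold projInv
  fun_prop

/-! ### The constants and branches -/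

theorem sqrtαβ_sq {A B : ℂ} (h : IsRootPair L A B) : sqrtαβ L A B ^ 2 = α₂ L * β₂ L := by
  have h12 := sub_ne_zero.2 (e₁_ne_e₂ L)
  have h13 := sub_ne_zero.2 (e₁_ne_e₃ L)
  have h23 := sub_ne_zero.2 (e₂_ne_e₃ L)
  rw [sqrtαβ, mul_pow, mul_pow, h.sq_A, h.sq_B, α₁, α₂, β₁, β₂]
  field_simp
  ring

theorem sqrtαβ_ne_zero {A B : ℂ} (h : IsRootPair L A B) : sqrtαβ L A B ≠ 0 := by
  have h12 := sub_ne_zero.2 (e₁_ne_e₂ L)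
  have h13 := sub_ne_zero.2 (e₁_ne_e₃ L)
  have h23 := sub_ne_zero.2 (e₂_ne_e₃ L)
  rw [← pow_ne_zero_iff two_ne_zero, sqrtαβ_sq h, α₂, β₂]
  simp [h12, h13, h23]

theorem exists_isRootPair (L : PeriodPair) : ∃ A B : ℂ, IsRootPair L A B := by
  obtain ⟨A, hA⟩ := IsAlgClosed.exists_pow_nat_eq (((e₁ L - e₃ L) / (e₂ L - e₃ L)) ^ 3) two_pos
  obtain ⟨B, hB⟩ := IsAlgClosed.exists_pow_nat_eq (((e₁ L - e₂ L) / (e₂ L - e₃ L)) ^ 3) two_pos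
  exact ⟨A, B, hA, hB⟩

/-- By `p₁_sq` and `p₀_sq` the coefficient of `p₂²` is `A²/α₁ - B²/β₁ = 1`, and the constant term
`A² α₂/α₁² - B² β₂/β₁²` vanishes. These two conditions are what the values of `A²` and `B²` achieve.
-/
theorem p₂_sq {A B : ℂ} (h : IsRootPair L A B) {z : ℂ} (hz : z ∉ (half L).lattice) :
    (A / α₁ L * p₁ L z - B / β₁ L * p₀ L z) * (A / α₁ L * p₁ L z + B / β₁ L * p₀ L z) =
      p₂ L z ^ 2 := by
  have h12 := sub_ne_zero.2 (e₁_ne_e₂ L)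
  have h13 := sub_ne_zero.2 (e₁_ne_e₃ L)
  have h23 := sub_ne_zero.2 (e₂_ne_e₃ L)
  have : (A / α₁ L * p₁ L z - B / β₁ L * p₀ L z) * (A / α₁ L * p₁ L z + B / β₁ L * p₀ L z) =
      A ^ 2 / α₁ L ^ 2 * p₁ L z ^ 2 - B ^ 2 / β₁ L ^ 2 * p₀ L z ^ 2 := by ring
  rw [this, p₁_sq hz, p₀_sq hz, h.sq_A, h.sq_B, α₁, α₂, β₁, β₂]
  field_simp
  ring

theorem exists_isBranchPair {A B : ℂ} (h : IsRootPair L A B) :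
    ∃ ξm ξp : ℂ → ℂ, IsBranchPair L A B ξm ξp := by
  have key : ∀ z, ∃ x y : ℂ, z ∉ (half L).lattice →
      x ^ 2 = A / α₁ L * p₁ L z - B / β₁ L * p₀ L z ∧
      y ^ 2 = A / α₁ L * p₁ L z + B / β₁ L * p₀ L z ∧ x * y = p₂ L z := by
    intro z
    by_cases hz : z ∈ (half L).lattice
    -- On `Λ/2` nothing is required of the branches, and `0` serves as a default value.
    · exact ⟨0, 0, fun h => absurd hz h⟩
    obtain ⟨x, hx⟩ :=
      IsAlgClosed.exists_pow_nat_eq (A / α₁ L * p₁ L z - B / β₁ L * p₀ L z) two_pos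
    obtain ⟨y, hy⟩ :=
      IsAlgClosed.exists_pow_nat_eq (A / α₁ L * p₁ L z + B / β₁ L * p₀ L z) two_pos
    have hxy : (x * y) ^ 2 = p₂ L z ^ 2 := by rw [mul_pow, hx, hy, p₂_sq h hz]
    rcases sq_eq_sq_iff_eq_or_eq_neg.1 hxy with hxy | hxy
    · exact ⟨x, y, fun _ => ⟨hx, hy, hxy⟩⟩
    · exact ⟨x, -y, fun _ => ⟨hx, by rw [neg_sq, hy], by rw [mul_neg, hxy, neg_neg]⟩⟩
  choose x y hxy using key
  exact ⟨x, y, fun z hz => (hxy z hz).1, fun z hz => (hxy z hz).2.1, fun z hz => (hxy z hz).2.2⟩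

/-- The relation between `p₀` and `p₁` which says that `Ω` has determinant one. -/
theorem det_relation (A B : ℂ) {z : ℂ} (hz : z ∉ (half L).lattice) :
    (A / α₁ L * p₁ L z - B / β₁ L * p₀ L z) * (A * p₀ L z + B * p₁ L z) -
      (A / α₁ L * p₁ L z + B / β₁ L * p₀ L z) * (A * p₀ L z - B * p₁ L z) =
      2 * sqrtαβ L A B := by
  have h12 := sub_ne_zero.2 (e₁_ne_e₂ L)
  have h13 := sub_ne_zero.2 (e₁_ne_e₃ L)
  have h23 := sub_ne_zero.2 (e₂_ne_e₃ L)
  have hα : α₁ L ≠ 0 := by rw [α₁]; positivity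
  have hβ : β₁ L ≠ 0 := by rw [β₁]; positivity
  -- The mixed terms cancel, and in `p₁²/α₁ - p₀²/β₁` the function `p₂²` drops out.
  have : (A / α₁ L * p₁ L z - B / β₁ L * p₀ L z) * (A * p₀ L z + B * p₁ L z) -
      (A / α₁ L * p₁ L z + B / β₁ L * p₀ L z) * (A * p₀ L z - B * p₁ L z) =
      2 * (A * B) * (p₁ L z ^ 2 / α₁ L - p₀ L z ^ 2 / β₁ L) := by ring
  rw [this, p₁_sq hz, p₀_sq hz, sqrtαβ]
  field_simp
  ring

theorem det_Omega {A B : ℂ} {ξm ξp : ℂ → ℂ} (h : IsRootPair L A B)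
    (hξ : IsBranchPair L A B ξm ξp) {z : ℂ} (hz : z ∉ (half L).lattice) :
    (Omega L A B ξm ξp z).det = 1 := by
  have h0 := sqrtαβ_ne_zero h
  rw [Omega, Matrix.det_fin_two_of]
  have := det_relation A B hz
  rw [← hξ.sq_m z hz, ← hξ.sq_p z hz] at this
  field_simp
  linear_combination this

end ALia

/-! ### Elliptic functions with poles only at lattice points -/

namespace PeriodPair

variable {L : PeriodPair}

theorem exists_eventuallyEq_id_mul {f : ℂ → ℂ} (hf : AnalyticAt ℂ f 0) (h0 : f 0 = 0) :
    ∃ k, AnalyticAt ℂ k 0 ∧ ∀ᶠ w in 𝓝 0, f w = w * k w := by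
  have : ((1 : ℕ) : ℕ∞) ≤ analyticOrderAt f 0 := by
    rw [natCast_le_analyticOrderAt_iff_iteratedDeriv_eq_zero hf]
    intro i hi
    interval_cases i
    simpa using h0
  simpa using (natCast_le_analyticOrderAt hf).1 this

/-- A holomorphic elliptic function is constant. -/
theorem eq_const_of_analytic_germ {f : ℂ → ℂ} (hper : ∀ l ∈ L.lattice, ∀ z, f (z + l) = f z)
    (hana : ∀ z ∉ L.lattice, AnalyticAt ℂ f z) {g : ℂ → ℂ} (hg : AnalyticAt ℂ g 0)
    (hfg : ∀ᶠ z in 𝓝[≠] 0, f z = g z) : ∃ c, ∀ z ∉ L.lattice, f z = c := by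
  obtain ⟨c, hc⟩ := exists_eventually_eq_const (L := L) f hper fun z => by
    by_cases hz : z ∈ L.lattice
    · simpa using analyticGerm_add (hper z hz) ⟨g, hg, hfg⟩
    · exact ⟨f, hana z hz, Filter.EventuallyEq.rfl⟩
  exact ⟨c, fun z hz => eq_const_of_continuousAt (hc z) (hana z hz).continuousAt⟩

/-- An elliptic function does not have a single simple pole. -/
theorem simple_pole_coeff_eq_zero {f : ℂ → ℂ} (hper : ∀ l ∈ L.lattice, ∀ z, f (z + l) = f z)
    (hana : ∀ z ∉ L.lattice, AnalyticAt ℂ f z) {g : ℂ → ℂ} (hg : AnalyticAt ℂ g 0)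
    (hfg : ∀ᶠ z in 𝓝[≠] 0, z * f z = g z) : g 0 = 0 := by
  have hneg : Filter.Tendsto (fun z : ℂ => -z) (𝓝[≠] 0) (𝓝[≠] 0) := by
    refine tendsto_nhdsWithin_iff.2 ⟨?_, ?_⟩
    · have : ContinuousAt (fun z : ℂ => -z) 0 := by fun_prop
      simpa [ContinuousAt] using this.tendsto.mono_left nhdsWithin_le_nhds
    · filter_upwards [self_mem_nhdsWithin] with z hz
      simpa using hz
  have hg' : AnalyticAt ℂ (fun z => g (-z)) 0 :=
    AnalyticAt.fun_comp (f := fun z : ℂ => -z) (by simpa using hg) (by fun_prop)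
  set c := g 0 + g 0 with hc
  -- Away from `0` near the origin, `N z = z² ((f(z) - f(-z))² - c² ℘(z))`. As `N` is even and
  -- vanishes at `0`, it is divisible by `z²`, so the difference in brackets is holomorphic at `0`
  -- and hence constant.
  set N : ℂ → ℂ := fun z => (g z + g (-z)) ^ 2 - c ^ 2 * (z ^ 2 * L.weierstrassPExcept 0 z + 1)
    with hN
  have hNan : AnalyticAt ℂ N 0 := by
    have := L.analyticAt_weierstrassPExcept 0
    exact ((hg.add hg').pow 2).sub (analyticAt_const.mul (by fun_prop))
  have hNeven : ∀ z, N (-z) = N z := by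
    intro z
    have h := L.weierstrassPExcept_neg 0 z
    rw [neg_zero] at h
    simp only [hN, h, neg_neg]
    ring
  have hNd : deriv N 0 = 0 := by
    have h := deriv_comp_neg N (0 : ℂ)
    rw [funext hNeven, neg_zero] at h
    linear_combination h / 2
  obtain ⟨k, hk, hNk⟩ := exists_eventuallyEq_sq_mul hNan (by simp [hN, hc]) hNd
  obtain ⟨d, hd⟩ := eq_const_of_analytic_germ (L := L)
    (f := fun z => (f z - f (-z)) ^ 2 - c ^ 2 * L.weierstrassP z) (fun l hl z => by
      simp only [hper l hl, weierstrassP_add z hl]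
      rw [neg_add, hper _ (neg_mem hl)]) (fun z hz => by
      have h1 := hana z hz
      have h2 : AnalyticAt ℂ (fun z => f (-z)) z :=
        AnalyticAt.fun_comp (f := fun z : ℂ => -z) (hana (-z) (by simpa using hz)) (by fun_prop)
      have h3 := L.analyticOnNhd_weierstrassP z hz
      exact ((h1.sub h2).pow 2).sub (analyticAt_const.mul h3)) hk (by
      filter_upwards [hfg, hneg.eventually hfg, nhdsWithin_le_nhds hNk, self_mem_nhdsWithin]
        with z h1 h2 h3 hz
      have hz : z ≠ 0 := hz
      refine mul_left_cancel₀ (pow_ne_zero 2 hz) ?_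
      rw [sub_zero] at h3
      rw [← h3, hN, weierstrassP_eq_add_inv]
      simp only [← h1, ← h2]
      field_simp
      ring)
  -- The odd part of `f` vanishes at half periods. So `c² ℘` takes the same value at all of them,
  -- and `e₁ ≠ e₂` leaves only `c = 0`.
  have hhalf : ∀ w ∉ L.lattice, w + w ∈ L.lattice → c ^ 2 * L.weierstrassP w = -d := by
    intro w hw hw2
    have h1 := hd w hw
    have h2 : f (-w) = f w := by rw [← hper _ hw2 (-w), neg_add_cancel_left]
    simp only [h2, sub_self] at h1
    linear_combination -h1
  have h1 := hhalf _ L.ω₁_div_two_notMem_lattice (ALia.half₁_add_self L)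
  have h2 := hhalf _ L.ω₂_div_two_notMem_lattice (ALia.half₂_add_self L)
  have h3 : c ^ 2 * (ALia.e₁ L - ALia.e₂ L) = 0 := by
    rw [ALia.e₁, ALia.e₂]
    linear_combination h1 - h2
  have h4 := pow_eq_zero_iff (two_ne_zero) |>.1
    ((mul_eq_zero.1 h3).resolve_right (sub_ne_zero.2 (ALia.e₁_ne_e₂ L)))
  linear_combination h4 / 2

open Polynomial in
/-- For every `n ≥ 2` there is a polynomial in `℘` and `℘'` with a pole of order `n` at `0`. -/
theorem exists_pole_order (L : PeriodPair) {n : ℕ} (hn : 2 ≤ n) :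
    ∃ P Q : ℂ[X], ∃ m : ℂ → ℂ, AnalyticAt ℂ m 0 ∧ m 0 = 1 ∧ ∀ z ≠ 0,
      z ^ n * (P.eval (L.weierstrassP z) + Q.eval (L.weierstrassP z) * L.derivWeierstrassP z) =
        m z := by
  have h1 := L.analyticAt_weierstrassPExcept 0
  have h2 := L.analyticAt_derivWeierstrassPExcept 0
  rcases Nat.even_or_odd' n with ⟨j, rfl | rfl⟩
  · refine ⟨X ^ j, 0, fun z => (z ^ 2 * L.weierstrassPExcept 0 z + 1) ^ j, by fun_prop, by simp,
      fun z hz => ?_⟩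
    rw [weierstrassP_eq_add_inv, pow_mul, eval_pow, eval_X, eval_zero, zero_mul, add_zero,
      ← mul_pow]
    congr 1
    field_simp
  · obtain ⟨i, rfl⟩ : ∃ i, j = i + 1 := ⟨j - 1, by omega⟩
    -- Here `n = 2 i + 3` is the pole order of `℘ⁱ ℘'`, and `-1/2` normalises the leading term
    -- `-2/z³` of `℘'`.
    refine ⟨0, C (-1 / 2) * X ^ i, fun z => (z ^ 2 * L.weierstrassPExcept 0 z + 1) ^ i *
      (-1 / 2 * (z ^ 3 * L.derivWeierstrassPExcept 0 z - 2)), by fun_prop, by simp,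
      fun z hz => ?_⟩
    have e1 : z ^ 2 * L.weierstrassPExcept 0 z + 1 = z ^ 2 * L.weierstrassP z := by
      rw [weierstrassP_eq_add_inv]
      field_simp
    have e2 : z ^ 3 * L.derivWeierstrassPExcept 0 z - 2 = z ^ 3 * L.derivWeierstrassP z := by
      rw [derivWeierstrassP_eq_sub]
      field_simp
    simp only [e1, e2]
    simp only [eval_zero, eval_mul, eval_C, eval_pow, eval_X]
    ring

open Polynomial in
/-- An elliptic function whose poles are lattice points is a polynomial in `℘` and `℘'`. -/
theorem exists_polynomial_eq {f : ℂ → ℂ} (hper : ∀ l ∈ L.lattice, ∀ z, f (z + l) = f z)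
    (hana : ∀ z ∉ L.lattice, AnalyticAt ℂ f z) (hmer : MeromorphicAt f 0) :
    ∃ P Q : ℂ[X], ∀ z ∉ L.lattice,
      f z = P.eval (L.weierstrassP z) + Q.eval (L.weierstrassP z) * L.derivWeierstrassP z := by
  obtain ⟨n, hn⟩ := hmer
  -- The induction runs on a bound `n` for the pole order at `0`, with `f` varying.
  have hg : ∃ g, AnalyticAt ℂ g 0 ∧ ∀ᶠ z in 𝓝[≠] 0, z ^ n * f z = g z :=
    ⟨_, hn, Filter.Eventually.of_forall fun z => by simp⟩
  clear hn
  induction n generalizing f with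
  | zero =>
    obtain ⟨g, hg, hfg⟩ := hg
    obtain ⟨c, hc⟩ := eq_const_of_analytic_germ hper hana hg (by simpa using hfg)
    exact ⟨C c, 0, fun z hz => by simp [hc z hz]⟩
  | succ n ih =>
    obtain ⟨g, hg, hfg⟩ := hg
    have hred : ∀ {f g : ℂ → ℂ}, AnalyticAt ℂ g 0 → g 0 = 0 →
        (∀ᶠ z in 𝓝[≠] 0, z ^ (n + 1) * f z = g z) →
        ∃ k, AnalyticAt ℂ k 0 ∧ ∀ᶠ z in 𝓝[≠] 0, z ^ n * f z = k z := by
      intro f g hg hg0 hfg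
      obtain ⟨k, hk, hgk⟩ := exists_eventuallyEq_id_mul hg hg0
      refine ⟨k, hk, ?_⟩
      filter_upwards [hfg, nhdsWithin_le_nhds hgk, self_mem_nhdsWithin] with z h1 h2 hz
      refine mul_left_cancel₀ (show z ≠ 0 from hz) ?_
      rw [← h2, ← h1]
      ring
    -- A pole of order at most one is no pole at all; from order two on, a multiple of a monomial in
    -- `℘` and `℘'` removes the leading term.
    rcases Nat.eq_zero_or_pos n with rfl | hpos
    · exact ih hper hana
        (hred hg (simple_pole_coeff_eq_zero hper hana hg (by simpa using hfg)) hfg)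
    · obtain ⟨P, Q, m, hm, hm0, hmz⟩ := L.exists_pole_order (n := n + 1) (by omega)
      obtain ⟨P', Q', h⟩ := ih (f := fun z => f z - g 0 *
        (P.eval (L.weierstrassP z) + Q.eval (L.weierstrassP z) * L.derivWeierstrassP z))
        (fun l hl z => by
          simp only [hper l hl, weierstrassP_add z hl, derivWeierstrassP_add z hl])
        (fun z hz => by
          have h1 := L.analyticOnNhd_weierstrassP z hz
          have h2 := L.analyticOnNhd_derivWeierstrassP z hz
          have h3 := hana z hz
          have h4 : ∀ R : ℂ[X], AnalyticAt ℂ (fun z => R.eval (L.weierstrassP z)) z := fun R =>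
            by simpa using AnalyticAt.aeval_polynomial h1 R
          have h5 := h4 P
          have h6 := h4 Q
          fun_prop)
        (hred (g := fun z => g z - g 0 * m z) (by fun_prop) (by simp [hm0]) (by
          filter_upwards [hfg, self_mem_nhdsWithin] with z h1 hz
          rw [← h1, ← hmz z hz]
          ring))
      refine ⟨P' + C (g 0) * P, Q' + C (g 0) * Q, fun z hz => ?_⟩
      have := h z hz
      simp only [eval_add, eval_mul, eval_C]
      linear_combination this

open Polynomial in
-- `℘` tends to infinity at `0`, while the zeros of a nonzero polynomial form a bounded set.
theorem eq_zero_of_eval_weierstrassP {P : ℂ[X]}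
    (h : ∀ᶠ z in 𝓝[≠] 0, P.eval (L.weierstrassP z) = 0) : P = 0 := by
  by_contra hP
  have ht : Filter.Tendsto L.weierstrassP (𝓝[≠] 0) (Bornology.cobounded ℂ) :=
    tendsto_cobounded_of_meromorphicOrderAt_neg (by
      rw [L.order_weierstrassP 0 (zero_mem _)]
      decide)
  have hfin : Bornology.IsBounded {x : ℂ | P.eval x = 0} := by
    refine (P.roots.toFinset.finite_toSet.subset fun x hx => ?_).isBounded
    simpa [hP] using hx
  obtain ⟨z, h1, h2⟩ := (h.and (ht.eventually (Bornology.isBounded_def.1 hfin))).exists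
  exact h2 h1

open Polynomial in
/-- `1` and `℘'` are independent over `ℂ[℘]`. -/
theorem eq_zero_of_eval_add_eval_mul {P Q : ℂ[X]} (h : ∀ z ∉ L.lattice,
    P.eval (L.weierstrassP z) + Q.eval (L.weierstrassP z) * L.derivWeierstrassP z = 0) :
    P = 0 ∧ Q = 0 := by
  have h' : ∀ z ∉ L.lattice,
      P.eval (L.weierstrassP z) - Q.eval (L.weierstrassP z) * L.derivWeierstrassP z = 0 := by
    intro z hz
    have := h (-z) (by simpa using hz)
    rw [weierstrassP_neg, derivWeierstrassP_neg] at this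
    linear_combination this
  constructor
  · refine eq_zero_of_eval_weierstrassP (L := L) ?_
    filter_upwards [L.eventually_notMem_lattice 0] with z hz
    linear_combination (h z hz + h' z hz) / 2
  · refine eq_zero_of_eval_weierstrassP (L := L) ?_
    -- Points off `Λ/2` are used here because `℘'` is nonzero there and can be cancelled.
    filter_upwards [(ALia.half L).eventually_notMem_lattice 0] with z hz
    have hz' := ALia.notMem_lattice_of_half hz
    refine (mul_eq_zero.1 ?_).resolve_right (ALia.derivWeierstrassP_ne_zero hz)
    linear_combination (h z hz' - h' z hz') / 2

end PeriodPair

/-! ### The coordinate ring of the Weierstrass cubic -/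

namespace ALia

open Polynomial PeriodPair

/-- The equation rewrites `y²` as a cubic in `x`, so a remainder of degree at most one in `y` can be
kept through multiplication by `x` and by `y`. -/
theorem exists_weierstrass_normal_form (L : PeriodPair) (p : MvPolynomial (Fin 2) ℂ) :
    ∃ P Q : ℂ[X], p - (aeval (MvPolynomial.X 0) P + aeval (MvPolynomial.X 0) Q * MvPolynomial.X 1) ∈
      Ideal.span {(MvPolynomial.X 1 ^ 2 - 4 * MvPolynomial.X 0 ^ 3 +
        MvPolynomial.C L.g₂ * MvPolynomial.X 0 + MvPolynomial.C L.g₃ :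
          MvPolynomial (Fin 2) ℂ)} := by
  induction p using MvPolynomial.induction_on with
  | C a => exact ⟨C a, 0, by simp [MvPolynomial.algebraMap_eq]⟩
  | add p q hp hq =>
    obtain ⟨P, Q, h⟩ := hp
    obtain ⟨P', Q', h'⟩ := hq
    refine ⟨P + P', Q + Q', ?_⟩
    convert add_mem h h' using 1
    simp only [map_add]
    ring
  | mul_X p i hp =>
    obtain ⟨P, Q, h⟩ := hp
    fin_cases i
    · refine ⟨X * P, X * Q, ?_⟩
      convert Ideal.mul_mem_right (MvPolynomial.X 0) _ h using 1
      simp only [map_mul, aeval_X, Fin.zero_eta]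
      ring
    · refine ⟨Q * (4 * X ^ 3 - C L.g₂ * X - C L.g₃), P, ?_⟩
      have h1 := Ideal.mul_mem_right (MvPolynomial.X 1) _ h
      have h2 := Ideal.mul_mem_left _ (aeval (MvPolynomial.X 0) Q)
        (Ideal.mem_span_singleton_self (MvPolynomial.X 1 ^ 2 - 4 * MvPolynomial.X 0 ^ 3 +
        MvPolynomial.C L.g₂ * MvPolynomial.X 0 + MvPolynomial.C L.g₃ :
          MvPolynomial (Fin 2) ℂ))
      convert add_mem h1 h2 using 1
      simp only [map_mul, map_sub, map_pow, aeval_X, aeval_C, Fin.mk_one, map_ofNat,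
        MvPolynomial.algebraMap_eq]
      ring

/-- `ℂ[x, y] / (y² - 4x³ + g₂ x + g₃)` is a subalgebra generated by two elements satisfying the
relation, provided that `1, y` are independent over `ℂ[x]`. -/
theorem nonempty_weierstrassRing_equiv (L : PeriodPair) {R : Type*} [CommRing R] [Algebra ℂ R]
    (x y : R) (hxy : y ^ 2 - 4 * x ^ 3 + algebraMap ℂ R L.g₂ * x + algebraMap ℂ R L.g₃ = 0)
    (hind : ∀ P Q : ℂ[X], aeval x P + aeval x Q * y = 0 → P = 0 ∧ Q = 0) :
    Nonempty (WeierstrassRing L ≃ₐ[ℂ] Algebra.adjoin ℂ {x, y}) := by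
  set φ : MvPolynomial (Fin 2) ℂ →ₐ[ℂ] R := MvPolynomial.aeval ![x, y] with hφ
  have hrange : φ.range = Algebra.adjoin ℂ {x, y} := by
    rw [hφ, ← Algebra.adjoin_range_eq_range_aeval]
    simp [Set.pair_comm]
  have hker : RingHom.ker φ = Ideal.span {(MvPolynomial.X 1 ^ 2 - 4 * MvPolynomial.X 0 ^ 3 +
      MvPolynomial.C L.g₂ * MvPolynomial.X 0 + MvPolynomial.C L.g₃ :
        MvPolynomial (Fin 2) ℂ)} := by
    have hle : Ideal.span {(MvPolynomial.X 1 ^ 2 - 4 * MvPolynomial.X 0 ^ 3 +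
        MvPolynomial.C L.g₂ * MvPolynomial.X 0 + MvPolynomial.C L.g₃ :
          MvPolynomial (Fin 2) ℂ)} ≤ RingHom.ker φ := by
      rw [Ideal.span_singleton_le_iff_mem, RingHom.mem_ker]
      simpa [hφ] using hxy
    -- An element of the kernel has a normal form `P + Q y` that also maps to zero; independence
    -- makes it vanish, so the element lies in the ideal.
    refine le_antisymm (fun p hp => ?_) hle
    obtain ⟨P, Q, h⟩ := exists_weierstrass_normal_form L p
    have h1 := hle h
    rw [RingHom.mem_ker] at hp h1
    rw [map_sub, hp, zero_sub, neg_eq_zero, map_add, map_mul, ← Polynomial.aeval_algHom_apply,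
      ← Polynomial.aeval_algHom_apply] at h1
    obtain ⟨rfl, rfl⟩ := hind P Q (by simpa [hφ] using h1)
    simpa using h
  exact ⟨((Ideal.quotientEquivAlgOfEq ℂ hker.symm).trans
    (Ideal.quotientKerEquivRange φ)).trans (Subalgebra.equivOfEq _ _ hrange)⟩

end ALia

/-! ### Automorphisms of the torus and the genus of the quotient -/

namespace ALia

open PeriodPair

variable {L : PeriodPair}

theorem proj_eq_proj {z w : ℂ} : proj L z = proj L w ↔ z - w ∈ L.lattice :=
  Submodule.Quotient.eq _

theorem proj_surjective (L : PeriodPair) : Function.Surjective (proj L) :=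
  Submodule.Quotient.mk_surjective _

theorem isCoveringMap_proj (L : PeriodPair) : IsCoveringMap (proj L) :=
  (AddSubgroup.isAddQuotientCoveringMap_of_comm L.lattice.toAddSubgroup
    ⟨inferInstanceAs (DiscreteTopology L.lattice)⟩).isCoveringMap

theorem continuous_proj (L : PeriodPair) : Continuous (proj L) := (isCoveringMap_proj L).continuous

/-- Uniqueness of lifts: `f` and a suitable translate of `g` by a lattice vector lift the same map
to the torus and agree at `w`. -/
theorem eq_of_sub_mem_lattice {f g : ℂ → ℂ} (hf : Continuous f) (hg : Continuous g)
    (h : ∀ z, f z - g z ∈ L.lattice) (z w : ℂ) : f z - g z = f w - g w := by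
  have h1 := (isCoveringMap_proj L).eq_of_comp_eq (g₁ := f) (g₂ := fun x => g x + (f w - g w)) hf
    (by fun_prop) (by
      funext x
      refine proj_eq_proj.2 ?_
      convert sub_mem (h x) (h w) using 1
      ring) w (by ring)
  have := congrFun h1 z
  linear_combination this

/-- The lift `G` to the universal cover is entire, and `G(z + l) - G(z)` is constant for each period
`l`. So `G'` is an entire periodic function, hence constant. -/
theorem IsHolomorphic.exists_affine {F : Torus L → Torus L} (hF : IsHolomorphic F) :
    ∃ a b : ℂ, ∀ z, F (proj L z) = proj L (a * z + b) := by
  have hcont : Continuous fun z => F (proj L z) := by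
    refine continuous_iff_continuousAt.2 fun z => ?_
    obtain ⟨s, hs, hs'⟩ := hF z
    exact ((continuous_proj L).continuousAt.comp hs.continuousAt).congr
      (by filter_upwards [hs'] with w hw using hw.symm)
  obtain ⟨e, he⟩ := proj_surjective L (F (proj L 0))
  obtain ⟨G, ⟨-, hG⟩, -⟩ :=
    (isCoveringMap_proj L).existsUnique_continuousMap_lifts ⟨_, hcont⟩ 0 e he
  replace hG : ∀ z, proj L (G z) = F (proj L z) := fun z => congrFun hG z
  have hd : Differentiable ℂ G := by
    intro z
    obtain ⟨s, hs, hs'⟩ := hF z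
    have h1 : ContinuousAt (fun w => G w - s w) z := G.continuous.continuousAt.sub hs.continuousAt
    have h2 := h1.eventually (L.compl_lattice_sdiff_singleton_mem_nhds _)
    refine (hs.add (analyticAt_const (v := G z - s z))).differentiableAt.congr_of_eventuallyEq ?_
    filter_upwards [hs', h2] with w h3 h4
    have h5 : G w - s w ∈ L.lattice := proj_eq_proj.1 (by rw [hG, h3])
    have h6 : G w - s w = G z - s z := by
      by_contra hne
      exact h4 ⟨h5, hne⟩
    rw [Pi.add_apply, ← h6]
    ring
  have hper : ∀ z, ∀ l ∈ L.lattice, deriv G (z + l) = deriv G z := by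
    intro z l hl
    have h1 : (fun w => G (w + l)) = fun w => G w + (G (0 + l) - G 0) := by
      funext w
      have := eq_of_sub_mem_lattice (L := L) (f := fun w => G (w + l)) (g := G) (by fun_prop)
        G.continuous (fun z => proj_eq_proj.1 (by
          rw [hG, hG]
          congr 1
          exact proj_eq_proj.2 (by simpa using hl))) w 0
      linear_combination this
    rw [← deriv_comp_add_const, h1, deriv_add_const]
  have hd' : Differentiable ℂ (deriv G) := fun z =>
    ((hd.analyticAt z).deriv).differentiableAt
  have hconst : ∀ z, deriv G z = deriv G 0 := fun z =>
    hd'.apply_eq_apply_of_bounded (IsZLattice.isCompact_range_of_periodic L.lattice _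
      hd'.continuous hper).isBounded z 0
  refine ⟨deriv G 0, G 0, fun z => ?_⟩
  rw [← hG]
  congr 1
  have h0 : Differentiable ℂ fun z => G z - deriv G 0 * z := by fun_prop
  have h1 := is_const_of_deriv_eq_zero h0 (fun z => by
    have := ((hd z).hasDerivAt.sub ((hasDerivAt_id z).const_mul (deriv G 0))).deriv
    simp only [id, mul_one] at this
    rw [hconst z, sub_self] at this
    exact this) z 0
  linear_combination h1

theorem klein_mul_self (γ : Klein) : γ * γ = 1 := by
  revert γ
  decide

theorem sigma_apply_apply (σ : Klein →* TorusAut L) (γ : Klein) (x : Torus L) :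
    (σ γ : Equiv.Perm (Torus L)) ((σ γ : Equiv.Perm (Torus L)) x) = x := by
  have h : σ γ * σ γ = 1 := by rw [← map_mul, klein_mul_self, map_one]
  exact congrArg (fun g : TorusAut L => (g : Equiv.Perm (Torus L)) x) h

/-- Every element of `C₂ × C₂` squares to one, so the affine lift satisfies `a² = 1`; for `a = 1`
the square is translation by `2 b`, which must be a period. -/
theorem exists_affine_sigma (σ : Klein →* TorusAut L) (γ : Klein) :
    ∃ a b : ℂ, (a = 1 ∧ b + b ∈ L.lattice ∨ a = -1) ∧
      ∀ z, (σ γ : Equiv.Perm (Torus L)) (proj L z) = proj L (a * z + b) := by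
  obtain ⟨a, b, h⟩ := IsHolomorphic.exists_affine (σ γ).2.1
  refine ⟨a, b, ?_, h⟩
  have h1 : ∀ z, a * (a * z + b) + b - z ∈ L.lattice := by
    intro z
    rw [← proj_eq_proj, ← h (a * z + b), ← h z, sigma_apply_apply]
  have h2 := eq_of_sub_mem_lattice (L := L) (f := fun z => a * (a * z + b) + b) (g := id)
    (by fun_prop) continuous_id h1 1 0
  have h3 : a ^ 2 = 1 := by
    simp only [id] at h2
    linear_combination h2
  rcases eq_or_eq_neg_of_sq_eq_sq a 1 (by simpa using h3) with rfl | rfl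
  · left
    simpa using h1 0
  · right
    rfl

/-- The identity of the circle does not lift to a real function. -/
theorem not_exists_section :
    ¬ ∃ k : AddCircle (1 : ℝ) → ℝ, Continuous k ∧ ∀ x, (k x : AddCircle (1 : ℝ)) = x := by
  rintro ⟨k, hk, h⟩
  -- Along `ℝ`, uniqueness of lifts gives `k(t) = t + k(0)`, which is not periodic.
  have h1 := (AddCircle.isCoveringMap_coe (1 : ℝ)).eq_of_comp_eq
    (g₁ := fun t : ℝ => k t) (g₂ := fun t : ℝ => t + k ((0 : ℝ) : AddCircle (1 : ℝ)))
    (hk.comp (AddCircle.continuous_mk' 1)) (by fun_prop) (by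
      funext t
      simp [h]) 0 (by simp)
  have h2 := congrFun h1 1
  have h3 : ((1 : ℝ) : AddCircle (1 : ℝ)) = ((0 : ℝ) : AddCircle (1 : ℝ)) := by simp
  simp only [h3] at h2
  linarith

/-- If some element acts with linear part `-1`, every map from the quotient to the circle lifts to a
real function, so that the quotient is not a torus. -/
theorem linear_part_ne_neg_one {σ : Klein →* TorusAut L} (hg : QuotientHasGenusOne σ) (γ : Klein)
    {b : ℂ} (hγ : ∀ z, (σ γ : Equiv.Perm (Torus L)) (proj L z) = proj L (-z + b)) : False := by
  obtain ⟨H⟩ := hg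
  let q : ℂ → MulAction.orbitRel.Quotient σ.range (Torus L) := fun z => Quotient.mk _ (proj L z)
  have hq : Topology.IsQuotientMap q :=
    isQuotientMap_quotient_mk'.comp
      ((isCoveringMap_proj L).isQuotientMap (proj_surjective L))
  have hqσ : ∀ (δ : Klein) z w, (σ δ : Equiv.Perm (Torus L)) (proj L z) = proj L w → q w = q z :=
    fun δ z w h => Quotient.sound ⟨⟨σ δ, δ, rfl⟩, h⟩
  have hqe : ∀ z w, q w = q z → ∃ δ, (σ δ : Equiv.Perm (Torus L)) (proj L z) = proj L w := by
    intro z w h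
    obtain ⟨⟨_, δ, rfl⟩, h⟩ := Quotient.exact h
    exact ⟨δ, h⟩
  have hql : ∀ z, ∀ l ∈ L.lattice, q (z + l) = q z := by
    intro z l hl
    have : proj L (z + l) = proj L z := proj_eq_proj.2 (by simpa using hl)
    simp only [q, this]
  let f : C(ℂ, AddCircle (1 : ℝ)) :=
    ⟨fun z => (H (q z)).1, continuous_fst.comp (H.continuous.comp hq.continuous)⟩
  obtain ⟨e, he⟩ := QuotientAddGroup.mk_surjective (f 0)
  obtain ⟨F, ⟨-, hF⟩, -⟩ :=
    (AddCircle.isCoveringMap_coe (1 : ℝ)).existsUnique_continuousMap_lifts f 0 e he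
  replace hF : ∀ z, (F z : AddCircle (1 : ℝ)) = (H (q z)).1 := fun z => congrFun hF z
  -- The reflection `z ↦ -z + c` fixes `c / 2`, so the two lifts agree there and hence everywhere.
  have hrefl : ∀ c : ℂ, (∀ z, q (-z + c) = q z) → ∀ z, F (-z + c) = F z := by
    intro c hc z
    refine congrFun ((AddCircle.isCoveringMap_coe (1 : ℝ)).eq_of_comp_eq
      (g₁ := fun z => F (-z + c)) (g₂ := F) (by fun_prop) F.continuous (by
        funext z
        simp only [Function.comp, hF, hc]) (c / 2) ?_) z
    congr 1
    ring
  -- Translation by a period is the composite of two reflections from the group generated by `σ(γ)`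
  -- and `Λ`.
  have hFl : ∀ z, ∀ l ∈ L.lattice, F (z + l) = F z := by
    intro z l hl
    have h1 := hrefl b (fun z => hqσ γ _ _ (hγ z)) (-z + b)
    have h2 := hrefl (b + l) (fun z => by
      rw [← add_assoc, hql _ l hl]
      exact hqσ γ _ _ (hγ z)) (-z + b)
    have h3 : -(-z + b) + (b + l) = z + l := by ring
    rw [h3] at h2
    have h4 : -(-z + b) + b = z := by ring
    rw [h4] at h1
    rw [h2, h1]
  have hFσ : ∀ z w, q w = q z → F w = F z := by
    intro z w h
    obtain ⟨δ, hδ⟩ := hqe z w h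
    obtain ⟨a, c, hac, h⟩ := exists_affine_sigma σ δ
    have hFac : F (a * z + c) = F z := by
      rcases hac with ⟨rfl, hc⟩ | rfl
      -- A translation by `c` changes the lift by a constant. As `2 c` is a period, twice this
      -- constant is zero.
      · have h1 := (AddCircle.isCoveringMap_coe (1 : ℝ)).eq_of_comp_eq
          (g₁ := fun z => F (z + c)) (g₂ := fun z => F z + (F c - F 0)) (by fun_prop)
          (by fun_prop) (by
            funext z
            have h2 : ∀ z, q (z + c) = q z := fun z => hqσ δ _ _ (by rw [h, one_mul])
            have h3 := h2 0
            rw [zero_add] at h3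
            simp only [Function.comp, AddCircle.coe_add, AddCircle.coe_sub, hF, h2, h3, sub_self,
              add_zero]) 0 (by simp)
        have h2 := congrFun h1 z
        have h3 := congrFun h1 (z + c)
        rw [add_assoc, hFl _ _ hc] at h3
        rw [one_mul]
        linarith
      · simpa using hrefl c (fun z => hqσ δ _ _ (by rw [h, neg_one_mul])) z
    rw [h z] at hδ
    have h1 := hFl (a * z + c) _ (proj_eq_proj.1 hδ.symm)
    rw [← hFac, ← h1]
    congr 1
    ring
  let k : C(MulAction.orbitRel.Quotient σ.range (Torus L), ℝ) :=
    Topology.IsQuotientMap.lift (f := ⟨q, hq.continuous⟩) hq F fun z w h => hFσ w z h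
  have hk : ∀ x, (k x : AddCircle (1 : ℝ)) = (H x).1 := by
    intro x
    obtain ⟨z, rfl⟩ := hq.surjective x
    rw [← hF]
    congr 1
    exact congrArg (fun g : C(ℂ, ℝ) => g z)
      (Topology.IsQuotientMap.lift_comp (f := ⟨q, hq.continuous⟩) hq F fun z w h => hFσ w z h)
  -- So the first coordinate of the product of circles lifts to `ℝ`; its restriction to a circle
  -- with second coordinate `0` would lift the identity.
  exact not_exists_section ⟨fun t => k (H.symm (t, 0)), by fun_prop, fun t => by simp [hk]⟩

theorem exists_translation {σ : Klein →* TorusAut L} (hg : QuotientHasGenusOne σ) (γ : Klein) :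
    ∃ b : ℂ, b + b ∈ L.lattice ∧
      ∀ z, (σ γ : Equiv.Perm (Torus L)) (proj L z) = proj L (z + b) := by
  obtain ⟨a, b, ⟨rfl, hb⟩ | rfl, h⟩ := exists_affine_sigma σ γ
  · exact ⟨b, hb, by simpa using h⟩
  · exact (linear_part_ne_neg_one hg γ (b := b) (by simpa using h)).elim

theorem proj_half_mem {b : ℂ} (hb : b + b ∈ L.lattice) :
    proj L b ∈ ({proj L 0, proj L (L.ω₁ / 2), proj L (L.ω₂ / 2), proj L ((L.ω₁ + L.ω₂) / 2)} :
      Set (Torus L)) := by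
  obtain ⟨m, n, h⟩ := mem_lattice.1 hb
  simp only [Set.mem_insert_iff, Set.mem_singleton_iff, proj_eq_proj, mem_lattice]
  rcases Int.even_or_odd' m with ⟨i, rfl | rfl⟩ <;> rcases Int.even_or_odd' n with ⟨j, rfl | rfl⟩ <;>
    push_cast at h
  · exact .inl ⟨i, j, by linear_combination h / 2⟩
  · exact .inr (.inr (.inl ⟨i, j, by linear_combination h / 2⟩))
  · exact .inr (.inl ⟨i, j, by linear_combination h / 2⟩)
  · exact .inr (.inr (.inr ⟨i, j, by linear_combination h / 2⟩))

/-- If the quotient has genus one, `C₂ × C₂` acts by all the translations by half periods. -/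
theorem exists_sigma_eq_translation {σ : Klein →* TorusAut L} (hσ : Function.Injective σ)
    (hg : QuotientHasGenusOne σ) {b : ℂ} (hb : b + b ∈ L.lattice) :
    ∃ γ, ∀ z, (σ γ : Equiv.Perm (Torus L)) (proj L z) = proj L (z + b) := by
  classical
  choose τ hτ hτ' using exists_translation hg
  have hinj : Function.Injective fun γ => proj L (τ γ) := by
    intro γ δ h
    refine hσ (Subtype.ext (Equiv.ext fun x => ?_))
    obtain ⟨z, rfl⟩ := proj_surjective L x
    rw [hτ', hτ', proj_eq_proj]
    simpa using proj_eq_proj.1 h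
  -- Injectivity of `σ` gives four distinct translations, and there are at most four half-period
  -- classes.
  have hS : (Finset.univ.image fun γ => proj L (τ γ)) =
      {proj L 0, proj L (L.ω₁ / 2), proj L (L.ω₂ / 2), proj L ((L.ω₁ + L.ω₂) / 2)} := by
    refine Finset.eq_of_subset_of_card_le (fun x hx => ?_) ?_
    · obtain ⟨γ, -, rfl⟩ := Finset.mem_image.1 hx
      simpa using proj_half_mem (hτ γ)
    · rw [Finset.card_image_of_injective _ hinj]
      exact Finset.card_le_four
  have hb' : proj L b ∈ Finset.univ.image fun γ => proj L (τ γ) := by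
    rw [hS]
    simpa using proj_half_mem hb
  obtain ⟨γ, -, h⟩ := Finset.mem_image.1 hb'
  refine ⟨γ, fun z => ?_⟩
  rw [hτ', proj_eq_proj]
  simpa using proj_eq_proj.1 h

theorem proj_mem_punctures {σ : Klein →* TorusAut L} (hσ : Function.Injective σ)
    (hg : QuotientHasGenusOne σ) {z : ℂ} : proj L z ∈ punctures σ ↔ z ∈ (half L).lattice := by
  rw [mem_half_lattice]
  constructor
  · rintro ⟨γ, h⟩
    obtain ⟨b, hb, hγ⟩ := exists_translation hg γ
    simp only [hγ, zero_add, proj_eq_proj] at h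
    convert sub_mem hb (add_mem h h) using 1
    ring
  · intro h
    obtain ⟨γ, hγ⟩ := exists_sigma_eq_translation hσ hg h
    exact ⟨γ, by simp [hγ]⟩

end ALia

namespace ALia

/-! ### The Lie algebra `sl₂` -/

theorem sl2_apply_one_one (X : sl2) : X.1 1 1 = -X.1 0 0 := by
  have h : Matrix.trace X.1 = 0 := X.2
  rw [Matrix.trace_fin_two] at h
  linear_combination h

theorem sl2_ext {X Y : sl2} (h0 : X.1 0 0 = Y.1 0 0) (h1 : X.1 0 1 = Y.1 0 1)
    (h2 : X.1 1 0 = Y.1 1 0) : X = Y := by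
  refine Subtype.ext (Matrix.ext fun i j => ?_)
  fin_cases i <;> fin_cases j
  · exact h0
  · exact h1
  · exact h2
  · simpa [sl2_apply_one_one] using h0

theorem coe_lie (X Y : sl2) : (⁅X, Y⁆ : sl2).1 = X.1 * Y.1 - Y.1 * X.1 := rfl

theorem lie_apply_zero_zero (X Y : sl2) :
    (⁅X, Y⁆ : sl2).1 0 0 = X.1 0 1 * Y.1 1 0 - Y.1 0 1 * X.1 1 0 := by
  rw [coe_lie, Matrix.sub_apply, Matrix.mul_apply,
    Matrix.mul_apply, Fin.sum_univ_two, Fin.sum_univ_two]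
  ring

theorem lie_apply_zero_one (X Y : sl2) :
    (⁅X, Y⁆ : sl2).1 0 1 = 2 * (X.1 0 0 * Y.1 0 1 - Y.1 0 0 * X.1 0 1) := by
  rw [coe_lie, Matrix.sub_apply, Matrix.mul_apply,
    Matrix.mul_apply, Fin.sum_univ_two, Fin.sum_univ_two, sl2_apply_one_one, sl2_apply_one_one]
  ring

theorem lie_apply_one_zero (X Y : sl2) :
    (⁅X, Y⁆ : sl2).1 1 0 = 2 * (Y.1 0 0 * X.1 1 0 - X.1 0 0 * Y.1 1 0) := by
  rw [coe_lie, Matrix.sub_apply, Matrix.mul_apply,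
    Matrix.mul_apply, Fin.sum_univ_two, Fin.sum_univ_two, sl2_apply_one_one, sl2_apply_one_one]
  ring

theorem sl2_add_apply (X Y : sl2) (i j : Fin 2) : (X + Y).1 i j = X.1 i j + Y.1 i j := rfl

theorem sl2_smul_apply (c : ℂ) (X : sl2) (i j : Fin 2) : (c • X).1 i j = c * X.1 i j := rfl

/-- Up to factors `±1`, `±2` the entries of the bracket are the `2 × 2` minors of the two coordinate
vectors, so commuting means proportional. -/
theorem exists_eq_smul_of_lie_eq_zero {X Y : sl2} (hX : X ≠ 0) (h : ⁅X, Y⁆ = 0) :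
    ∃ c : ℂ, Y = c • X := by
  have h0 := lie_apply_zero_zero X Y
  have h1 := lie_apply_zero_one X Y
  have h2 := lie_apply_one_zero X Y
  rw [h] at h0 h1 h2
  change 0 = _ at h0
  change 0 = _ at h1
  change 0 = _ at h2
  by_cases ha : X.1 0 0 = 0
  · by_cases hb : X.1 0 1 = 0
    · by_cases hc : X.1 1 0 = 0
      · exact absurd (sl2_ext (Y := 0) ha hb hc) hX
      · refine ⟨Y.1 1 0 / X.1 1 0, sl2_ext ?_ ?_ ?_⟩ <;> rw [sl2_smul_apply] <;> field_simp
        · linear_combination -h2 / 2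
        · linear_combination h0
    · refine ⟨Y.1 0 1 / X.1 0 1, sl2_ext ?_ ?_ ?_⟩ <;> rw [sl2_smul_apply] <;> field_simp
      · linear_combination h1 / 2
      · linear_combination -h0
  · refine ⟨Y.1 0 0 / X.1 0 0, sl2_ext ?_ ?_ ?_⟩ <;> rw [sl2_smul_apply] <;> field_simp
    · linear_combination -h1 / 2
    · linear_combination h2 / 2

/-- From `X² = -det X` and `XY + YX = tr(XY)` one gets `k = -4 det X` and `t = -2 tr(XY)`. -/
theorem lie_lie_self (X Y : sl2) : ∃ k t : ℂ, ⁅X, ⁅X, Y⁆⁆ = k • Y + t • X := by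
  refine ⟨4 * (X.1 0 0 ^ 2 + X.1 0 1 * X.1 1 0),
    -2 * (2 * X.1 0 0 * Y.1 0 0 + X.1 0 1 * Y.1 1 0 + X.1 1 0 * Y.1 0 1), sl2_ext ?_ ?_ ?_⟩ <;>
  simp only [lie_apply_zero_zero, lie_apply_zero_one, lie_apply_one_zero, sl2_add_apply,
    sl2_smul_apply] <;> ring

theorem eq_zero_of_eq_neg {X : sl2} (h : X = -X) : X = 0 := by
  have h' : ∀ i j, X.1 i j = 0 := fun i j =>
    self_eq_neg.1 (congrArg (fun Z : sl2 => Z.1 i j) h)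
  exact sl2_ext (h' _ _) (h' _ _) (h' _ _)

/-- The vectors `y₁, y₂, y₃` behave like the basis `h, e - f, e + f`. -/
structure IsOrthogonalTriple (y₁ y₂ y₃ : sl2) : Prop where
  lie₁₂ : ⁅y₁, y₂⁆ = (2 : ℂ) • y₃
  lie₁₃ : ⁅y₁, y₃⁆ = (2 : ℂ) • y₂
  lie₂₃ : ⁅y₂, y₃⁆ = (2 : ℂ) • y₁

/-- The linear map with `h ↦ y₁`, `e - f ↦ y₂`, `e + f ↦ y₃`. -/
def tripleMap (y₁ y₂ y₃ : sl2) : sl2 →ₗ[ℂ] sl2 where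
  toFun X := X.1 0 0 • y₁ + ((X.1 0 1 - X.1 1 0) / 2) • y₂ + ((X.1 0 1 + X.1 1 0) / 2) • y₃
  map_add' X Y := by
    simp only [sl2_add_apply]
    module
  map_smul' c X := by
    simp only [sl2_smul_apply, RingHom.id_apply]
    module

theorem tripleMap_apply (y₁ y₂ y₃ X : sl2) : tripleMap y₁ y₂ y₃ X =
    X.1 0 0 • y₁ + ((X.1 0 1 - X.1 1 0) / 2) • y₂ + ((X.1 0 1 + X.1 1 0) / 2) • y₃ := rfl

theorem IsOrthogonalTriple.map_lie {y₁ y₂ y₃ : sl2} (h : IsOrthogonalTriple y₁ y₂ y₃)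
    (X Y : sl2) :
    tripleMap y₁ y₂ y₃ ⁅X, Y⁆ = ⁅tripleMap y₁ y₂ y₃ X, tripleMap y₁ y₂ y₃ Y⁆ := by
  have h21 : ⁅y₂, y₁⁆ = (-2 : ℂ) • y₃ := by rw [← lie_skew, h.lie₁₂, neg_smul]
  have h31 : ⁅y₃, y₁⁆ = (-2 : ℂ) • y₂ := by rw [← lie_skew, h.lie₁₃, neg_smul]
  have h32 : ⁅y₃, y₂⁆ = (-2 : ℂ) • y₁ := by rw [← lie_skew, h.lie₂₃, neg_smul]
  simp only [tripleMap_apply, lie_apply_zero_zero, lie_apply_zero_one, lie_apply_one_zero,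
    add_lie, lie_add, smul_lie, lie_smul, lie_self, h.lie₁₂, h.lie₁₃, h.lie₂₃, h21, h31, h32]
  module

/-- Conjugation by `diag(1, -1)`. -/
def conj₁ (X : sl2) : sl2 :=
  ⟨!![X.1 0 0, -X.1 0 1; -X.1 1 0, X.1 1 1], by
    rw [sl2_apply_one_one]
    exact matrix_mem_sl2 _ _ _⟩

/-- Conjugation by `(0, 1; -1, 0)`. -/
def conj₂ (X : sl2) : sl2 :=
  ⟨!![-X.1 0 0, -X.1 1 0; -X.1 0 1, -X.1 1 1], matrix_mem_sl2' X⟩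
where
  matrix_mem_sl2' (X : sl2) : !![-X.1 0 0, -X.1 1 0; -X.1 0 1, -X.1 1 1] ∈
      LieAlgebra.SpecialLinear.sl (Fin 2) ℂ := by
    rw [sl2_apply_one_one]
    exact matrix_mem_sl2 _ _ _

/-- Two commuting nontrivial involutions have a common eigenvector for the eigenvalue -1. -/
theorem exists_joint_eigenvector {R S : LieAut} (hR : ∀ X, R (R X) = X) (hS : ∀ X, S (S X) = X)
    (hRS : ∀ X, R (S X) = S (R X)) (hR1 : ∃ X, R X ≠ X) (hS1 : ∃ X, S X ≠ X) :
    ∃ X, X ≠ 0 ∧ R X = -X ∧ S X = -X := by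
  -- If there is none, each involution fixes the `-1` eigenvectors of the other. The bracket of two
  -- such vectors would be a joint eigenvector, so it vanishes and the vectors are proportional,
  -- contradicting their `R`-eigenvalues.
  by_contra! hne
  have h1 : ∃ X, X ≠ 0 ∧ R X = -X ∧ S X = X := by
    obtain ⟨Z, hZ⟩ := hR1
    set W := Z - R Z with hW
    have hW0 : W ≠ 0 := fun h => hZ (sub_eq_zero.1 h).symm
    have hRW : R W = -W := by rw [hW, map_sub, hR, neg_sub]
    have h2 : R (W - S W) = -(W - S W) := by rw [map_sub, hRS, hRW, map_neg]; abel
    have h3 : S (W - S W) = -(W - S W) := by rw [map_sub, hS, neg_sub]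
    have h4 : W - S W = 0 := by
      by_contra h4
      exact hne _ h4 h2 h3
    exact ⟨W, hW0, hRW, (sub_eq_zero.1 h4).symm⟩
  have h2 : ∃ Y, Y ≠ 0 ∧ R Y = Y ∧ S Y = -Y := by
    obtain ⟨Z, hZ⟩ := hS1
    set W := Z - S Z with hW
    have hW0 : W ≠ 0 := fun h => hZ (sub_eq_zero.1 h).symm
    have hSW : S W = -W := by rw [hW, map_sub, hS, neg_sub]
    have h2 : S (W - R W) = -(W - R W) := by rw [map_sub, ← hRS, hSW, map_neg]; abel
    have h3 : R (W - R W) = -(W - R W) := by rw [map_sub, hR, neg_sub]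
    have h4 : W - R W = 0 := by
      by_contra h4
      exact hne _ h4 h3 h2
    exact ⟨W, hW0, (sub_eq_zero.1 h4).symm, hSW⟩
  obtain ⟨X, hX, hRX, hSX⟩ := h1
  obtain ⟨Y, hY, hRY, hSY⟩ := h2
  have h0 : ⁅X, Y⁆ = 0 := by
    by_contra h0
    refine hne _ h0 ?_ ?_
    · rw [LieEquiv.map_lie, hRX, hRY, neg_lie]
    · rw [LieEquiv.map_lie, hSX, hSY, lie_neg]
  obtain ⟨c, rfl⟩ := exists_eq_smul_of_lie_eq_zero hX h0
  rw [map_smul, hRX, smul_neg] at hRY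
  exact hY (eq_zero_of_eq_neg hRY.symm)

/-- Two commuting involutions of `sl₂` generating a group of order four are simultaneously conjugate
to the standard ones. -/
theorem exists_conj_standard {R S : LieAut} (hR : ∀ X, R (R X) = X) (hS : ∀ X, S (S X) = X)
    (hRS : ∀ X, R (S X) = S (R X)) (hR1 : ∃ X, R X ≠ X) (hS1 : ∃ X, S X ≠ X)
    (hRS1 : ∃ X, R (S X) ≠ X) :
    ∃ θ : LieAut, (∀ X, θ (conj₁ X) = R (θ X)) ∧ ∀ X, θ (conj₂ X) = S (θ X) := by
  -- Applied to the pairs `S, RS` and `R, RS`, the joint eigenvector lemma produces one vector for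
  -- each of two nontrivial characters; their bracket belongs to the third.
  obtain ⟨x₁, h₁, hS₁, hR₁⟩ : ∃ X, X ≠ 0 ∧ S X = -X ∧ R X = X := by
    obtain ⟨X, h1, h2, h3⟩ := exists_joint_eigenvector (R := S) (S := R * S) hS
      (fun X => by change R (S (R (S X))) = X; rw [← hRS, hR, hS])
      (fun X => by change S (R (S X)) = R (S (S X)); rw [← hRS]) hS1 hRS1
    refine ⟨X, h1, h2, ?_⟩
    change R (S X) = -X at h3
    rw [h2, map_neg] at h3
    exact neg_injective h3
  obtain ⟨x₂, h₂, hR₂, hS₂⟩ : ∃ X, X ≠ 0 ∧ R X = -X ∧ S X = X := by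
    obtain ⟨X, h1, h2, h3⟩ := exists_joint_eigenvector (R := R) (S := R * S) hR
      (fun X => by change R (S (R (S X))) = X; rw [← hRS, hR, hS])
      (fun X => by change R (R (S X)) = R (S (R X)); rw [← hRS]) hR1 hRS1
    refine ⟨X, h1, h2, ?_⟩
    change R (S X) = -X at h3
    rw [hRS, h2, map_neg] at h3
    exact neg_injective h3
  set x₃ := ⁅x₁, x₂⁆ with hx₃
  have hR₃ : R x₃ = -x₃ := by rw [hx₃, LieEquiv.map_lie, hR₁, hR₂, lie_neg]
  have hS₃ : S x₃ = -x₃ := by rw [hx₃, LieEquiv.map_lie, hS₁, hS₂, neg_lie]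
  have h₃ : x₃ ≠ 0 := by
    intro h
    obtain ⟨c, hc⟩ := exists_eq_smul_of_lie_eq_zero h₁ h
    rw [hc, map_smul, hR₁] at hR₂
    exact h₂ (hc.trans (eq_zero_of_eq_neg hR₂))
  -- In `[x, [x, y]] = k y + t x` the left side is odd under `R` and `t x` is even, so `t x = 0`.
  have hlie : ∀ {x y : sl2}, R x = x → R y = -y →
      ∃ k : ℂ, ⁅x, ⁅x, y⁆⁆ = k • y := by
    intro x y hRx hRy
    obtain ⟨k, t, h⟩ := lie_lie_self x y
    refine ⟨k, ?_⟩
    have h1 := congrArg R h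
    simp only [LieEquiv.map_lie, hRx, hRy, map_add, map_smul, lie_neg] at h1
    rw [h] at h1
    have h2 : t • x = -(t • x) := by
      linear_combination (norm := module) -h1
    rw [h, eq_zero_of_eq_neg h2, add_zero]
  obtain ⟨k, hk⟩ : ∃ k : ℂ, ⁅x₁, x₃⁆ = k • x₂ := hlie hR₁ hR₂
  obtain ⟨l, hl⟩ : ∃ l : ℂ, ⁅x₂, x₃⁆ = l • x₁ := by
    obtain ⟨l, t, h⟩ := lie_lie_self x₂ x₁
    rw [← lie_skew x₂ x₁, ← hx₃, lie_neg] at h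
    have h1 := congrArg R h
    simp only [LieEquiv.map_lie, hR₁, hR₂, hR₃, map_add, map_smul, map_neg, lie_neg, neg_lie,
      neg_neg] at h1
    rw [h] at h1
    have h2 : t • x₂ = -(t • x₂) := by
      linear_combination (norm := module) h1
    rw [eq_zero_of_eq_neg h2, add_zero] at h
    exact ⟨-l, by rw [neg_smul, ← h, neg_neg]⟩
  have hk0 : k ≠ 0 := by
    rintro rfl
    rw [zero_smul] at hk
    obtain ⟨c, hc⟩ := exists_eq_smul_of_lie_eq_zero h₁ hk
    rw [hc, map_smul, hR₁] at hR₃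
    exact h₃ (hc.trans (eq_zero_of_eq_neg hR₃))
  have hl0 : l ≠ 0 := by
    rintro rfl
    rw [zero_smul] at hl
    obtain ⟨c, hc⟩ := exists_eq_smul_of_lie_eq_zero h₂ hl
    rw [hc, map_smul, hS₂] at hS₃
    exact h₃ (hc.trans (eq_zero_of_eq_neg hS₃))
  -- The scalings `a x₁`, `b x₂`, `(ab/2) x₃` satisfy the first relation automatically; the other
  -- two ask for `a² k = 4` and `b² l = 4`.
  obtain ⟨a, ha⟩ := IsAlgClosed.exists_pow_nat_eq (4 / k) two_pos
  obtain ⟨b, hb⟩ := IsAlgClosed.exists_pow_nat_eq (4 / l) two_pos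
  have ha0 : a ≠ 0 := by
    rintro rfl
    exact hk0 (by simpa using ha.symm)
  have hb0 : b ≠ 0 := by
    rintro rfl
    exact hl0 (by simpa using hb.symm)
  have hak : a ^ 2 * k = 4 := by rw [ha]; field_simp
  have hbl : b ^ 2 * l = 4 := by rw [hb]; field_simp
  have htriple : IsOrthogonalTriple (a • x₁) (b • x₂) ((a * b / 2) • x₃) := by
    refine ⟨?_, ?_, ?_⟩
    · rw [smul_lie, lie_smul, ← hx₃]
      module
    · rw [smul_lie, lie_smul, hk, smul_smul, smul_smul, smul_smul]
      congr 1
      linear_combination b / 2 * hak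
    · rw [smul_lie, lie_smul, hl, smul_smul, smul_smul, smul_smul]
      congr 1
      linear_combination a / 2 * hbl
  set T := tripleMap (a • x₁) (b • x₂) ((a * b / 2) • x₃) with hT
  have hTR : ∀ X, T (conj₁ X) = R (T X) := by
    intro X
    simp only [hT, tripleMap_apply, map_add, map_smul, hR₁, hR₂, hR₃, conj₁, Matrix.of_apply,
      Matrix.cons_val', Matrix.cons_val_zero, Matrix.cons_val_one, Matrix.cons_val_fin_one]
    module
  have hTS : ∀ X, T (conj₂ X) = S (T X) := by
    intro X
    simp only [hT, tripleMap_apply, map_add, map_smul, hS₁, hS₂, hS₃, conj₂, Matrix.of_apply,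
      Matrix.cons_val', Matrix.cons_val_zero, Matrix.cons_val_one, Matrix.cons_val_fin_one]
    module
  have hinj : Function.Injective T := by
    refine (injective_iff_map_eq_zero T).2 fun X hX => ?_
    -- The three vectors belong to different characters, so applying `R` and `S` separates their
    -- coefficients.
    obtain ⟨α, hα⟩ : ∃ α, α = X.1 0 0 := ⟨_, rfl⟩
    obtain ⟨β, hβ⟩ : ∃ β, β = (X.1 0 1 - X.1 1 0) / 2 := ⟨_, rfl⟩
    obtain ⟨δ, hδ⟩ : ∃ δ, δ = (X.1 0 1 + X.1 1 0) / 2 := ⟨_, rfl⟩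
    have e0 : α • (a • x₁) + β • (b • x₂) + δ • ((a * b / 2) • x₃) = 0 := by
      rw [hα, hβ, hδ]
      exact hX
    have e1 := congrArg R e0
    simp only [map_add, map_smul, hR₁, hR₂, hR₃, map_zero] at e1
    have e2 := congrArg S e0
    simp only [map_add, map_smul, hS₁, hS₂, hS₃, map_zero] at e2
    have f1 : (2 * α * a) • x₁ = 0 := by linear_combination (norm := module) e0 + e1
    have f2 : (2 * β * b) • x₂ = 0 := by linear_combination (norm := module) e0 + e2
    have f3 : (δ * a * b) • x₃ = 0 := by linear_combination (norm := module) -e1 - e2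
    have g1 : α = 0 := by simpa [h₁, ha0] using f1
    have g2 : β = 0 := by simpa [h₂, hb0] using f2
    have g3 : δ = 0 := by simpa [h₃, ha0, hb0] using f3
    refine sl2_ext (hα.symm.trans g1) ?_ ?_
    · change X.1 0 1 = 0
      linear_combination g2 + g3 - hβ - hδ
    · change X.1 1 0 = 0
      linear_combination g3 - g2 + hβ - hδ
  let e : sl2 ≃ₗ[ℂ] sl2 := LinearEquiv.ofInjectiveEndo T hinj
  let θ : LieAut := { e with map_lie' := fun {X Y} => htriple.map_lie X Y }
  exact ⟨θ, hTR, hTS⟩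

end ALia

namespace ALia

open PeriodPair

variable {L : PeriodPair}

/-! ### Elements of the current algebra -/

theorem sl2_eq (X : sl2) : X = X.1 0 0 • hElt + X.1 0 1 • eElt + X.1 1 0 • fElt := by
  refine sl2_ext ?_ ?_ ?_ <;> simp [hElt, eElt, fElt]

theorem exists_eq_tmul_add {R : Type*} [CommRing R] [Algebra ℂ R] (t : R ⊗[ℂ] sl2) :
    ∃ a b c, t = a ⊗ₜ[ℂ] hElt + b ⊗ₜ[ℂ] eElt + c ⊗ₜ[ℂ] fElt := by
  induction t using TensorProduct.induction_on with
  | zero => exact ⟨0, 0, 0, by simp⟩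
  | tmul f X =>
    refine ⟨X.1 0 0 • f, X.1 0 1 • f, X.1 1 0 • f, ?_⟩
    conv_lhs => rw [sl2_eq X]
    simp only [TensorProduct.tmul_add, TensorProduct.tmul_smul, TensorProduct.smul_tmul']
  | add s t hs ht =>
    obtain ⟨a, b, c, rfl⟩ := hs
    obtain ⟨a', b', c', rfl⟩ := ht
    refine ⟨a + a', b + b', c + c', ?_⟩
    simp only [TensorProduct.add_tmul]
    abel

section Current

variable {σ : Klein →* TorusAut L}

local instance instCommRingRegular : CommRing (regular σ) := (regular σ).toCommRing

local instance instAddCommGroupCurrent : AddCommGroup (Current σ) := TensorProduct.addCommGroup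

local instance instLieRingCurrent : LieRing (Current σ) :=
  LieAlgebra.ExtendScalars.instLieRing ℂ (regular σ) sl2

local instance instLieAlgebraCurrent : LieAlgebra (regular σ) (Current σ) :=
  LieAlgebra.ExtendScalars.instLieAlgebra ℂ (regular σ) sl2

local instance instBaseLieAlgebraCurrent : LieAlgebra ℂ (Current σ) :=
  LieAlgebra.ExtendScalars.instBaseLieAlgebra ℂ (regular σ) sl2

/-- The element `a h + b e + c f` of the current algebra. -/
def curr (a b c : regular σ) : Current σ := a ⊗ₜ[ℂ] hElt + b ⊗ₜ[ℂ] eElt + c ⊗ₜ[ℂ] fElt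

theorem exists_eq_curr (t : Current σ) : ∃ a b c, t = curr a b c := exists_eq_tmul_add t

theorem eval_curr_zero_zero (x : Punctured σ) (a b c : regular σ) :
    (eval σ x (curr a b c)).1 0 0 = a.1 x := by
  simp [curr, eval_tmul, hElt, eElt, fElt]

theorem eval_curr_zero_one (x : Punctured σ) (a b c : regular σ) :
    (eval σ x (curr a b c)).1 0 1 = b.1 x := by
  simp [curr, eval_tmul, hElt, eElt, fElt]

theorem eval_curr_one_zero (x : Punctured σ) (a b c : regular σ) :
    (eval σ x (curr a b c)).1 1 0 = c.1 x := by
  simp [curr, eval_tmul, hElt, eElt, fElt]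

/-- The coefficients with respect to `h`, `e`, `f` are genuine functions on `𝕋`, so identities in
the current algebra can be checked pointwise in `sl₂`. -/
theorem current_ext {s t : Current σ} (h : ∀ x, eval σ x s = eval σ x t) : s = t := by
  obtain ⟨a, b, c, rfl⟩ := exists_eq_curr s
  obtain ⟨a', b', c', rfl⟩ := exists_eq_curr t
  have h1 : a = a' := Subtype.ext (funext fun x => by
    simpa only [eval_curr_zero_zero] using congrArg (fun X : sl2 => X.1 0 0) (h x))
  have h2 : b = b' := Subtype.ext (funext fun x => by
    simpa only [eval_curr_zero_one] using congrArg (fun X : sl2 => X.1 0 1) (h x))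
  have h3 : c = c' := Subtype.ext (funext fun x => by
    simpa only [eval_curr_one_zero] using congrArg (fun X : sl2 => X.1 1 0) (h x))
  rw [h1, h2, h3]

theorem curr_injective {a b c a' b' c' : regular σ} (h : curr a b c = curr a' b' c') :
    a = a' ∧ b = b' ∧ c = c' := by
  refine ⟨Subtype.ext (funext fun x => ?_), Subtype.ext (funext fun x => ?_),
    Subtype.ext (funext fun x => ?_)⟩
  · rw [← eval_curr_zero_zero x a b c, h, eval_curr_zero_zero]
  · rw [← eval_curr_zero_one x a b c, h, eval_curr_zero_one]
  · rw [← eval_curr_one_zero x a b c, h, eval_curr_one_zero]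

theorem eval_smul (x : Punctured σ) (f : regular σ) (t : Current σ) :
    eval σ x (f • t) = f.1 x • eval σ x t := by
  induction t using TensorProduct.induction_on with
  | zero => simp
  | tmul g X =>
    rw [TensorProduct.smul_tmul', eval_tmul, eval_tmul, smul_smul]
    rfl
  | add s t hs ht => rw [smul_add, map_add, hs, ht, map_add, smul_add]

theorem eval_lie (x : Punctured σ) (s t : Current σ) :
    eval σ x ⁅s, t⁆ = ⁅eval σ x s, eval σ x t⁆ := by
  induction s using TensorProduct.induction_on with
  | zero => simp
  | tmul f X =>
    induction t using TensorProduct.induction_on with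
    | zero => simp
    | tmul g Y =>
      rw [LieAlgebra.ExtendScalars.bracket_tmul, eval_tmul, eval_tmul, eval_tmul, smul_lie,
        lie_smul, smul_smul]
      rfl
    | add s t hs ht => rw [lie_add, map_add, hs, ht, map_add, lie_add]
  | add s s' hs hs' => rw [add_lie, map_add, hs, hs', map_add, add_lie]

theorem eval_actCurrent (ρ : Klein →* LieAut) (γ : Klein) (x : Punctured σ) (t : Current σ) :
    eval σ x (actCurrent ρ σ γ t) = ρ γ (eval σ (actPt σ γ⁻¹ x) t) := by
  induction t using TensorProduct.induction_on with
  | zero => simp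
  | tmul f X =>
    rw [eval_tmul, map_smul]
    rfl
  | add s t hs ht => rw [map_add, map_add, hs, ht, map_add, map_add]

theorem eval_constAct (θ : LieAut) (x : Punctured σ) (t : Current σ) :
    eval σ x (constAct σ θ t) = θ (eval σ x t) := by
  induction t using TensorProduct.induction_on with
  | zero => simp
  | tmul f X =>
    rw [eval_tmul, map_smul]
    rfl
  | add s t hs ht => rw [map_add, map_add, hs, ht, map_add, map_add]

/-- The `𝒪_𝕋`-linear map with given values on the standard basis. -/
def curriedMap (H E F : Current σ) : Current σ →ₗ[regular σ] Current σ :=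
  LinearMap.liftBaseChange (regular σ)
    { toFun := fun X => X.1 0 0 • H + X.1 0 1 • E + X.1 1 0 • F
      map_add' := fun X Y => by
        simp only [sl2_add_apply]
        module
      map_smul' := fun c X => by
        simp only [sl2_smul_apply, RingHom.id_apply]
        module }

theorem eval_curriedMap (H E F : Current σ) (x : Punctured σ) (t : Current σ) :
    eval σ x (curriedMap H E F t) = (eval σ x t).1 0 0 • eval σ x H +
      (eval σ x t).1 0 1 • eval σ x E + (eval σ x t).1 1 0 • eval σ x F := by
  induction t using TensorProduct.induction_on with
  | zero =>
    simp only [map_zero]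
    change 0 = (0 : ℂ) • _ + (0 : ℂ) • _ + (0 : ℂ) • _
    module
  | tmul f X =>
    rw [curriedMap, LinearMap.liftBaseChange_tmul, eval_smul, eval_tmul]
    simp only [LinearMap.coe_mk, AddHom.coe_mk, map_add, map_smul, sl2_smul_apply]
    module
  | add s t hs ht =>
    rw [map_add, map_add, hs, ht, map_add]
    simp only [sl2_add_apply]
    module

end Current

/-! ### Conjugation by a matrix of the shape of `Ω` -/

/-- Conjugation by `(x, u y; y, v x)` in terms of `m = x²`, `p = y²`, `q = x y`. -/
def adMat (m p q u v : ℂ) (X : sl2) : sl2 :=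
  X.1 0 0 • ⟨!![v * m + u * p, -2 * u * q; 2 * v * q, -(v * m + u * p)], matrix_mem_sl2 _ _ _⟩ +
    X.1 0 1 • ⟨!![-q, m; -p, - -q], matrix_mem_sl2 _ _ _⟩ +
    X.1 1 0 • ⟨!![u * v * q, -u ^ 2 * p; v ^ 2 * m, -(u * v * q)], matrix_mem_sl2 _ _ _⟩

/-- The inverse of `adMat`. -/
def adMatInv (m p q u v : ℂ) (X : sl2) : sl2 :=
  X.1 0 0 • ⟨!![v * m + u * p, 2 * u * v * q; -2 * q, -(v * m + u * p)], matrix_mem_sl2 _ _ _⟩ +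
    X.1 0 1 • ⟨!![v * q, v ^ 2 * m; -p, -(v * q)], matrix_mem_sl2 _ _ _⟩ +
    X.1 1 0 • ⟨!![-u * q, -u ^ 2 * p; m, -(-u * q)], matrix_mem_sl2 _ _ _⟩

theorem adMat_zero_zero (m p q u v : ℂ) (X : sl2) : (adMat m p q u v X).1 0 0 =
    X.1 0 0 * (v * m + u * p) + X.1 0 1 * -q + X.1 1 0 * (u * v * q) := rfl

theorem adMat_zero_one (m p q u v : ℂ) (X : sl2) : (adMat m p q u v X).1 0 1 =
    X.1 0 0 * (-2 * u * q) + X.1 0 1 * m + X.1 1 0 * (-u ^ 2 * p) := rfl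

theorem adMat_one_zero (m p q u v : ℂ) (X : sl2) : (adMat m p q u v X).1 1 0 =
    X.1 0 0 * (2 * v * q) + X.1 0 1 * -p + X.1 1 0 * (v ^ 2 * m) := rfl

theorem adMatInv_zero_zero (m p q u v : ℂ) (X : sl2) : (adMatInv m p q u v X).1 0 0 =
    X.1 0 0 * (v * m + u * p) + X.1 0 1 * (v * q) + X.1 1 0 * (-u * q) := rfl

theorem adMatInv_zero_one (m p q u v : ℂ) (X : sl2) : (adMatInv m p q u v X).1 0 1 =
    X.1 0 0 * (2 * u * v * q) + X.1 0 1 * (v ^ 2 * m) + X.1 1 0 * (-u ^ 2 * p) := rfl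

theorem adMatInv_one_zero (m p q u v : ℂ) (X : sl2) : (adMatInv m p q u v X).1 1 0 =
    X.1 0 0 * (-2 * q) + X.1 0 1 * -p + X.1 1 0 * m := rfl

/-- The sign changes are those caused by `z ↦ z + ω₁/2`, under which `p₀` and `p₁` are odd and `p₂`
is even. -/
theorem adMat_shift₁ (m p q u v : ℂ) (X : sl2) :
    adMat (-m) (-p) q (-u) (-v) X = conj₁ (adMat m p q u v X) := by
  refine sl2_ext ?_ ?_ ?_
  · change _ = (adMat m p q u v X).1 0 0
    rw [adMat_zero_zero, adMat_zero_zero]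
    ring
  · change _ = -(adMat m p q u v X).1 0 1
    rw [adMat_zero_one, adMat_zero_one]
    ring
  · change _ = -(adMat m p q u v X).1 1 0
    rw [adMat_one_zero, adMat_one_zero]
    ring

/-- The substitution is the one caused by `z ↦ z + ω₂/2`: `p₀` and `p₂` change sign and `p₁` does
not, which exchanges `ξ₋²` with `ξ₊²` and each column factor with the negative of the other. -/
theorem adMat_shift₂ (m p q u v : ℂ) (X : sl2) :
    adMat p m (-q) (-v) (-u) X = conj₂ (adMat m p q u v X) := by
  refine sl2_ext ?_ ?_ ?_
  · change _ = -(adMat m p q u v X).1 0 0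
    rw [adMat_zero_zero, adMat_zero_zero]
    ring
  · change _ = -(adMat m p q u v X).1 1 0
    rw [adMat_zero_one, adMat_one_zero]
    ring
  · change _ = -(adMat m p q u v X).1 0 1
    rw [adMat_one_zero, adMat_zero_one]
    ring

theorem matrix_sl2_eq (X : sl2) : X.1 = !![X.1 0 0, X.1 0 1; X.1 1 0, -X.1 0 0] := by
  rw [← sl2_apply_one_one]
  exact Matrix.eta_fin_two _

theorem coe_adMat (x y u v : ℂ) (X : sl2) :
    (adMat (x ^ 2) (y ^ 2) (x * y) u v X).1 =
      !![x, u * y; y, v * x] * X.1 * !![v * x, -(u * y); -y, x] := by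
  rw [matrix_sl2_eq (adMat _ _ _ _ _ X), matrix_sl2_eq X, adMat_zero_zero, adMat_zero_one,
    adMat_one_zero, Matrix.mul_fin_two, Matrix.mul_fin_two]
  refine congrArg _ ?_
  ext i j
  fin_cases i <;> fin_cases j <;> simp <;> ring

theorem coe_adMatInv (x y u v : ℂ) (X : sl2) :
    (adMatInv (x ^ 2) (y ^ 2) (x * y) u v X).1 =
      !![v * x, -(u * y); -y, x] * X.1 * !![x, u * y; y, v * x] := by
  rw [matrix_sl2_eq (adMatInv _ _ _ _ _ X), matrix_sl2_eq X, adMatInv_zero_zero,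
    adMatInv_zero_one, adMatInv_one_zero, Matrix.mul_fin_two, Matrix.mul_fin_two]
  refine congrArg _ ?_
  ext i j
  fin_cases i <;> fin_cases j <;> simp <;> ring

theorem mul_adjugate_shape {x y u v : ℂ} (h : v * x ^ 2 - u * y ^ 2 = 1) :
    !![x, u * y; y, v * x] * !![v * x, -(u * y); -y, x] = 1 := by
  rw [Matrix.mul_fin_two, Matrix.one_fin_two]
  refine congrArg _ ?_
  ext i j
  fin_cases i <;> fin_cases j <;> simp
  · linear_combination h
  · ring
  · ring
  · linear_combination h

theorem adjugate_shape_mul {x y u v : ℂ} (h : v * x ^ 2 - u * y ^ 2 = 1) :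
    !![v * x, -(u * y); -y, x] * !![x, u * y; y, v * x] = 1 :=
  mul_eq_one_comm.1 (mul_adjugate_shape h)

/-- Allows identities for `adMat` to be proved at a single point as identities of matrix
conjugation, without a global choice of roots. -/
theorem exists_sqrt_pair {m p q : ℂ} (h : m * p = q ^ 2) :
    ∃ x y : ℂ, x ^ 2 = m ∧ y ^ 2 = p ∧ x * y = q := by
  obtain ⟨x, hx⟩ := IsAlgClosed.exists_pow_nat_eq m two_pos
  obtain ⟨y, hy⟩ := IsAlgClosed.exists_pow_nat_eq p two_pos
  have hxy : (x * y) ^ 2 = q ^ 2 := by rw [mul_pow, hx, hy, h]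
  rcases sq_eq_sq_iff_eq_or_eq_neg.1 hxy with hxy | hxy
  · exact ⟨x, y, hx, hy, hxy⟩
  · exact ⟨x, -y, hx, by rw [neg_sq, hy], by rw [mul_neg, hxy, neg_neg]⟩

theorem adMat_lie {m p q u v : ℂ} (h : m * p = q ^ 2) (hdet : v * m - u * p = 1) (X Y : sl2) :
    adMat m p q u v ⁅X, Y⁆ = ⁅adMat m p q u v X, adMat m p q u v Y⁆ := by
  obtain ⟨x, y, rfl, rfl, rfl⟩ := exists_sqrt_pair h
  have h1 := adjugate_shape_mul hdet
  refine Subtype.ext ?_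
  rw [coe_lie, coe_adMat, coe_adMat, coe_adMat, coe_lie]
  generalize !![x, u * y; y, v * x] = P at *
  generalize !![v * x, -(u * y); -y, x] = Q at *
  have h2 : ∀ A B : Matrix (Fin 2) (Fin 2) ℂ, P * A * Q * (P * B * Q) = P * (A * B) * Q := by
    intro A B
    calc P * A * Q * (P * B * Q) = P * A * (Q * P) * B * Q := by noncomm_ring
      _ = P * (A * B) * Q := by rw [h1]; noncomm_ring
  rw [h2, h2]
  noncomm_ring

theorem adMatInv_adMat {m p q u v : ℂ} (h : m * p = q ^ 2) (hdet : v * m - u * p = 1) (X : sl2) :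
    adMatInv m p q u v (adMat m p q u v X) = X := by
  obtain ⟨x, y, rfl, rfl, rfl⟩ := exists_sqrt_pair h
  have h1 := adjugate_shape_mul hdet
  refine Subtype.ext ?_
  rw [coe_adMatInv, coe_adMat]
  generalize !![x, u * y; y, v * x] = P at *
  generalize !![v * x, -(u * y); -y, x] = Q at *
  calc Q * (P * X.1 * Q) * P = (Q * P) * X.1 * (Q * P) := by noncomm_ring
    _ = X.1 := by rw [h1, one_mul, mul_one]

theorem adMat_adMatInv {m p q u v : ℂ} (h : m * p = q ^ 2) (hdet : v * m - u * p = 1) (X : sl2) :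
    adMat m p q u v (adMatInv m p q u v X) = X := by
  obtain ⟨x, y, rfl, rfl, rfl⟩ := exists_sqrt_pair h
  have h1 := mul_adjugate_shape hdet
  refine Subtype.ext ?_
  rw [coe_adMat, coe_adMatInv]
  generalize !![x, u * y; y, v * x] = P at *
  generalize !![v * x, -(u * y); -y, x] = Q at *
  calc P * (Q * X.1 * P) * Q = (P * Q) * X.1 * (P * Q) := by noncomm_ring
    _ = X.1 := by rw [h1, one_mul, mul_one]

section Psi

variable {σ : Klein →* TorusAut L}

/-- The automorphism of the current algebra given by `adMat` for regular functions. -/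
theorem exists_adMat_equiv {m p q u v : regular σ} (h : ∀ x, m.1 x * p.1 x = q.1 x ^ 2)
    (hdet : ∀ x, v.1 x * m.1 x - u.1 x * p.1 x = 1) :
    ∃ Ψ : Current σ ≃ₗ⁅regular σ⁆ Current σ, ∀ t x,
      eval σ x (Ψ t) = adMat (m.1 x) (p.1 x) (q.1 x) (u.1 x) (v.1 x) (eval σ x t) := by
  set Φ := curriedMap (curr (v * m + u * p) (-2 * u * q) (2 * v * q)) (curr (-q) m (-p))
    (curr (u * v * q) (-u ^ 2 * p) (v ^ 2 * m)) with hΦ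
  set Φ' := curriedMap (curr (v * m + u * p) (2 * u * v * q) (-2 * q))
    (curr (v * q) (v ^ 2 * m) (-p)) (curr (-u * q) (-u ^ 2 * p) m) with hΦ'
  have h1 : ∀ t x,
      eval σ x (Φ t) = adMat (m.1 x) (p.1 x) (q.1 x) (u.1 x) (v.1 x) (eval σ x t) := by
    intro t x
    rw [hΦ, eval_curriedMap]
    refine sl2_ext ?_ ?_ ?_
    · simp only [sl2_add_apply, sl2_smul_apply, eval_curr_zero_zero, adMat_zero_zero]
      rfl
    · simp only [sl2_add_apply, sl2_smul_apply, eval_curr_zero_one, adMat_zero_one]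
      rfl
    · simp only [sl2_add_apply, sl2_smul_apply, eval_curr_one_zero, adMat_one_zero]
      rfl
  have h2 : ∀ t x,
      eval σ x (Φ' t) = adMatInv (m.1 x) (p.1 x) (q.1 x) (u.1 x) (v.1 x) (eval σ x t) := by
    intro t x
    rw [hΦ', eval_curriedMap]
    refine sl2_ext ?_ ?_ ?_
    · simp only [sl2_add_apply, sl2_smul_apply, eval_curr_zero_zero, adMatInv_zero_zero]
      rfl
    · simp only [sl2_add_apply, sl2_smul_apply, eval_curr_zero_one, adMatInv_zero_one]
      rfl
    · simp only [sl2_add_apply, sl2_smul_apply, eval_curr_one_zero, adMatInv_one_zero]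
      rfl
  let e : Current σ ≃ₗ[regular σ] Current σ := LinearEquiv.ofLinearMap Φ Φ'
    (LinearMap.ext fun t => current_ext fun x => by
      rw [LinearMap.comp_apply, h1, h2, adMat_adMatInv (h x) (hdet x), LinearMap.id_apply])
    (LinearMap.ext fun t => current_ext fun x => by
      rw [LinearMap.comp_apply, h2, h1, adMatInv_adMat (h x) (hdet x), LinearMap.id_apply])
  refine ⟨{ e with map_lie' := fun {s t} => current_ext fun x => ?_ }, h1⟩
  change eval σ x (Φ ⁅s, t⁆) = eval σ x ⁅Φ s, Φ t⁆
  rw [h1, eval_lie, eval_lie, h1, h1, adMat_lie (h x) (hdet x)]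

end Psi

end ALia

namespace ALia

open PeriodPair

attribute [local instance] instCommRingRegular instAddCommGroupCurrent instLieRingCurrent
  instLieAlgebraCurrent instBaseLieAlgebraCurrent

variable {L : PeriodPair} {σ : Klein →* TorusAut L}

/-! ### Functions in `𝒪_𝕋` from functions on the plane -/

theorem exists_regular_eq (hσ : Function.Injective σ) (hg : QuotientHasGenusOne σ) {φ : ℂ → ℂ}
    (hper : ∀ l ∈ L.lattice, ∀ z, φ (z + l) = φ z)
    (hana : ∀ z ∉ (half L).lattice, AnalyticAt ℂ φ z) (hmer : Meromorphic φ) :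
    ∃ f : regular σ, ∀ z (hz : proj L z ∉ punctures σ), f.1 ⟨proj L z, hz⟩ = φ z := by
  let ψ : Torus L → ℂ := Quotient.lift φ fun a b hab => by
    have h : a - b ∈ L.lattice := (Submodule.quotientRel_def _).mp hab
    rw [← hper _ h b, add_sub_cancel]
  have hψ : ∀ z, ψ (proj L z) = φ z := fun _ => rfl
  refine ⟨⟨fun x => ψ x.1, fun z hz => ?_, fun z _ => ?_⟩, fun z hz => rfl⟩
  · exact ⟨φ, hana z (by rwa [← proj_mem_punctures hσ hg]),
      Filter.Eventually.of_forall fun w _ => hψ w⟩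
  · exact ⟨φ, hmer z, Filter.Eventually.of_forall fun w _ => hψ w⟩

theorem punctured_eq (x : Punctured σ) : ∃ z, ∃ hz : proj L z ∉ punctures σ, x = ⟨proj L z, hz⟩ := by
  obtain ⟨x, hx⟩ := x
  obtain ⟨z, rfl⟩ := proj_surjective L x
  exact ⟨z, hx, rfl⟩

theorem weierstrass_regular (hσ : Function.Injective σ) (hg : QuotientHasGenusOne σ) :
    (fun x : Punctured σ => wpHalf L x.1) ∈ regular σ ∧
      (fun x : Punctured σ => wpHalfDeriv L x.1) ∈ regular σ := by
  constructor
  · obtain ⟨f, hf⟩ := exists_regular_eq hσ hg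
      (fun l hl z => weierstrassP_add (L := half L) z (lattice_le_half L hl))
      (half L).analyticOnNhd_weierstrassP (half L).meromorphic_weierstrassP
    convert f.2 using 1
    funext x
    obtain ⟨z, hz, rfl⟩ := punctured_eq x
    exact (hf z hz).symm
  · obtain ⟨f, hf⟩ := exists_regular_eq hσ hg
      (fun l hl z => derivWeierstrassP_add (L := half L) z (lattice_le_half L hl))
      (half L).analyticOnNhd_derivWeierstrassP (half L).meromorphic_derivWeierstrassP
    convert f.2 using 1
    funext x
    obtain ⟨z, hz, rfl⟩ := punctured_eq x
    exact (hf z hz).symm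

/-! ### The algebra of invariants -/

theorem mem_invariants {f : regular σ} :
    f ∈ invariants σ ↔ ∀ γ x, f.1 (actPt σ γ x) = f.1 x := by
  constructor
  · intro h γ x
    have := congrFun (congrArg Subtype.val (h γ⁻¹)) x
    change f.1 (actPt σ γ⁻¹⁻¹ x) = f.1 x at this
    rwa [inv_inv] at this
  · intro h γ
    exact Subtype.ext (funext fun x => h γ⁻¹ x)

open Polynomial in
theorem aeval_apply_punctured (f : Punctured σ → ℂ) (P : ℂ[X]) (x : Punctured σ) :
    aeval f P x = P.eval (f x) := by
  simp

open Polynomial in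
-- Invariance under all half-period translations makes the pullback to `ℂ` periodic for `Λ/2`, with
-- poles only in `Λ/2`, and `exists_polynomial_eq` applies to the half lattice.
theorem invariants_map_eq (hσ : Function.Injective σ) (hg : QuotientHasGenusOne σ) :
    (invariants σ).map (regular σ).val = wpHalfAlgebra σ := by
  apply le_antisymm
  · rintro _ ⟨f, hf, rfl⟩
    classical
    -- The value `0` at the punctures keeps the extension periodic; being isolated values, they do
    -- not affect meromorphy.
    let φ : ℂ → ℂ := fun z => if hz : proj L z ∉ punctures σ then f.1 ⟨proj L z, hz⟩ else 0
    have hφ : ∀ z (hz : proj L z ∉ punctures σ), φ z = f.1 ⟨proj L z, hz⟩ := fun z hz => dif_pos hz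
    have hmem := fun z => proj_mem_punctures hσ hg (z := z)
    have hper : ∀ l ∈ (half L).lattice, ∀ z, φ (z + l) = φ z := by
      intro l hl z
      by_cases hz : proj L z ∈ punctures σ
      · have hz' : proj L (z + l) ∈ punctures σ := by
          rw [hmem] at hz ⊢
          exact add_mem hz hl
        rw [show φ z = 0 from dif_neg (not_not.2 hz),
          show φ (z + l) = 0 from dif_neg (not_not.2 hz')]
      · have hz' : proj L (z + l) ∉ punctures σ := by
          rw [hmem] at hz ⊢
          intro h
          exact hz (by simpa using sub_mem h hl)
        obtain ⟨γ, hγ⟩ := exists_sigma_eq_translation hσ hg (mem_half_lattice.1 hl)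
        rw [hφ z hz, hφ _ hz', ← mem_invariants.1 hf γ ⟨proj L z, hz⟩]
        exact congrArg f.1 (Subtype.ext (hγ z).symm)
    have hana : ∀ z ∉ (half L).lattice, AnalyticAt ℂ φ z := by
      intro z hz
      obtain ⟨g, hg1, hg2⟩ := f.2.1 z (by rwa [hmem])
      refine hg1.congr ?_
      filter_upwards [hg2, (half L).isClosed_lattice.isOpen_compl.mem_nhds hz] with w h1 h2
      have h3 : proj L w ∉ punctures σ := by rwa [hmem]
      rw [← h1 h3, hφ w h3]
    have hmer : MeromorphicAt φ 0 := by
      obtain ⟨g, hg1, hg2⟩ := f.2.2 0 (by rw [hmem]; exact zero_mem _)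
      refine hg1.congr ?_
      filter_upwards [hg2, (half L).eventually_notMem_lattice 0] with w h1 h2
      have h3 : proj L w ∉ punctures σ := by rwa [hmem]
      rw [← h1 h3, hφ w h3]
    obtain ⟨P, Q, hPQ⟩ := exists_polynomial_eq hper hana hmer
    set x : Punctured σ → ℂ := fun x => wpHalf L x.1 with hx
    set y : Punctured σ → ℂ := fun x => wpHalfDeriv L x.1 with hy
    have hfxy : f.1 = aeval x P + aeval x Q * y := by
      funext t
      obtain ⟨z, hz, rfl⟩ := punctured_eq t
      rw [Pi.add_apply, Pi.mul_apply, aeval_apply_punctured, aeval_apply_punctured, ← hφ z hz]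
      exact hPQ z (by rwa [← hmem])
    have hxm : x ∈ wpHalfAlgebra σ := Algebra.subset_adjoin (by simp [hx])
    have hym : y ∈ wpHalfAlgebra σ := Algebra.subset_adjoin (by simp [hy])
    change f.1 ∈ _
    rw [hfxy]
    have haeval : ∀ R : ℂ[X], aeval x R ∈ wpHalfAlgebra σ := fun R =>
      Algebra.adjoin_le (Set.singleton_subset_iff.2 hxm) (aeval_mem_adjoin_singleton ℂ x)
    exact add_mem (haeval P) (mul_mem (haeval Q) hym)
  · refine Algebra.adjoin_le ?_
    rintro _ (rfl | rfl)
    · refine ⟨⟨_, (weierstrass_regular hσ hg).1⟩, mem_invariants.2 fun γ t => ?_, rfl⟩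
      obtain ⟨b, hb, hγ⟩ := exists_translation hg γ
      obtain ⟨z, hz, rfl⟩ := punctured_eq t
      change wpHalf L ((σ γ : Equiv.Perm (Torus L)) (proj L z)) = wpHalf L (proj L z)
      rw [hγ]
      exact weierstrassP_add (L := half L) z (mem_half_lattice.2 hb)
    · refine ⟨⟨_, (weierstrass_regular hσ hg).2⟩, mem_invariants.2 fun γ t => ?_, rfl⟩
      obtain ⟨b, hb, hγ⟩ := exists_translation hg γ
      obtain ⟨z, hz, rfl⟩ := punctured_eq t
      change wpHalfDeriv L ((σ γ : Equiv.Perm (Torus L)) (proj L z)) = wpHalfDeriv L (proj L z)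
      rw [hγ]
      exact derivWeierstrassP_add (L := half L) z (mem_half_lattice.2 hb)

theorem nonempty_invariants_equiv (hσ : Function.Injective σ) (hg : QuotientHasGenusOne σ) :
    Nonempty (invariants σ ≃ₐ[ℂ] wpHalfAlgebra σ) :=
  ⟨(Subalgebra.equivMapOfInjective (invariants σ) (regular σ).val
    Subtype.val_injective).trans (Subalgebra.equivOfEq _ _ (invariants_map_eq hσ hg))⟩

open Polynomial in
theorem nonempty_wpHalfAlgebra_equiv (hσ : Function.Injective σ) (hg : QuotientHasGenusOne σ) :
    Nonempty (WeierstrassRing (half L) ≃ₐ[ℂ] wpHalfAlgebra σ) := by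
  have hmem := fun z => proj_mem_punctures hσ hg (z := z)
  refine nonempty_weierstrassRing_equiv (half L) _ _ ?_ fun P Q h => ?_
  · funext t
    obtain ⟨z, hz, rfl⟩ := punctured_eq t
    have := (half L).derivWeierstrassP_sq z (by rwa [← hmem])
    change (half L).derivWeierstrassP z ^ 2 - 4 * (half L).weierstrassP z ^ 3 +
      (half L).g₂ * (half L).weierstrassP z + (half L).g₃ = 0
    rw [this]
    ring
  · refine eq_zero_of_eval_add_eval_mul (L := half L) fun z hz => ?_
    have := congrFun h ⟨proj L z, by rwa [hmem]⟩
    rw [Pi.add_apply, Pi.mul_apply, aeval_apply_punctured, aeval_apply_punctured] at this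
    exact this

/-! ### The intertwiner -/

section Intertwiner

variable (L) (A B : ℂ)

/-- `ξ₋²`. -/
def sqMinus (z : ℂ) : ℂ := A / α₁ L * p₁ L z - B / β₁ L * p₀ L z

/-- `ξ₊²`. -/
def sqPlus (z : ℂ) : ℂ := A / α₁ L * p₁ L z + B / β₁ L * p₀ L z

/-- The factor of `ξ₊` in the second column of `Ω`. -/
def facPlus (z : ℂ) : ℂ := 1 / (2 * sqrtαβ L A B) * (A * p₀ L z - B * p₁ L z)

/-- The factor of `ξ₋` in the second column of `Ω`. -/
def facMinus (z : ℂ) : ℂ := 1 / (2 * sqrtαβ L A B) * (A * p₀ L z + B * p₁ L z)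

/-- Conjugation by `Ω(z)` on `sl₂`. -/
def adOmega (z : ℂ) (X : sl2) : sl2 :=
  adMat (sqMinus L A B z) (sqPlus L A B z) (p₂ L z) (facPlus L A B z) (facMinus L A B z) X

variable {L A B}

theorem sqMinus_mul_sqPlus (h : IsRootPair L A B) {z : ℂ} (hz : z ∉ (half L).lattice) :
    sqMinus L A B z * sqPlus L A B z = p₂ L z ^ 2 := p₂_sq h hz

theorem facMinus_mul_sub (h : IsRootPair L A B) {z : ℂ} (hz : z ∉ (half L).lattice) :
    facMinus L A B z * sqMinus L A B z - facPlus L A B z * sqPlus L A B z = 1 := by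
  have h0 := sqrtαβ_ne_zero h
  have := det_relation A B hz
  rw [facMinus, facPlus, sqMinus, sqPlus]
  generalize A / α₁ L * p₁ L z - B / β₁ L * p₀ L z = m at *
  generalize A / α₁ L * p₁ L z + B / β₁ L * p₀ L z = p at *
  field_simp
  linear_combination this

theorem adOmega_add_half₁ (z : ℂ) (X : sl2) :
    adOmega L A B (z + L.ω₁ / 2) X = conj₁ (adOmega L A B z X) := by
  have h0 : p₀ L (z + L.ω₁ / 2) = -p₀ L z := by
    rw [p₀, projInv_add_half₁ (by norm_num), neg_one_mul]
  have h1 : p₁ L (z + L.ω₁ / 2) = -p₁ L z := by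
    rw [p₁, projInv_add_half₁ (by norm_num), neg_one_mul]
  have h2 : p₂ L (z + L.ω₁ / 2) = p₂ L z := by
    rw [p₂, projInv_add_half₁ (by norm_num), one_mul]
  rw [adOmega, adOmega, ← adMat_shift₁, h2]
  congr 1 <;> simp only [sqMinus, sqPlus, facPlus, facMinus, h0, h1] <;> ring

theorem adOmega_add_half₂ (z : ℂ) (X : sl2) :
    adOmega L A B (z + L.ω₂ / 2) X = conj₂ (adOmega L A B z X) := by
  have h0 : p₀ L (z + L.ω₂ / 2) = -p₀ L z := by
    rw [p₀, projInv_add_half₂ (by norm_num), neg_one_mul]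
  have h1 : p₁ L (z + L.ω₂ / 2) = p₁ L z := by
    rw [p₁, projInv_add_half₂ (by norm_num), one_mul]
  have h2 : p₂ L (z + L.ω₂ / 2) = -p₂ L z := by
    rw [p₂, projInv_add_half₂ (by norm_num), neg_one_mul]
  rw [adOmega, adOmega, ← adMat_shift₂, h2]
  congr 1 <;> simp only [sqMinus, sqPlus, facPlus, facMinus, h0, h1] <;> ring

/-- Since `det Ω = 1`, the inverse is the adjugate, and the roots enter only through their squares
and product. So `Ad(Ω)` is the same for every choice of branches. -/
theorem coe_adOmega {ξm ξp : ℂ → ℂ} (h : IsRootPair L A B) (hξ : IsBranchPair L A B ξm ξp) {z : ℂ}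
    (hz : z ∉ (half L).lattice) (X : sl2) :
    (adOmega L A B z X).1 = Omega L A B ξm ξp z * X.1 * (Omega L A B ξm ξp z)⁻¹ := by
  have hdet := det_Omega h hξ hz
  have hinv : (Omega L A B ξm ξp z)⁻¹ =
      !![facMinus L A B z * ξm z, -(facPlus L A B z * ξp z); -ξp z, ξm z] := by
    rw [Matrix.inv_def, hdet, Ring.inverse_one, one_smul, Omega, Matrix.adjugate_fin_two_of]
    rfl
  rw [hinv, adOmega, sqMinus, sqPlus, ← hξ.sq_m z hz, ← hξ.sq_p z hz, ← hξ.mul z hz, coe_adMat]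
  rfl

theorem exists_adOmega_equiv (hσ : Function.Injective σ) (hg : QuotientHasGenusOne σ)
    (h : IsRootPair L A B) :
    ∃ Ψ : Current σ ≃ₗ⁅regular σ⁆ Current σ, ∀ t z (hz : proj L z ∉ punctures σ),
      eval σ ⟨proj L z, hz⟩ (Ψ t) = adOmega L A B z (eval σ ⟨proj L z, hz⟩ t) := by
  have hp : ∀ a b, ∃ f : regular σ, ∀ z (hz : proj L z ∉ punctures σ),
      f.1 ⟨proj L z, hz⟩ = projInv L a b z := fun a b =>
    exists_regular_eq hσ hg (fun l hl z => projInv_add_lattice z hl)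
      (fun z hz => analyticAt_projInv a b hz) (meromorphic_projInv a b)
  obtain ⟨P₀, h₀⟩ := hp (-1) (-1)
  obtain ⟨P₁, h₁⟩ := hp (-1) 1
  obtain ⟨P₂, h₂⟩ := hp 1 (-1)
  let m : regular σ := (A / α₁ L) • P₁ - (B / β₁ L) • P₀
  let p : regular σ := (A / α₁ L) • P₁ + (B / β₁ L) • P₀
  let u : regular σ := (1 / (2 * sqrtαβ L A B)) • (A • P₀ - B • P₁)
  let v : regular σ := (1 / (2 * sqrtαβ L A B)) • (A • P₀ + B • P₁)
  have hm : ∀ z hz, m.1 ⟨proj L z, hz⟩ = sqMinus L A B z := fun z hz => by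
    change A / α₁ L * P₁.1 _ - B / β₁ L * P₀.1 _ = _
    rw [h₀, h₁]
    rfl
  have hp' : ∀ z hz, p.1 ⟨proj L z, hz⟩ = sqPlus L A B z := fun z hz => by
    change A / α₁ L * P₁.1 _ + B / β₁ L * P₀.1 _ = _
    rw [h₀, h₁]
    rfl
  have hu : ∀ z hz, u.1 ⟨proj L z, hz⟩ = facPlus L A B z := fun z hz => by
    change 1 / (2 * sqrtαβ L A B) * (A * P₀.1 _ - B * P₁.1 _) = _
    rw [h₀, h₁]
    rfl
  have hv : ∀ z hz, v.1 ⟨proj L z, hz⟩ = facMinus L A B z := fun z hz => by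
    change 1 / (2 * sqrtαβ L A B) * (A * P₀.1 _ + B * P₁.1 _) = _
    rw [h₀, h₁]
    rfl
  obtain ⟨Ψ, hΨ⟩ := exists_adMat_equiv (m := m) (p := p) (q := P₂) (u := u) (v := v)
    (fun x => by
      obtain ⟨z, hz, rfl⟩ := punctured_eq x
      rw [hm, hp', h₂]
      exact sqMinus_mul_sqPlus h (by rwa [← proj_mem_punctures hσ hg]))
    (fun x => by
      obtain ⟨z, hz, rfl⟩ := punctured_eq x
      rw [hm, hp', hu, hv]
      exact facMinus_mul_sub h (by rwa [← proj_mem_punctures hσ hg]))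
  refine ⟨Ψ, fun t z hz => ?_⟩
  rw [hΨ, hm, hp', hu, hv, h₂]
  rfl

end Intertwiner

end ALia

/-! ### From equivariance to the normal form -/

namespace ALia

open PeriodPair

attribute [local instance] instCommRingRegular instAddCommGroupCurrent instLieRingCurrent
  instLieAlgebraCurrent instBaseLieAlgebraCurrent

variable {L : PeriodPair} {σ : Klein →* TorusAut L}

theorem actPt_actPt_inv (γ : Klein) (x : Punctured σ) : actPt σ γ (actPt σ γ⁻¹ x) = x := by
  refine Subtype.ext ?_
  change (σ γ : Equiv.Perm (Torus L)) ((σ γ⁻¹ : Equiv.Perm (Torus L)) x.1) = x.1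
  rw [map_inv]
  exact (σ γ : Equiv.Perm (Torus L)).apply_symm_apply x.1

theorem actPt_mul (γ δ : Klein) (x : Punctured σ) :
    actPt σ (γ * δ) x = actPt σ γ (actPt σ δ x) := by
  refine Subtype.ext ?_
  change (σ (γ * δ) : Equiv.Perm (Torus L)) x.1 = _
  rw [map_mul]
  rfl

theorem rho_mul_apply (ρ : Klein →* LieAut) (γ δ : Klein) (X : sl2) :
    ρ (γ * δ) X = ρ γ (ρ δ X) := by
  rw [map_mul]
  rfl

theorem rho_one_apply (ρ : Klein →* LieAut) (X : sl2) : ρ 1 X = X := by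
  rw [map_one]
  rfl

theorem rho_apply_apply (ρ : Klein →* LieAut) (γ : Klein) (X : sl2) : ρ γ (ρ γ X) = X := by
  rw [← rho_mul_apply, klein_mul_self, rho_one_apply]

section Twist

variable (Ψ : Current σ ≃ₗ⁅regular σ⁆ Current σ) (θ : LieAut)

theorem lieEquiv_map_smul (f : regular σ) (t : Current σ) : Ψ (f • t) = f • Ψ t :=
  Ψ.toLinearEquiv.map_smul f t

/-- An `𝒪_𝕋`-linear map acts fibrewise: its value at a point depends only on the value of the
argument there. -/
theorem eval_equiv (t : Current σ) (x : Punctured σ) :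
    eval σ x (Ψ t) = eval σ x (Ψ (1 ⊗ₜ[ℂ] eval σ x t)) := by
  induction t using TensorProduct.induction_on with
  | zero => simp
  | tmul f X =>
    have h1 : f ⊗ₜ[ℂ] X = f • ((1 : regular σ) ⊗ₜ[ℂ] X) := by
      rw [TensorProduct.smul_tmul', smul_eq_mul, mul_one]
    have h2 : (1 : regular σ) ⊗ₜ[ℂ] eval σ x (f ⊗ₜ[ℂ] X) =
        algebraMap ℂ (regular σ) (f.1 x) • ((1 : regular σ) ⊗ₜ[ℂ] X) := by
      rw [eval_tmul, TensorProduct.tmul_smul, algebraMap_smul]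
    rw [h2, h1, lieEquiv_map_smul, lieEquiv_map_smul, eval_smul, eval_smul]
    rfl
  | add s t hs ht => rw [map_add, map_add, hs, ht, map_add, TensorProduct.tmul_add, map_add, map_add]

theorem constAct_smul (f : regular σ) (t : Current σ) :
    constAct σ θ (f • t) = f • constAct σ θ t :=
  current_ext fun x => by rw [eval_constAct, eval_smul, eval_smul, eval_constAct, map_smul]

theorem constAct_injective : Function.Injective (constAct σ θ) := by
  intro s t h
  refine current_ext fun x => θ.injective (?_ : θ _ = θ _)
  rw [← eval_constAct, h, eval_constAct]

theorem constAct_surjective : Function.Surjective (constAct σ θ) := by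
  intro t
  refine ⟨constAct σ θ.symm t, current_ext fun x => ?_⟩
  rw [eval_constAct, eval_constAct, LieEquiv.apply_symm_apply]

theorem curr_eq_smul (a b c : regular σ) : curr a b c =
    a • (1 ⊗ₜ[ℂ] hElt) + b • (1 ⊗ₜ[ℂ] eElt) + c • ((1 : regular σ) ⊗ₜ[ℂ] fElt) := by
  simp only [curr, TensorProduct.smul_tmul', smul_eq_mul, mul_one]

theorem constAct_curr (a b c : regular σ) : constAct σ θ (Ψ (curr a b c)) =
    a • constAct σ θ (Ψ (1 ⊗ₜ[ℂ] hElt)) + b • constAct σ θ (Ψ (1 ⊗ₜ[ℂ] eElt)) +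
      c • constAct σ θ (Ψ (1 ⊗ₜ[ℂ] fElt)) := by
  simp only [curr_eq_smul, map_add, map_smul, constAct_smul]

variable {Ψ θ} {ρ : Klein →* LieAut}

/-- Equivariance on constant elements suffices: the intertwiner absorbs `ρ`, and what remains is the
action on the coefficient functions. -/
theorem actCurrent_constAct_curr (hΨ : ∀ (γ : Klein) (x : Punctured σ) (X : sl2),
      θ (eval σ (actPt σ γ x) (Ψ (1 ⊗ₜ[ℂ] X))) = ρ γ (θ (eval σ x (Ψ (1 ⊗ₜ[ℂ] X)))))
    (γ : Klein) (a b c : regular σ) :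
    actCurrent ρ σ γ (constAct σ θ (Ψ (curr a b c))) =
      constAct σ θ (Ψ (curr (actFun σ γ a) (actFun σ γ b) (actFun σ γ c))) := by
  refine current_ext fun x => ?_
  have h1 : eval σ x (curr (actFun σ γ a) (actFun σ γ b) (actFun σ γ c)) =
      eval σ (actPt σ γ⁻¹ x) (curr a b c) := by
    refine sl2_ext ?_ ?_ ?_
    · rw [eval_curr_zero_zero, eval_curr_zero_zero]
      rfl
    · rw [eval_curr_zero_one, eval_curr_zero_one]
      rfl
    · rw [eval_curr_one_zero, eval_curr_one_zero]
      rfl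
  rw [eval_actCurrent, eval_constAct, eval_constAct, eval_equiv, eval_equiv Ψ _ x, h1, ← hΨ,
    actPt_actPt_inv]

theorem constAct_curr_mem_automorphic (hΨ : ∀ (γ : Klein) (x : Punctured σ) (X : sl2),
      θ (eval σ (actPt σ γ x) (Ψ (1 ⊗ₜ[ℂ] X))) = ρ γ (θ (eval σ x (Ψ (1 ⊗ₜ[ℂ] X)))))
    {a b c : regular σ} : constAct σ θ (Ψ (curr a b c)) ∈ automorphic ρ σ ↔
      a ∈ invariants σ ∧ b ∈ invariants σ ∧ c ∈ invariants σ := by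
  constructor
  · intro h
    have h1 : ∀ γ, actFun σ γ a = a ∧ actFun σ γ b = b ∧ actFun σ γ c = c := by
      intro γ
      have := h γ
      rw [actCurrent_constAct_curr hΨ] at this
      exact curr_injective (Ψ.injective (constAct_injective θ this))
    exact ⟨fun γ => (h1 γ).1, fun γ => (h1 γ).2.1, fun γ => (h1 γ).2.2⟩
  · rintro ⟨ha, hb, hc⟩ γ
    rw [actCurrent_constAct_curr hΨ, ha γ, hb γ, hc γ]

theorem invariants_smul_eq (a : invariants σ) (t : Current σ) : a • t = (a : regular σ) • t := by
  induction t using TensorProduct.induction_on with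
  | zero => rw [smul_zero, smul_zero]
  | tmul f X => rfl
  | add s t hs ht => rw [smul_add, smul_add, hs, ht]

theorem lie_h_e : ⁅hElt, eElt⁆ = (2 : ℂ) • eElt := by
  refine sl2_ext ?_ ?_ ?_ <;>
  simp [lie_apply_zero_zero, lie_apply_zero_one, lie_apply_one_zero, hElt, eElt]

theorem lie_h_f : ⁅hElt, fElt⁆ = (-2 : ℂ) • fElt := by
  refine sl2_ext ?_ ?_ ?_ <;>
  simp [lie_apply_zero_zero, lie_apply_zero_one, lie_apply_one_zero, hElt, fElt]

theorem lie_e_f : ⁅eElt, fElt⁆ = hElt := by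
  refine sl2_ext ?_ ?_ ?_ <;>
  simp [lie_apply_zero_zero, lie_apply_zero_one, lie_apply_one_zero, hElt, eElt, fElt]

variable (Ψ θ) in
theorem constAct_lie_tmul (X Y : sl2) :
    ⁅constAct σ θ (Ψ (1 ⊗ₜ[ℂ] X)), constAct σ θ (Ψ (1 ⊗ₜ[ℂ] Y))⁆ =
      constAct σ θ (Ψ (1 ⊗ₜ[ℂ] ⁅X, Y⁆)) := by
  rw [← LieHom.map_lie, ← LieEquiv.map_lie, LieAlgebra.ExtendScalars.bracket_tmul, one_mul]

variable (Ψ θ) in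
theorem constAct_smul_tmul (k : ℂ) (X : sl2) :
    constAct σ θ (Ψ (1 ⊗ₜ[ℂ] (k • X))) = k • constAct σ θ (Ψ (1 ⊗ₜ[ℂ] X)) := by
  rw [TensorProduct.tmul_smul, ← algebraMap_smul (regular σ) k, map_smul, constAct_smul,
    algebraMap_smul]

theorem isNormalForm_of_equivariant (hΨ : ∀ (γ : Klein) (x : Punctured σ) (X : sl2),
      θ (eval σ (actPt σ γ x) (Ψ (1 ⊗ₜ[ℂ] X))) = ρ γ (θ (eval σ x (Ψ (1 ⊗ₜ[ℂ] X))))) :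
    IsNormalForm ρ σ (constAct σ θ (Ψ (1 ⊗ₜ[ℂ] hElt)))
      (constAct σ θ (Ψ (1 ⊗ₜ[ℂ] eElt))) (constAct σ θ (Ψ (1 ⊗ₜ[ℂ] fElt))) where
  linearIndependent := by
    rw [Fintype.linearIndependent_iff]
    intro g hg
    rw [Fin.sum_univ_three] at hg
    simp only [Matrix.cons_val, invariants_smul_eq] at hg
    rw [← constAct_curr, ← map_zero (constAct σ θ)] at hg
    have h0 : Ψ (curr (g 0 : regular σ) (g 1) (g 2)) = Ψ 0 := by
      rw [constAct_injective θ hg, map_zero]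
    have h1 : curr (g 0 : regular σ) (g 1) (g 2) = curr 0 0 0 := by
      rw [Ψ.injective h0]
      simp [curr]
    obtain ⟨h2, h3, h4⟩ := curr_injective h1
    intro i
    fin_cases i
    · exact Subtype.ext h2
    · exact Subtype.ext h3
    · exact Subtype.ext h4
  span_eq := by
    ext t
    rw [SetLike.mem_coe, Submodule.mem_span_triple, SetLike.mem_coe]
    constructor
    · rintro ⟨a, b, c, rfl⟩
      simp only [invariants_smul_eq]
      rw [← constAct_curr, constAct_curr_mem_automorphic hΨ]
      exact ⟨a.2, b.2, c.2⟩
    · intro ht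
      obtain ⟨s, rfl⟩ := constAct_surjective θ t
      obtain ⟨s, rfl⟩ : ∃ s', Ψ s' = s := Ψ.surjective s
      obtain ⟨a, b, c, rfl⟩ := exists_eq_curr s
      obtain ⟨ha, hb, hc⟩ := (constAct_curr_mem_automorphic hΨ).1 ht
      refine ⟨⟨a, ha⟩, ⟨b, hb⟩, ⟨c, hc⟩, ?_⟩
      simp only [invariants_smul_eq]
      rw [constAct_curr]
  lie_h_e := by rw [constAct_lie_tmul, lie_h_e, constAct_smul_tmul]
  lie_h_f := by rw [constAct_lie_tmul, lie_h_f, constAct_smul_tmul]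
  lie_e_f := by rw [constAct_lie_tmul, lie_e_f]

end Twist

/-! ### Isomorphisms of current algebras -/

/-- An isomorphism of algebras extends to the current algebras. -/
def currentCongr {R S : Type*} [CommRing R] [Algebra ℂ R] [CommRing S] [Algebra ℂ S]
    (e : R ≃ₐ[ℂ] S) : R ⊗[ℂ] sl2 ≃ₗ⁅ℂ⁆ S ⊗[ℂ] sl2 :=
  { LieAlgebra.ExtendScalars.map (e : R →ₐ[ℂ] S) (LieHom.id : sl2 →ₗ⁅ℂ⁆ sl2),
    TensorProduct.congr e.toLinearEquiv (LinearEquiv.refl ℂ sl2) with }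

/-- The inverse isomorphism is the restriction of `θ ∘ Ψ` to elements with invariant coefficients.
-/
theorem nonempty_automorphic_equiv {ρ : Klein →* LieAut} {Ψ : Current σ ≃ₗ⁅regular σ⁆ Current σ}
    {θ : LieAut} (hΨ : ∀ (γ : Klein) (x : Punctured σ) (X : sl2),
      θ (eval σ (actPt σ γ x) (Ψ (1 ⊗ₜ[ℂ] X))) = ρ γ (θ (eval σ x (Ψ (1 ⊗ₜ[ℂ] X))))) :
    Nonempty (automorphic ρ σ ≃ₗ⁅ℂ⁆ (invariants σ ⊗[ℂ] sl2)) := by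
  let ι : invariants σ ⊗[ℂ] sl2 →ₗ⁅ℂ⁆ Current σ :=
    LieAlgebra.ExtendScalars.map (invariants σ).val (LieHom.id : sl2 →ₗ⁅ℂ⁆ sl2)
  have hι : ∀ a b c : invariants σ, ι (a ⊗ₜ[ℂ] hElt + b ⊗ₜ[ℂ] eElt + c ⊗ₜ[ℂ] fElt) =
      curr (a : regular σ) b c := fun a b c => by
    rw [map_add, map_add]
    rfl
  let Θ : invariants σ ⊗[ℂ] sl2 →ₗ[ℂ] Current σ :=
    (constAct σ θ : Current σ →ₗ[ℂ] Current σ) ∘ₗ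
      (Ψ.toLinearEquiv.toLinearMap.restrictScalars ℂ) ∘ₗ (ι : invariants σ ⊗[ℂ] sl2 →ₗ[ℂ] Current σ)
  have hΘ : ∀ t, Θ t = constAct σ θ (Ψ (ι t)) := fun _ => rfl
  have hmem : ∀ t, Θ t ∈ (automorphic ρ σ).toSubmodule := by
    intro t
    obtain ⟨a, b, c, rfl⟩ := exists_eq_tmul_add t
    rw [hΘ, hι]
    exact (constAct_curr_mem_automorphic hΨ).2 ⟨a.2, b.2, c.2⟩
  let Θ' : invariants σ ⊗[ℂ] sl2 →ₗ[ℂ] automorphic ρ σ := Θ.codRestrict _ hmem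
  have hbij : Function.Bijective Θ' := by
    constructor
    · intro s t h
      have h1 : Θ s = Θ t := congrArg Subtype.val h
      obtain ⟨a, b, c, rfl⟩ := exists_eq_tmul_add s
      obtain ⟨a', b', c', rfl⟩ := exists_eq_tmul_add t
      rw [hΘ, hΘ, hι, hι] at h1
      obtain ⟨h2, h3, h4⟩ := curr_injective (Ψ.injective (constAct_injective θ h1))
      rw [Subtype.ext h2, Subtype.ext h3, Subtype.ext h4]
    · rintro ⟨t, ht⟩
      obtain ⟨s, rfl⟩ := constAct_surjective θ t
      obtain ⟨s, rfl⟩ : ∃ s', Ψ s' = s := Ψ.surjective s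
      obtain ⟨a, b, c, rfl⟩ := exists_eq_curr s
      obtain ⟨ha, hb, hc⟩ := (constAct_curr_mem_automorphic hΨ).1 ht
      refine ⟨(⟨a, ha⟩ : invariants σ) ⊗ₜ[ℂ] hElt + (⟨b, hb⟩ : invariants σ) ⊗ₜ[ℂ] eElt +
        (⟨c, hc⟩ : invariants σ) ⊗ₜ[ℂ] fElt, Subtype.ext ?_⟩
      change Θ _ = _
      rw [hΘ, hι]
  let e : invariants σ ⊗[ℂ] sl2 ≃ₗ[ℂ] automorphic ρ σ := LinearEquiv.ofBijective Θ' hbij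
  exact ⟨LieEquiv.symm { e with
    map_lie' := fun {s t} => Subtype.ext (by
      change constAct σ θ (Ψ (ι ⁅s, t⁆)) =
        ⁅constAct σ θ (Ψ (ι s)), constAct σ θ (Ψ (ι t))⁆
      rw [LieHom.map_lie, LieEquiv.map_lie, LieHom.map_lie]) }⟩

end ALia

/-! ### The constant automorphism `θ` and equivariance of `Ad(Ω)` -/

namespace ALia

open PeriodPair

attribute [local instance] instCommRingRegular instAddCommGroupCurrent instLieRingCurrent
  instLieAlgebraCurrent instBaseLieAlgebraCurrent

variable {L : PeriodPair} {σ : Klein →* TorusAut L}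

theorem eq_of_translation (hσ : Function.Injective σ) {γ δ : Klein} {b c : ℂ}
    (hγ : ∀ z, (σ γ : Equiv.Perm (Torus L)) (proj L z) = proj L (z + b))
    (hδ : ∀ z, (σ δ : Equiv.Perm (Torus L)) (proj L z) = proj L (z + c))
    (h : proj L b = proj L c) : γ = δ := by
  refine hσ (Subtype.ext (Equiv.ext fun x => ?_))
  obtain ⟨z, rfl⟩ := proj_surjective L x
  rw [hγ, hδ, proj_eq_proj]
  simpa using proj_eq_proj.1 h

theorem sigma_one_apply (σ : Klein →* TorusAut L) (z : ℂ) :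
    (σ 1 : Equiv.Perm (Torus L)) (proj L z) = proj L (z + 0) := by
  rw [map_one, add_zero]
  rfl

theorem sigma_mul_apply {γ δ : Klein} {b c : ℂ}
    (hγ : ∀ z, (σ γ : Equiv.Perm (Torus L)) (proj L z) = proj L (z + b))
    (hδ : ∀ z, (σ δ : Equiv.Perm (Torus L)) (proj L z) = proj L (z + c)) (z : ℂ) :
    (σ (γ * δ) : Equiv.Perm (Torus L)) (proj L z) = proj L (z + (b + c)) := by
  rw [map_mul, add_comm b, ← add_assoc, ← hγ, ← hδ]
  rfl

/-- A translation by a non-period comes from a nontrivial group element, on which the injective `ρ`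
is nontrivial. This supplies the nontriviality needed in `exists_conj_standard`. -/
theorem exists_rho_ne {ρ : Klein →* LieAut} (hρ : Function.Injective ρ) {γ : Klein} {b : ℂ}
    (hγ : ∀ z, (σ γ : Equiv.Perm (Torus L)) (proj L z) = proj L (z + b)) (hb : b ∉ L.lattice) :
    ∃ X, ρ γ X ≠ X := by
  by_contra! h
  have h1 : γ = 1 := hρ (by
    rw [map_one]
    exact LieEquiv.ext h)
  have h2 := hγ 0
  rw [h1, sigma_one_apply, proj_eq_proj] at h2
  exact hb (by simpa using h2)

/-- A constant automorphism which brings `ρ` into standard position. -/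
theorem exists_theta {ρ : Klein →* LieAut} (hρ : Function.Injective ρ)
    (hσ : Function.Injective σ) {γ₁ γ₂ : Klein}
    (h₁ : ∀ z, (σ γ₁ : Equiv.Perm (Torus L)) (proj L z) = proj L (z + L.ω₁ / 2))
    (h₂ : ∀ z, (σ γ₂ : Equiv.Perm (Torus L)) (proj L z) = proj L (z + L.ω₂ / 2)) :
    ∃ θ : LieAut, (IsStandard ρ σ → θ = 1) ∧ (∀ X, θ (conj₁ X) = ρ γ₁ (θ X)) ∧
      ∀ X, θ (conj₂ X) = ρ γ₂ (θ X) := by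
  -- The simultaneous conjugation is not unique, so in standard position the identity is chosen
  -- explicitly. There `γ₁` and `γ₂` coincide with `r₁` and `r₂`.
  by_cases hs : IsStandard ρ σ
  · refine ⟨1, fun _ => rfl, fun X => Subtype.ext ?_, fun X => Subtype.ext ?_⟩
    · rw [eq_of_translation hσ h₁ hs.sigma_r₁ rfl]
      exact (hs.rho_r₁ X).symm
    · rw [eq_of_translation hσ h₂ hs.sigma_r₂ rfl]
      exact (hs.rho_r₂ X).symm
  · have h₃ := sigma_mul_apply h₁ h₂
    obtain ⟨θ, hθ₁, hθ₂⟩ := exists_conj_standard (rho_apply_apply ρ γ₁) (rho_apply_apply ρ γ₂)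
      (fun X => by rw [← rho_mul_apply, ← rho_mul_apply, mul_comm])
      (exists_rho_ne hρ h₁ L.ω₁_div_two_notMem_lattice)
      (exists_rho_ne hρ h₂ L.ω₂_div_two_notMem_lattice) (by
        obtain ⟨X, hX⟩ := exists_rho_ne hρ h₃ (by rw [← add_div]; exact half₃_notMem L)
        exact ⟨X, by rwa [← rho_mul_apply]⟩)
    exact ⟨θ, fun h => absurd h hs, hθ₁, hθ₂⟩

/-- The translation rules for `adOmega` give the claim for `γ₁` and `γ₂`; every group element is
`1`, `γ₁`, `γ₂` or `γ₁ γ₂`. -/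
theorem equivariant_adOmega {ρ : Klein →* LieAut} (hσ : Function.Injective σ)
    (hg : QuotientHasGenusOne σ) {γ₁ γ₂ : Klein}
    (h₁ : ∀ z, (σ γ₁ : Equiv.Perm (Torus L)) (proj L z) = proj L (z + L.ω₁ / 2))
    (h₂ : ∀ z, (σ γ₂ : Equiv.Perm (Torus L)) (proj L z) = proj L (z + L.ω₂ / 2))
    {θ : LieAut} (hθ₁ : ∀ X, θ (conj₁ X) = ρ γ₁ (θ X)) (hθ₂ : ∀ X, θ (conj₂ X) = ρ γ₂ (θ X))
    {A B : ℂ} {Ψ : Current σ ≃ₗ⁅regular σ⁆ Current σ}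
    (hΨ : ∀ t z (hz : proj L z ∉ punctures σ),
      eval σ ⟨proj L z, hz⟩ (Ψ t) = adOmega L A B z (eval σ ⟨proj L z, hz⟩ t))
    (γ : Klein) (x : Punctured σ) (X : sl2) :
    θ (eval σ (actPt σ γ x) (Ψ (1 ⊗ₜ[ℂ] X))) = ρ γ (θ (eval σ x (Ψ (1 ⊗ₜ[ℂ] X)))) := by
  have heval : ∀ y : Punctured σ, eval σ y ((1 : regular σ) ⊗ₜ[ℂ] X) = X := fun y => by
    rw [eval_tmul]
    exact one_smul ℂ X
  have hΨ' : ∀ z (hz : proj L z ∉ punctures σ),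
      eval σ ⟨proj L z, hz⟩ (Ψ (1 ⊗ₜ[ℂ] X)) = adOmega L A B z X := fun z hz => by
    rw [hΨ, heval]
  have key : ∀ {δ : Klein} {b : ℂ},
      (∀ z, (σ δ : Equiv.Perm (Torus L)) (proj L z) = proj L (z + b)) →
      (∀ z, θ (adOmega L A B (z + b) X) = ρ δ (θ (adOmega L A B z X))) →
      ∀ x, θ (eval σ (actPt σ δ x) (Ψ (1 ⊗ₜ[ℂ] X))) =
        ρ δ (θ (eval σ x (Ψ (1 ⊗ₜ[ℂ] X)))) := by
    intro δ b hδ h x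
    obtain ⟨z, hz, rfl⟩ := punctured_eq x
    have hz' : proj L (z + b) ∉ punctures σ := by
      rw [← hδ]
      exact apply_notMem_punctures σ δ hz
    have hact : actPt σ δ ⟨proj L z, hz⟩ = ⟨proj L (z + b), hz'⟩ := Subtype.ext (hδ z)
    rw [hact, hΨ', hΨ', h]
  have k₁ := key h₁ fun z => by rw [adOmega_add_half₁, hθ₁]
  have k₂ := key h₂ fun z => by rw [adOmega_add_half₂, hθ₂]
  obtain ⟨b, hb, hγ⟩ := exists_translation hg γ
  rcases proj_half_mem hb with h | h | h | h
  · obtain rfl := eq_of_translation hσ hγ (sigma_one_apply σ) h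
    exact key (sigma_one_apply σ) (fun z => by rw [add_zero, rho_one_apply]) x
  · obtain rfl := eq_of_translation hσ hγ h₁ h
    exact k₁ x
  · obtain rfl := eq_of_translation hσ hγ h₂ h
    exact k₂ x
  · obtain rfl := eq_of_translation hσ hγ (sigma_mul_apply h₁ h₂) (by rw [h, add_div])
    rw [actPt_mul, k₁, k₂, ← rho_mul_apply]

end ALia

end

/-! ### The main theorem -/

open ALia
theorem mainTheorem5 (L : PeriodPair) (ρ : Klein →* LieAut) (σ : Klein →* TorusAut L)
    (hρ : Function.Injective ρ) (hσ : Function.Injective σ) (hg : QuotientHasGenusOne σ) :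
    -- the isomorphism type
    Nonempty (automorphic ρ σ ≃ₗ⁅ℂ⁆ (invariants σ ⊗[ℂ] sl2)) ∧
    (invariants σ).map (regular σ).val = wpHalfAlgebra σ ∧
    Nonempty (automorphic ρ σ ≃ₗ⁅ℂ⁆ (wpHalfAlgebra σ ⊗[ℂ] sl2)) ∧
    Nonempty (automorphic ρ σ ≃ₗ⁅ℂ⁆ CurrentC (half L)) ∧
    -- the ingredients of the matrix `Ω` exist, for every choice of the constants
    (∃ A B : ℂ, IsRootPair L A B) ∧
    (∀ A B : ℂ, IsRootPair L A B →
      sqrtαβ L A B ^ 2 = α₂ L * β₂ L ∧ ∃ ξm ξp : ℂ → ℂ, IsBranchPair L A B ξm ξp) ∧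
    -- the normal form, up to a constant automorphism `θ`, which is trivial in standard position
    ∃ θ : LieAut, (IsStandard ρ σ → θ = 1) ∧
      ∀ (A B : ℂ) (ξm ξp : ℂ → ℂ), IsRootPair L A B → IsBranchPair L A B ξm ξp →
        (∀ z ∉ (half L).lattice, (Omega L A B ξm ξp z).det = 1) ∧
        ∃ Ψ : Current σ ≃ₗ⁅regular σ⁆ Current σ,
          IsAdOmega σ A B ξm ξp Ψ ∧
          (∀ (γ : Klein) (x : Punctured σ) (X : sl2),
            θ (eval σ (actPt σ γ x) (Ψ (1 ⊗ₜ[ℂ] X))) =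
              ρ γ (θ (eval σ x (Ψ (1 ⊗ₜ[ℂ] X))))) ∧
          IsNormalForm ρ σ (constAct σ θ (Ψ (1 ⊗ₜ[ℂ] hElt)))
            (constAct σ θ (Ψ (1 ⊗ₜ[ℂ] eElt))) (constAct σ θ (Ψ (1 ⊗ₜ[ℂ] fElt))) := by
  obtain ⟨γ₁, h₁⟩ := exists_sigma_eq_translation hσ hg (half₁_add_self L)
  obtain ⟨γ₂, h₂⟩ := exists_sigma_eq_translation hσ hg (half₂_add_self L)
  -- `θ` depends on `ρ` and `σ` only and is fixed before `A`, `B` and the branches. For the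
  -- isomorphism type a single admissible pair `A`, `B` is enough.
  obtain ⟨θ, hθ, hθ₁, hθ₂⟩ := exists_theta hρ hσ h₁ h₂
  obtain ⟨A, B, hAB⟩ := exists_isRootPair L
  obtain ⟨Ψ, hΨ⟩ := exists_adOmega_equiv hσ hg hAB
  obtain ⟨i₁⟩ := nonempty_automorphic_equiv (equivariant_adOmega hσ hg h₁ h₂ hθ₁ hθ₂ hΨ)
  obtain ⟨i₂⟩ := nonempty_invariants_equiv hσ hg
  obtain ⟨i₃⟩ := nonempty_wpHalfAlgebra_equiv hσ hg
  refine ⟨⟨i₁⟩, invariants_map_eq hσ hg, ⟨i₁.trans (currentCongr i₂)⟩,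
    ⟨i₁.trans (currentCongr (i₂.trans i₃.symm))⟩, ⟨A, B, hAB⟩,
    fun A B h => ⟨sqrtαβ_sq h, exists_isBranchPair h⟩, θ, hθ, fun A B ξm ξp h hξ => ?_⟩
  obtain ⟨Ψ, hΨ⟩ := exists_adOmega_equiv hσ hg h
  have hequiv := equivariant_adOmega hσ hg h₁ h₂ hθ₁ hθ₂ hΨ
  refine ⟨fun z hz => det_Omega h hξ hz, Ψ, fun a z hz => ?_, hequiv,
    isNormalForm_of_equivariant hequiv⟩
  rw [hΨ]
  exact coe_adOmega h hξ (by rwa [← proj_mem_punctures hσ hg]) _
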